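/- Let $\sigma$ be normalized Lebesgue measure on the unit circle $\mathbb T$ and let $\|\cdot\|_r$ be the norm of $L^r(\mathbb T,\sigma)$. An inner function $I$ is a holomorphic function on the unit disc $\mathbb D$ with $|I|\le 1$ whose radial boundary values have modulus $1$ a.e.; it is called one-component if for some $\varepsilon\in(0,1)$ the level set $\{z\in\mathbb D:|I(z)|<\varepsilon\}$ is connected and non-empty. For $1\le r<\infty$ put $K^r_I=H^r\cap I\,\overline{H^r_0}$, where $H^r_0=zH^r$ (as spaces of functions on $\mathbb T$, with the $L^r$ norm; functions in $H^r$ are evaluated in $\mathbb D$ through their holomorphic extension), and put $k^I_a(z)=\dfrac{1-\overline{I(a)}I(z)}{1-\overline a z}$ for $a\in\mathbb D$. Write $E_a:f\mapsto f(a)$ for the point evaluation at $a$, as an element of the dual of the space in question. Let $I$ and $E$ be one-component inner functions and $J=IE$. Let $1\le s<p<\infty$, let $q$ be given by $\frac1s=\frac1p+\frac1q$, and let $p',s'\in(1,\infty]$ be the exponents conjugate to $p$ and $s$. Let $S\subset\mathbb D$ be a countable set which is dual bounded in $K^p_I$, i.e. the family $(E_a/\|E_a\|)_{a\in S}$ is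 uniformly minimal in $(K^p_I)^*$: there is $\delta>0$ such that for every $a\in S$ the distance of $E_a/\|E_a\|$ to the closed linear span of $\{E_b/\|E_b\|:b\in S,\ b\ne a\}$ is at least $\delta$. Let $(\rho_{p,a})_{a\in S}$ be a corresponding dual sequence: $\rho_{p,a}\in K^p_I$, $\sup_{a\in S}\|\rho_{p,a}\|_p<\infty$ and $\rho_{p,a}(b)=\delta_{ab}\|k^I_b\|_{p'}$ for $a,b\in S$. Let $(\epsilon_a)_{a\in S}$ be independent random variables with $\mathbb P(\epsilon_a=1)=\mathbb P(\epsilon_a=-1)=\frac12$. Suppose that: (i) $\|k^J_a\|_{s'}\simeq \dfrac{\|k^E_a\|_{s'}\,\|k^I_a\|_{p'}}{\|k^E_a\|_{p'}}$, with constants independent of $a\in S$; (ii) there is a constant $C$ such that for every $\lambda\in\ell^p(S)$ $$\mathbb E\Big[\Big\|\sum_{a\in S}\lambda_a\epsilon_a\rho_{p,a}\Big\|_p^p\Big]\le C\,\|\lambda\|_{\ell^p}^p$$ (when $S$ is infinite: for all finite partial sums, with one constant $C$); (iii) if $q>2$, then $S$ is weakly $q$-Carleson in $K^q_E$: there is $D>0$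 such that for every $\mu\in\ell^q(S)$ $$\Big\|\sum_{a\in S}|\mu_a|^2\,\frac{|k^E_a|^2}{\|k^E_a\|_q^2}\Big\|_{q/2}\le D\,\|\mu\|_{\ell^q}^2 .$$ Then $S$ is $K^s_J$-interpolating: for every family $(v_a)_{a\in S}$ of complex numbers with $(v_a/\|E_a\|_{(K^s_J)^*})_{a\in S}\in\ell^s(S)$ there is $f\in K^s_J$ with $f(a)=v_a$ for all $a\in S$. Moreover, there exists a bounded linear operator $T:\ell^s(S)\to K^s_J$ such that $$T(\nu)(a)=\nu_a\,\|k^J_a\|_{s'}\qquad(\nu\in\ell^s(S),\ a\in S).$$ -/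

import Mathlib

open MeasureTheory ProbabilityTheory Filter Topology AddCircle
open scoped ENNReal NNReal ComplexConjugate

noncomputable section

namespace ModelSpace

/-! ### The unit circle

The unit circle is parametrised by `t ∈ ℝ/ℤ` through `ζ t = exp (2π i t)`; `σ` is normalised
Lebesgue measure. -/

/-- The point `exp (2π i t)` of the unit circle. -/
def ζ (t : UnitAddCircle) : ℂ := (AddCircle.toCircle t : ℂ)

/-- Normalised Lebesgue measure on the circle. -/
abbrev σ : Measure UnitAddCircle := haarAddCircle

/-! ### Inner functions -/

/-- The radial boundary function `ζ ↦ lim_{r → 1⁻} I (r ζ)`. -/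
def bdry (I : ℂ → ℂ) (t : UnitAddCircle) : ℂ :=
  limUnder (𝓝[<] (1 : ℝ)) (fun r : ℝ => I ((r : ℂ) * ζ t))

/-- Inner functions: holomorphic on the open unit disc, bounded by `1` there, with radial limits
of modulus one almost everywhere. The values of `I` outside the open disc are irrelevant. -/
structure IsInner (I : ℂ → ℂ) : Prop where
  differentiableOn : DifferentiableOn ℂ I (Metric.ball 0 1)
  norm_le_one : ∀ z ∈ Metric.ball (0 : ℂ) 1, ‖I z‖ ≤ 1
  norm_bdry : ∀ᵐ t ∂σ, ∃ w : ℂ, ‖w‖ = 1 ∧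
    Tendsto (fun r : ℝ => I ((r : ℂ) * ζ t)) (𝓝[<] (1 : ℝ)) (𝓝 w)

/-- Some level set `{z ∈ 𝔻 : |I z| < ε}`, `0 < ε < 1`, is connected (and non-empty, which for
inner functions only excludes the unimodular constants). -/
def IsOneComponent (I : ℂ → ℂ) : Prop :=
  ∃ ε : ℝ, 0 < ε ∧ ε < 1 ∧ IsConnected {z : ℂ | z ∈ Metric.ball (0 : ℂ) 1 ∧ ‖I z‖ < ε}

/-! ### Hardy spaces on the circle and backward shift invariant subspaces -/

theorem fourierCoeff_smul_Lp (p : ℝ≥0∞) (c : ℂ) (f : Lp ℂ p σ) (n : ℤ) :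
    fourierCoeff (c • f : Lp ℂ p σ) n = c * fourierCoeff f n := by
  rw [fourierCoeff_congr_ae (Lp.coeFn_smul c f), fourierCoeff.const_smul]
  rfl

section Spaces

variable (p : ℝ≥0∞) [Fact (1 ≤ p)]

theorem integrable_Lp (f : Lp ℂ p σ) : Integrable (f : UnitAddCircle → ℂ) σ :=
  (Lp.memLp f).integrable Fact.out

theorem fourierCoeff_add_Lp (f g : Lp ℂ p σ) (n : ℤ) :
    fourierCoeff (f + g : Lp ℂ p σ) n = fourierCoeff f n + fourierCoeff g n := by
  rw [fourierCoeff_congr_ae (Lp.coeFn_add f g),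
    fourierCoeff.add (integrable_Lp p f) (integrable_Lp p g)]
  rfl

theorem fourierCoeff_zero_Lp (n : ℤ) : fourierCoeff (0 : Lp ℂ p σ) n = 0 := by
  simpa using fourierCoeff_smul_Lp p 0 (0 : Lp ℂ p σ) n

/-- Functions in `L^p` of the circle whose Fourier coefficients of index `< m` vanish. -/
def hardyFrom (m : ℤ) : Submodule ℂ (Lp ℂ p σ) where
  carrier := {f | ∀ n : ℤ, n < m → fourierCoeff f n = 0}
  add_mem' := fun {f g} hf hg n hn => by
    rw [fourierCoeff_add_Lp, hf n hn, hg n hn, add_zero]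
  zero_mem' := fun n _ => fourierCoeff_zero_Lp p n
  smul_mem' := fun c f hf n hn => by
    rw [fourierCoeff_smul_Lp, hf n hn, mul_zero]

/-- The Hardy space `H^p` as a space of functions on the circle. -/
abbrev hardy : Submodule ℂ (Lp ℂ p σ) := hardyFrom p 0

/-- The space `H^p_0 = z H^p`. -/
abbrev hardyZero : Submodule ℂ (Lp ℂ p σ) := hardyFrom p 1

/-- The space `K^p_I`, the intersection of `H^p` with `I` times the conjugates of `H^p_0`,
as a space of functions on the circle, with the `L^p` norm. -/
def K (I : ℂ → ℂ) : Submodule ℂ (Lp ℂ p σ) where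
  carrier := {f | f ∈ hardy p ∧ ∃ g ∈ hardyZero p, ∀ᵐ t ∂σ, f t = bdry I t * conj (g t)}
  add_mem' := by
    rintro f₁ f₂ ⟨h₁, g₁, hg₁, e₁⟩ ⟨h₂, g₂, hg₂, e₂⟩
    refine ⟨add_mem h₁ h₂, g₁ + g₂, add_mem hg₁ hg₂, ?_⟩
    filter_upwards [e₁, e₂, Lp.coeFn_add f₁ f₂, Lp.coeFn_add g₁ g₂] with t a b c d
    rw [c, d, Pi.add_apply, Pi.add_apply, a, b, map_add, mul_add]
  zero_mem' := by
    refine ⟨zero_mem _, 0, zero_mem _, ?_⟩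
    filter_upwards [Lp.coeFn_zero ℂ p σ] with t a
    rw [a, Pi.zero_apply, map_zero, mul_zero]
  smul_mem' := by
    rintro c f ⟨h, g, hg, e⟩
    refine ⟨Submodule.smul_mem _ c h, conj c • g, Submodule.smul_mem _ _ hg, ?_⟩
    filter_upwards [e, Lp.coeFn_smul c f, Lp.coeFn_smul (conj c) g] with t a b d
    rw [b, d, Pi.smul_apply, Pi.smul_apply, a]
    simp only [smul_eq_mul, map_mul, Complex.conj_conj]
    ring

/-! ### Point evaluations -/

theorem norm_ζ (t : UnitAddCircle) : ‖ζ t‖ = 1 := Circle.norm_coe _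

theorem continuous_ζ : Continuous ζ := continuous_subtype_val.comp AddCircle.continuous_toCircle

theorem one_sub_ne_zero (a : Complex.UnitDisc) (t : UnitAddCircle) :
    1 - (a : ℂ) * conj (ζ t) ≠ 0 := by
  intro h
  have h1 : (a : ℂ) * conj (ζ t) = 1 := (sub_eq_zero.1 h).symm
  have h2 := congrArg norm h1
  rw [norm_mul, RCLike.norm_conj, norm_ζ, mul_one, norm_one] at h2
  exact a.norm_ne_one h2

theorem continuous_cauchy (a : Complex.UnitDisc) :
    Continuous fun t : UnitAddCircle => (1 - (a : ℂ) * conj (ζ t))⁻¹ :=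
  (continuous_const.sub (continuous_const.mul
    (Complex.continuous_conj.comp continuous_ζ))).inv₀ (one_sub_ne_zero a)

theorem cauchy_bound (a : Complex.UnitDisc) (t : UnitAddCircle) :
    ‖(1 - (a : ℂ) * conj (ζ t))⁻¹‖ ≤ (1 - ‖(a : ℂ)‖)⁻¹ := by
  rw [norm_inv]
  have ha := a.norm_lt_one
  apply inv_anti₀ (by linarith)
  have h := norm_sub_norm_le (1 : ℂ) ((a : ℂ) * conj (ζ t))
  rwa [norm_one, norm_mul, RCLike.norm_conj, norm_ζ, mul_one] at h

theorem integrable_cauchy (a : Complex.UnitDisc) (f : Lp ℂ p σ) :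
    Integrable (fun t => f t * (1 - (a : ℂ) * conj (ζ t))⁻¹) σ := by
  refine (integrable_Lp p f).mul_bdd (c := (1 - ‖(a : ℂ)‖)⁻¹)
    (continuous_cauchy a).aestronglyMeasurable (ae_of_all _ (cauchy_bound a))

theorem integral_norm_le (f : Lp ℂ p σ) : ∫ t, ‖f t‖ ∂σ ≤ ‖f‖ := by
  rw [integral_norm_eq_lintegral_enorm (Lp.aestronglyMeasurable f), Lp.norm_def,
    ← eLpNorm_one_eq_lintegral_enorm]
  exact ENNReal.toReal_mono (Lp.eLpNorm_ne_top f)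
    (eLpNorm_le_eLpNorm_of_exponent_le Fact.out (Lp.aestronglyMeasurable f))

/-- The Cauchy integral `f ↦ ∫ f(ζ) / (1 - a ζ̄) dσ(ζ)` at a point `a` of the disc. For `f ∈ H^p`
it equals `∑ f̂(n) aⁿ`, the value at `a` of the holomorphic extension of `f` to the disc. -/
def cauchyAt (a : Complex.UnitDisc) : Lp ℂ p σ →L[ℂ] ℂ :=
  LinearMap.mkContinuous
    { toFun := fun f => ∫ t, f t * (1 - (a : ℂ) * conj (ζ t))⁻¹ ∂σ
      map_add' := fun f g => by
        rw [← integral_add (integrable_cauchy p a f) (integrable_cauchy p a g)]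
        refine integral_congr_ae ?_
        filter_upwards [Lp.coeFn_add f g] with t ht
        rw [ht, Pi.add_apply, add_mul]
      map_smul' := fun c f => by
        rw [RingHom.id_apply, ← integral_smul]
        refine integral_congr_ae ?_
        filter_upwards [Lp.coeFn_smul c f] with t ht
        rw [ht, Pi.smul_apply, smul_mul_assoc] }
    ((1 - ‖(a : ℂ)‖)⁻¹)
    (fun f => by
      have ha : 0 ≤ (1 - ‖(a : ℂ)‖)⁻¹ := inv_nonneg.2 (sub_nonneg.2 a.norm_lt_one.le)
      refine (norm_integral_le_integral_norm _).trans ?_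
      refine le_trans ?_ (mul_le_mul_of_nonneg_left (integral_norm_le p f) ha)
      rw [← integral_const_mul]
      refine integral_mono (integrable_cauchy p a f).norm
        ((integrable_Lp p f).norm.const_mul _) fun t => ?_
      change ‖f t * _‖ ≤ _ * ‖f t‖
      rw [norm_mul, mul_comm]
      exact mul_le_mul_of_nonneg_right (cauchy_bound a t) (norm_nonneg _))

/-- The point evaluation `E_a : f ↦ f(a)` as an element of the dual of `K^p_I`. -/
def eval (I : ℂ → ℂ) (a : Complex.UnitDisc) : StrongDual ℂ (K p I) :=
  (cauchyAt p a).comp (K p I).subtypeL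

end Spaces

/-! ### Reproducing kernels -/

/-- Boundary function of the reproducing kernel
`k_a^I(z) = (1 - conj (I a) I z) / (1 - conj a z)`. -/
def kernel (I : ℂ → ℂ) (a : Complex.UnitDisc) (t : UnitAddCircle) : ℂ :=
  (1 - conj (I a) * bdry I t) / (1 - conj (a : ℂ) * ζ t)

/-- The norm `‖k_a^I‖_r`. -/
def kernelNorm (I : ℂ → ℂ) (r : ℝ≥0∞) (a : Complex.UnitDisc) : ℝ :=
  (eLpNorm (kernel I a) r σ).toReal

/-- The normalised kernel `k_{r,a}^I = k_a^I / ‖k_a^I‖_r`. -/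
def normalizedKernel (I : ℂ → ℂ) (r : ℝ≥0∞) (a : Complex.UnitDisc) (t : UnitAddCircle) : ℂ :=
  kernel I a t / (kernelNorm I r a : ℂ)

/-! ### Uniform minimality, dual boundedness, interpolation, Carleson conditions -/

/-- `inf_n dist (x_n, closed span of {x_k : k ≠ n}) > 0`. -/
def UniformlyMinimal {ι X : Type*} [NormedAddCommGroup X] [NormedSpace ℂ X] (x : ι → X) : Prop :=
  ∃ δ : ℝ, 0 < δ ∧ ∀ n : ι, δ ≤ Metric.infDist (x n)
    ((Submodule.span ℂ (x '' {m | m ≠ n})).topologicalClosure : Set X)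

/-- `S` is dual bounded in `K^p_I`: the normalised point evaluations `E_a / ‖E_a‖`, `a ∈ S`, are
uniformly minimal in the dual of `K^p_I`. -/
def DualBounded (p : ℝ≥0∞) [Fact (1 ≤ p)] (I : ℂ → ℂ) (S : Set Complex.UnitDisc) : Prop :=
  UniformlyMinimal fun a : S => ((‖eval p I a‖⁻¹ : ℝ) : ℂ) • eval p I a

/-- `ρ` is a dual sequence of `(k_a^I / ‖k_a^I‖_{p'})_{a ∈ S}`: a bounded family in `K^p_I` with
`ρ_a(b) = δ_{ab} ‖k_b^I‖_{p'}`. -/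
structure IsDualSequence (p p' : ℝ≥0∞) [Fact (1 ≤ p)] (I : ℂ → ℂ) (S : Set Complex.UnitDisc)
    (ρ : S → K p I) : Prop where
  eval_self : ∀ a : S, eval p I a (ρ a) = (kernelNorm I p' a : ℂ)
  eval_of_ne : ∀ a b : S, a ≠ b → eval p I b (ρ a) = 0
  bounded : ∃ C : ℝ, ∀ a : S, ‖ρ a‖ ≤ C

/-- `S` is `K^s_J`-interpolating: every `v` with `(v_a / ‖E_a‖)_{a ∈ S} ∈ ℓ^s` is the restriction
to `S` of a function in `K^s_J`. -/
def IsInterpolating (s : ℝ≥0∞) [Fact (1 ≤ s)] (J : ℂ → ℂ) (S : Set Complex.UnitDisc) : Prop :=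
  ∀ v : S → ℂ, Memℓp (fun a : S => v a / (‖eval s J a‖ : ℂ)) s →
    ∃ f : K s J, ∀ a : S, eval s J a f = v a

/-- `S` is weakly `q`-Carleson in `K^q_E`: `‖∑ |μ_a|² |k_{q,a}^E|²‖_{q/2} ≤ D ‖μ‖_q²` for all
`μ ∈ ℓ^q`; the sum of non-negative terms is taken in `[0, ∞]`. -/
def WeaklyCarleson (q : ℝ≥0∞) (E : ℂ → ℂ) (S : Set Complex.UnitDisc) : Prop :=
  ∃ D : ℝ, 0 < D ∧ ∀ μ : lp (fun _ : S => ℂ) q,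
    eLpNorm (fun t => ∑' a : S, ‖μ a‖ₑ ^ 2 * ‖normalizedKernel E q a t‖ₑ ^ 2) (q / 2) σ ≤
      ENNReal.ofReal (D * ‖μ‖ ^ 2)

/-- Independent symmetric Bernoulli variables with values `±1`. -/
structure IsBernoulliSigns {ι Ω : Type*} [MeasurableSpace Ω] (P : Measure Ω)
    (ε : ι → Ω → ℝ) : Prop where
  measurable : ∀ i, Measurable (ε i)
  prob_one : ∀ i, P {ω | ε i ω = 1} = 1 / 2
  prob_neg_one : ∀ i, P {ω | ε i ω = -1} = 1 / 2
  indep : iIndepFun ε P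

/-- The random sign bound `𝔼 ‖∑_{a ∈ S} λ_a ε_a ρ_a‖^p ≲ ‖λ‖_p^p` for all `λ ∈ ℓ^p(S)`, read as a
bound on all finite partial sums with one constant. -/
def RandomSignBound {ι Ω X : Type*} [MeasurableSpace Ω] [NormedAddCommGroup X] [NormedSpace ℂ X]
    (P : Measure Ω) (ε : ι → Ω → ℝ) (p : ℝ≥0∞) (ρ : ι → X) : Prop :=
  ∃ C : ℝ, 0 < C ∧ ∀ (l : lp (fun _ : ι => ℂ) p) (F : Finset ι),
    ∫ ω, ‖∑ a ∈ F, (l a * (ε a ω : ℂ)) • ρ a‖ ^ p.toReal ∂P ≤ C * ‖l‖ ^ p.toReal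

/-- Comparability `u ≃ v` of real families, uniformly in the index. -/
def Comparable {ι : Type*} (u v : ι → ℝ) : Prop :=
  ∃ c C : ℝ, 0 < c ∧ 0 < C ∧ ∀ i, c * v i ≤ u i ∧ u i ≤ C * v i

end ModelSpace

end

noncomputable section
namespace ModelSpace

/-! ### Crossing curves in a square and the two-constant estimate -/

/-! For `a ∈ S` put `x_a = c_a ρ_a k_a^E` with `c_a = ‖k_a^J‖_{s'} / (‖k_a^I‖_{p'} k_a^E(a))`. A
function in `K^p_I` times a kernel of `E` lies in `K^s_J`, and `x_a` equals `‖k_a^J‖_{s'}` at `a`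
and `0` on the rest of `S` (`exists_interpolating_family`). So `T ν = ∑ ν_a x_a` has the right
values once `‖∑ ν_a x_a‖_s ≲ ‖ν‖_s` for finite sums. Interpolation follows because `‖E_a‖ ≤
‖k_a^J‖_{s'}`.

For the estimate, factor `ν = λ μ` with `|λ|^p = |μ|^q = |ν|^s`. Orthonormality of the signs gives,
pointwise on the circle, `∑ ν_a x_a = 𝔼 [(∑ ε_a λ_a ρ_a) (∑ ε_a μ_a c_a k_a^E)]`. Hölder over the
signs (exponents `p`, `p'`) and then on the circle (`1/s = 1/p + 1/q`) separates the factors. The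
first is condition (ii). Khinchin turns the second into the `L^q` norm of `(∑ |μ_a c_a
k_a^E|²)^{1/2}`, controlled by (iii) if `q > 2` and by `ℓ^q ⊂ ℓ²` if `q ≤ 2`, provided `c_a
‖k_a^E‖_q` is bounded (`RandomSignBound.exists_eLpNorm_sum_mul_le`, `exists_norm_sum_smul_le`).

By (i) this boundedness reduces to `‖k_a^E‖_{s'} ‖k_a^E‖_q ≲ ‖k_a^E‖_{p'} N` with `N = k_a^E(a)`
(`exists_kernelNorm_mul_le`). For a one-component `E`, `‖k_a^E‖_r ≲ N^{1-1/r}` for all `r > 1`;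
Hölder in `‖k_a^E‖_2² = N` then gives `‖k_a^E‖_{p'} ≳ N^{1/p}`, and the exponents add up.

The upper bounds follow from `|k_a^E| ≲ N` together with the decay of `k_a^E` away from `u = a/|a|`.
The sup bound is `exists_kernel_bound_of_isOneComponent`. If `1 - |E a|²` is small, the connected
set `{|E| < ε}` stays at distance `R ≳ (1-|a|)/(1-|E a|²)` from `u`: otherwise it would cross an
annulus around `u`, and a two-constant estimate with Schwarz–Pick would contradict the size of `|E
a|`. On the remaining disc `|E| ≥ ε`, and a reflection argument makes `E` Lipschitz near `u` with
constant of order `1/R`. -/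

theorem exists_int_mem_of_sin_nonneg {θ : ℝ → ℝ} (hθ : Continuous θ)
    (h : ∀ s, 0 ≤ Real.sin (θ s)) :
    ∃ k : ℤ, ∀ s, 2 * Real.pi * k ≤ θ s ∧ θ s ≤ 2 * Real.pi * k + Real.pi := by
  have hpi := Real.pi_pos
  set k : ℤ := ⌊θ 0 / (2 * Real.pi)⌋
  have h1 : 2 * Real.pi * k ≤ θ 0 := by
    have := Int.floor_le (θ 0 / (2 * Real.pi))
    rw [le_div_iff₀ (by positivity)] at this
    linarith
  have h2 : θ 0 < 2 * Real.pi * k + 2 * Real.pi := by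
    have := Int.lt_floor_add_one (θ 0 / (2 * Real.pi))
    rw [div_lt_iff₀ (by positivity)] at this
    linarith
  -- At both points the sine is `-1`, so the range of `θ`, an interval, cannot get past either of
  -- them.
  have key : ∀ s, θ s ≠ 2 * Real.pi * k - Real.pi / 2 ∧ θ s ≠ 2 * Real.pi * k + 3 * Real.pi / 2 := by
    intro s
    constructor
    · intro e
      have := h s
      rw [e, show 2 * Real.pi * k - Real.pi / 2 = -(Real.pi / 2) + k * (2 * Real.pi) by ring,
        Real.sin_add_int_mul_two_pi, Real.sin_neg, Real.sin_pi_div_two] at this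
      linarith
    · intro e
      have := h s
      rw [e, show 2 * Real.pi * k + 3 * Real.pi / 2 = Real.pi / 2 + Real.pi + k * (2 * Real.pi) by
        ring, Real.sin_add_int_mul_two_pi, Real.sin_add_pi, Real.sin_pi_div_two] at this
      linarith
  have range : ∀ s, 2 * Real.pi * k - Real.pi / 2 < θ s ∧ θ s < 2 * Real.pi * k + 3 * Real.pi / 2 := by
    have hconn : (Set.range θ).OrdConnected := (isPreconnected_range hθ).ordConnected
    have h0 : θ 0 < 2 * Real.pi * k + 3 * Real.pi / 2 := by
      by_contra! hc
      have hs := h 0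
      have : Real.sin (θ 0 - k * (2 * Real.pi)) < 0 := by
        rw [← Real.sin_sub_two_pi]
        apply Real.sin_neg_of_neg_of_neg_pi_lt <;> nlinarith
      rw [Real.sin_sub_int_mul_two_pi] at this
      linarith
    intro s
    constructor
    · by_contra! hc
      obtain ⟨s', hs'⟩ := hconn.out (Set.mem_range_self s) (Set.mem_range_self 0)
        ⟨hc, by linarith⟩
      exact (key s').1 hs'
    · by_contra! hc
      obtain ⟨s', hs'⟩ := hconn.out (Set.mem_range_self 0) (Set.mem_range_self s)
        ⟨h0.le, hc⟩
      exact (key s').2 hs'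
  refine ⟨k, fun s => ⟨?_, ?_⟩⟩
  · by_contra! hc
    have := h s
    have h3 : Real.sin (θ s - k * (2 * Real.pi)) < 0 := by
      apply Real.sin_neg_of_neg_of_neg_pi_lt <;> linarith [range s]
    rw [Real.sin_sub_int_mul_two_pi] at h3
    linarith
  · by_contra! hc
    have := h s
    have h3 : Real.sin (θ s - k * (2 * Real.pi)) < 0 := by
      rw [← Real.sin_sub_two_pi]
      apply Real.sin_neg_of_neg_of_neg_pi_lt <;> linarith [range s]
    rw [Real.sin_sub_int_mul_two_pi] at h3
    linarith

/-- A curve from left to right and a curve from bottom to top must meet. -/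
theorem exists_eq_of_crossing {γ δ : ℝ → ℂ} (hγ : Continuous γ) (hδ : Continuous δ)
    (hγ₀ : ∀ t, (γ 0).re ≤ (δ t).re) (hγ₁ : ∀ t, (δ t).re ≤ (γ 1).re)
    (hδ₀ : ∀ s, (δ 0).im ≤ (γ s).im) (hδ₁ : ∀ s, (γ s).im ≤ (δ 1).im) :
    ∃ s t, γ s = δ t := by
  by_contra! hne
  have hpi := Real.pi_pos
  have hU : IsSimplyConnected (Set.univ : Set (ℝ × ℝ)) :=
    (Homeomorph.Set.univ (ℝ × ℝ)).toHomotopyEquiv.simplyConnectedSpace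
  -- If the curves never met, `γ s - δ t` would have a continuous logarithm on the plane of
  -- parameters. On each side of the unit square of parameters its argument is confined to a half
  -- turn, and these half turns go once around the origin, which a continuous argument cannot do.
  obtain ⟨L, hLc, hL⟩ := Complex.exists_continuousOn_eqOn_exp_comp hU isOpen_univ
    (g := fun x : ℝ × ℝ => γ x.1 - δ x.2) (by fun_prop)
    (by rintro ⟨x, -, hx⟩; exact hne _ _ (sub_eq_zero.1 hx))
  rw [continuousOn_univ] at hLc
  have hre : ∀ s t, (γ s).re - (δ t).re = Real.exp (L (s, t)).re * Real.cos (L (s, t)).im := by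
    intro s t
    rw [← Complex.exp_re, ← Complex.sub_re]
    exact congrArg Complex.re (hL (Set.mem_univ (s, t))).symm
  have him : ∀ s t, (γ s).im - (δ t).im = Real.exp (L (s, t)).re * Real.sin (L (s, t)).im := by
    intro s t
    rw [← Complex.exp_im, ← Complex.sub_im]
    exact congrArg Complex.im (hL (Set.mem_univ (s, t))).symm
  obtain ⟨k₁, h₁⟩ := exists_int_mem_of_sin_nonneg (θ := fun s => (L (s, 0)).im) (by fun_prop)
    (fun s => by
      have := him s 0
      have h2 := hδ₀ s
      exact (mul_nonneg_iff_of_pos_left (Real.exp_pos _)).1 (this ▸ sub_nonneg.2 h2))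
  obtain ⟨k₂, h₂⟩ := exists_int_mem_of_sin_nonneg (θ := fun t => (L (1, t)).im + Real.pi / 2)
    (by fun_prop)
    (fun t => by
      have := hre 1 t
      have h2 := hγ₁ t
      rw [Real.sin_add_pi_div_two]
      exact (mul_nonneg_iff_of_pos_left (Real.exp_pos _)).1 (this ▸ sub_nonneg.2 h2))
  obtain ⟨k₃, h₃⟩ := exists_int_mem_of_sin_nonneg (θ := fun s => (L (s, 1)).im + Real.pi)
    (by fun_prop)
    (fun s => by
      have := him s 1
      have h2 := hδ₁ s
      rw [Real.sin_add_pi]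
      refine (mul_nonneg_iff_of_pos_left (Real.exp_pos (L (s, 1)).re)).1 ?_
      linarith)
  obtain ⟨k₄, h₄⟩ := exists_int_mem_of_sin_nonneg (θ := fun t => (L (0, t)).im - Real.pi / 2)
    (by fun_prop)
    (fun t => by
      have := hre 0 t
      have h2 := hγ₀ t
      rw [Real.sin_sub_pi_div_two]
      refine (mul_nonneg_iff_of_pos_left (Real.exp_pos (L (0, t)).re)).1 ?_
      linarith)
  have aux : ∀ (k l : ℤ) (x y : ℝ), x < 2 * Real.pi → y < 2 * Real.pi →
      2 * Real.pi * k ≤ 2 * Real.pi * l + x → 2 * Real.pi * l ≤ 2 * Real.pi * k + y → k = l := by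
    intro k l x y hx hy h h'
    have a : (k : ℝ) < l + 1 := by nlinarith
    have b : (l : ℝ) < k + 1 := by nlinarith
    have a' : k < l + 1 := by exact_mod_cast a
    have b' : l < k + 1 := by exact_mod_cast b
    omega
  -- Consecutive sides share a corner, so their half turns belong to the same branch. At the
  -- remaining corner `(0, 1)` the argument would be both at most `2πk` and at least `2πk + π/2`.
  have e₁ : k₁ = k₂ := aux _ _ (Real.pi / 2) (3 * Real.pi / 2) (by linarith) (by linarith)
    (by linarith [h₁ 1, h₂ 0]) (by linarith [h₁ 1, h₂ 0])
  have e₂ : k₂ = k₃ := aux _ _ (Real.pi / 2) (3 * Real.pi / 2) (by linarith) (by linarith)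
    (by linarith [h₂ 1, h₃ 1]) (by linarith [h₂ 1, h₃ 1])
  have e₄ : k₄ = k₁ := aux _ _ (Real.pi / 2) (3 * Real.pi / 2) (by linarith) (by linarith)
    (by linarith [h₁ 0, h₄ 0]) (by linarith [h₁ 0, h₄ 0])
  subst e₁ e₂ e₄
  have a1 := h₃ 0
  have a2 := h₄ 1
  linarith


/-- If `F` is holomorphic and bounded by `1` on the strip `|Im z| < 1` and bounded by `c` on a curve
crossing the square `(-1, 1)²` from left to right, then `|F 0|⁴ ≤ c`. -/
theorem norm_pow_four_le_of_crossing {F : ℂ → ℂ}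
    (hF : DifferentiableOn ℂ F {z | |z.im| < 1}) (hF₁ : ∀ z : ℂ, |z.im| < 1 → ‖F z‖ ≤ 1)
    {c : ℝ} {x y : ℂ} (γ : Path x y) (hx : x.re ≤ -1) (hy : 1 ≤ y.re)
    (hγ : ∀ s, |(γ s).im| < 1) (hγc : ∀ s, ‖F (γ s)‖ ≤ c) : ‖F 0‖ ^ 4 ≤ c := by
  have hopen : IsOpen {z : ℂ | |z.im| < 1} :=
    isOpen_lt (continuous_abs.comp Complex.continuous_im) continuous_const
  -- The closed square of half-side `r < 1` lies inside the domain of `G` below, and `γ` still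
  -- crosses it between its top and bottom sides.
  obtain ⟨r, hr0, hr1, hγr⟩ : ∃ r : ℝ, 0 < r ∧ r < 1 ∧ ∀ s, |(γ s).im| ≤ r := by
    obtain ⟨s₀, -, hs₀⟩ := isCompact_univ.exists_isMaxOn (f := fun s => |(γ s).im|)
      Set.univ_nonempty (Continuous.continuousOn (by fun_prop))
    refine ⟨max (1 / 2) |(γ s₀).im|, by positivity, max_lt (by norm_num) (hγ s₀), fun s => ?_⟩
    exact le_max_of_le_right (hs₀ (Set.mem_univ s))
  -- The product over the four quarter turns satisfies `|G| ≤ |F|` on the square and is invariant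
  -- under rotation by `i`, so reaching one side of the square is the same as reaching any other.
  set G : ℂ → ℂ := fun z => F z * F (Complex.I * z) * (F (-z) * F (-(Complex.I * z))) with hG
  have hG0 : ‖G 0‖ = ‖F 0‖ ^ 4 := by simp [hG]; ring
  set Q : Set ℂ := {z | |z.re| < 1 ∧ |z.im| < 1} with hQ
  have hGd : ∀ z ∈ Q, DifferentiableAt ℂ G z := by
    rintro z ⟨h1, h2⟩
    have hd : ∀ w : ℂ, |w.im| < 1 → DifferentiableAt ℂ F w := fun w hw =>
      hF.differentiableAt (hopen.mem_nhds hw)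
    refine ((hd z h2).mul ?_).mul (DifferentiableAt.mul ?_ ?_)
    · exact DifferentiableAt.comp z (hd _ (by simpa using h1)) (by fun_prop)
    · exact DifferentiableAt.comp z (hd _ (by simpa using h2)) (by fun_prop)
    · exact DifferentiableAt.comp z (hd _ (by simpa using h1)) (by fun_prop)
  have hGF : ∀ z ∈ Q, ‖G z‖ ≤ ‖F z‖ := by
    rintro z ⟨h1, h2⟩
    have a1 := hF₁ (Complex.I * z) (by simpa using h1)
    have a2 := hF₁ (-z) (by simpa using h2)
    have a3 := hF₁ (-(Complex.I * z)) (by simpa using h1)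
    rw [hG]
    simp only [norm_mul]
    calc ‖F z‖ * ‖F (Complex.I * z)‖ * (‖F (-z)‖ * ‖F (-(Complex.I * z))‖)
        ≤ ‖F z‖ * 1 * (1 * 1) := by gcongr
      _ = ‖F z‖ := by ring
  have hGI : ∀ z, G (Complex.I * z) = G z := by
    intro z
    have : Complex.I * (Complex.I * z) = -z := by rw [← mul_assoc, Complex.I_mul_I]; ring
    simp only [hG, this, neg_neg]
    ring
  rw [← hG0]
  by_contra! hcon
  set B : Set ℂ := {z | |z.re| ≤ r ∧ |z.im| ≤ r ∧ c < ‖G z‖} with hB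
  have hBI : ∀ {z w : ℂ}, JoinedIn B z w → JoinedIn B (Complex.I * z) (Complex.I * w) := by
    intro z w h
    refine (h.map (f := fun z => Complex.I * z) (by fun_prop)).mono ?_
    rintro _ ⟨v, ⟨h1, h2, h3⟩, rfl⟩
    exact ⟨by simpa using h2, by simpa using h1, by rwa [hGI]⟩
  -- A path in `B` from the centre to the top side, joined to its half turn, runs from bottom to
  -- top. It meets `γ`, where `|G| ≤ |F| ≤ c`.
  have htop : ∀ z : ℂ, JoinedIn B 0 z → z.im ≠ r := by
    intro z hz him
    have hz' : JoinedIn B (-z) z := by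
      have := hBI (hBI hz)
      rw [← mul_assoc, ← mul_assoc, Complex.I_mul_I, mul_zero, neg_one_mul] at this
      exact this.symm.trans hz
    set δ := hz'.somePath
    have hδ : ∀ t, δ.extend t ∈ B := fun t => hz'.somePath_mem _
    have hγe : ∀ t, |(γ.extend t).im| ≤ r := fun t => hγr _
    obtain ⟨s, t, hst⟩ := exists_eq_of_crossing γ.continuous_extend δ.continuous_extend
      (fun t => by
        rw [γ.extend_zero]
        linarith [(abs_le.1 (hδ t).1).1])
      (fun t => by
        rw [γ.extend_one]
        linarith [(abs_le.1 (hδ t).1).2])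
      (fun s => by
        rw [δ.extend_zero, Complex.neg_im, him]
        exact (abs_le.1 (hγe s)).1)
      (fun s => by
        rw [δ.extend_one, him]
        exact (abs_le.1 (hγe s)).2)
    have h1 := hδ t
    have h2 : ‖F (γ.extend s)‖ ≤ c := hγc _
    have h3 := hGF (δ.extend t) ⟨h1.1.trans_lt hr1, h1.2.1.trans_lt hr1⟩
    rw [hst] at h2
    linarith [h1.2.2]
  have hside : ∀ z : ℂ, JoinedIn B 0 z → |z.re| < r ∧ |z.im| < r := by
    intro z hz
    have e1 := hBI hz
    rw [mul_zero] at e1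
    have e2 := hBI e1
    rw [mul_zero] at e2
    have e3 := hBI e2
    rw [mul_zero] at e3
    have t0 := htop _ hz
    have t1 := htop _ e1
    have t2 := htop _ e2
    have t3 := htop _ e3
    simp at t1 t2 t3
    obtain ⟨h1, h2, -⟩ := hz.target_mem
    refine ⟨lt_of_le_of_ne h1 fun h => ?_, lt_of_le_of_ne h2 fun h => ?_⟩
    · rcases abs_choice z.re with h' | h'
      · exact t1 (h' ▸ h)
      · exact t3 (h' ▸ h)
    · rcases abs_choice z.im with h' | h'
      · exact t0 (h' ▸ h)
      · exact t2 (h' ▸ h)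
  set U : Set ℂ := {z | |z.re| < r ∧ |z.im| < r} with hU
  have hUo : IsOpen U := (isOpen_lt (continuous_abs.comp Complex.continuous_re)
    continuous_const).inter (isOpen_lt (continuous_abs.comp Complex.continuous_im) continuous_const)
  have hUconv : Convex ℝ U := by
    have : U = Complex.re ⁻¹' Set.Ioo (-r) r ∩ Complex.im ⁻¹' Set.Ioo (-r) r := by
      ext z; simp [hU, abs_lt]
    rw [this]
    exact ((convex_Ioo _ _).is_linear_preimage Complex.reLm.isLinear).inter
      ((convex_Ioo _ _).is_linear_preimage Complex.imLm.isLinear)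
  have hUb : Bornology.IsBounded U := by
    refine (Metric.isBounded_closedBall (x := (0 : ℂ)) (r := r + r)).subset fun z hz => ?_
    rw [mem_closedBall_zero_iff]
    exact (Complex.norm_le_abs_re_add_abs_im z).trans (add_le_add hz.1.le hz.2.le)
  set V : Set ℂ := {z | |z.re| ≤ r ∧ |z.im| ≤ r} with hV
  have hVc : IsClosed V := (isClosed_le (continuous_abs.comp Complex.continuous_re)
    continuous_const).inter (isClosed_le (continuous_abs.comp Complex.continuous_im) continuous_const)
  have hVconv : Convex ℝ V := by
    have : V = Complex.re ⁻¹' Set.Icc (-r) r ∩ Complex.im ⁻¹' Set.Icc (-r) r := by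
      ext z; simp [hV, abs_le]
    rw [this]
    exact ((convex_Icc _ _).is_linear_preimage Complex.reLm.isLinear).inter
      ((convex_Icc _ _).is_linear_preimage Complex.imLm.isLinear)
  have hVQ : V ⊆ Q := fun z hz => ⟨hz.1.trans_lt hr1, hz.2.trans_lt hr1⟩
  have hUV : U ⊆ V := fun z hz => ⟨hz.1.le, hz.2.le⟩
  set A : Set ℂ := U ∩ {z | c < ‖G z‖} with hA
  have hAo : IsOpen A := by
    have : ContinuousOn (fun z => ‖G z‖) U := fun z hz =>
      (hGd z (hVQ (hUV hz))).continuousAt.norm.continuousWithinAt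
    exact this.isOpen_inter_preimage hUo isOpen_Ioi
  have h0A : (0 : ℂ) ∈ A := ⟨by simp [hU, hr0], hcon⟩
  set C := connectedComponentIn A 0 with hC
  have hCA : C ⊆ A := connectedComponentIn_subset A 0
  have hCo : IsOpen C := hAo.connectedComponentIn
  have h0C : (0 : ℂ) ∈ C := mem_connectedComponentIn h0A
  have hCV : closure C ⊆ V :=
    closure_minimal (hCA.trans (Set.inter_subset_left.trans hUV)) hVc
  have hCp : IsPathConnected C :=
    hCo.isConnected_iff_isPathConnected.1 (isConnected_connectedComponentIn_iff.2 h0A)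
  have hdiff : DiffContOnCl ℂ G C := by
    refine DifferentiableOn.diffContOnCl fun z hz => ?_
    exact (hGd z (hVQ (hCV hz))).differentiableWithinAt
  -- Maximum principle on the component of `{|G| > c}` containing the centre. A frontier point with
  -- `|G| > c` would be joined to `0` in `B`, hence be off the sides of the square, hence lie in the
  -- open component itself.
  refine absurd (Complex.norm_le_of_forall_mem_frontier_norm_le
    (hUb.subset (hCA.trans Set.inter_subset_left)) hdiff (C := c) ?_ (subset_closure h0C))
    (not_le.2 hcon)
  intro w hw
  by_contra! hwc
  have hwcl : w ∈ closure C := hw.1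
  have hwV := hCV hwcl
  obtain ⟨ρ, hρ, hball⟩ := Metric.mem_nhds_iff.1
    ((hGd w (hVQ hwV)).continuousAt.norm.eventually (lt_mem_nhds hwc))
  obtain ⟨w', hw'C, hw'⟩ := Metric.mem_closure_iff.1 hwcl ρ hρ
  have hw'ball : w' ∈ Metric.ball w ρ := by rwa [Metric.mem_ball, dist_comm]
  have hwU : w ∈ U := by
    refine hside w (JoinedIn.trans (y := w') ?_ ?_)
    · exact (hCp.joinedIn 0 h0C w' hw'C).mono fun z hz =>
        ⟨(hCA hz).1.1.le, (hCA hz).1.2.le, (hCA hz).2⟩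
    · have hconv : Convex ℝ (Metric.ball w ρ ∩ V) := (convex_ball w ρ).inter hVconv
      have : w' ∈ Metric.ball w ρ ∩ V := ⟨hw'ball, hCV (subset_closure hw'C)⟩
      exact ((hconv.isPathConnected ⟨w', this⟩).joinedIn w' this w
        ⟨Metric.mem_ball_self hρ, hwV⟩).mono fun z hz => ⟨hz.2.1, hz.2.2, hball hz.1⟩
  have hsub : Metric.ball w ρ ∩ U ⊆ C := by
    rw [hC, connectedComponentIn_eq hw'C]
    refine ((convex_ball w ρ).inter hUconv).isPreconnected.subset_connectedComponentIn
      ⟨hw'ball, (hCA hw'C).1⟩ fun z hz => ⟨hz.2, hball hz.1⟩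
  have hwC : w ∈ C := hsub ⟨Metric.mem_ball_self hρ, hwU⟩
  rw [hCo.frontier_eq] at hw
  exact hw.2 hwC


/-! ### The Schwarz–Pick inequality -/

theorem norm_one_sub_conj_mul_sq (a b : ℂ) :
    ‖1 - conj a * b‖ ^ 2 = ‖a - b‖ ^ 2 + (1 - ‖a‖ ^ 2) * (1 - ‖b‖ ^ 2) := by
  simp only [← Complex.normSq_eq_norm_sq, Complex.normSq_apply, Complex.sub_re, Complex.sub_im,
    Complex.mul_re, Complex.mul_im, Complex.conj_re, Complex.conj_im, Complex.one_re,
    Complex.one_im]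
  ring

theorem norm_sub_le_norm_one_sub_conj_mul {a b : ℂ} (ha : ‖a‖ ≤ 1) (hb : ‖b‖ ≤ 1) :
    ‖a - b‖ ≤ ‖1 - conj a * b‖ := by
  have h := norm_one_sub_conj_mul_sq a b
  have h1 : 0 ≤ (1 - ‖a‖ ^ 2) * (1 - ‖b‖ ^ 2) := by
    apply mul_nonneg <;> nlinarith [norm_nonneg a, norm_nonneg b]
  exact le_of_sq_le_sq (by linarith) (norm_nonneg _)

theorem one_sub_norm_le_norm_one_sub_conj_mul {a b : ℂ} (hb : ‖b‖ ≤ 1) :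
    1 - ‖a‖ ≤ ‖1 - conj a * b‖ := by
  have h := norm_sub_norm_le (1 : ℂ) (conj a * b)
  rw [norm_one, norm_mul, RCLike.norm_conj] at h
  nlinarith [norm_nonneg a]

theorem one_sub_conj_mul_ne_zero {a b : ℂ} (ha : ‖a‖ < 1) (hb : ‖b‖ ≤ 1) :
    1 - conj a * b ≠ 0 := by
  have := one_sub_norm_le_norm_one_sub_conj_mul (a := a) hb
  intro h
  rw [h, norm_zero] at this
  linarith

/-- Schwarz–Pick. -/
theorem norm_sub_mul_le_of_holomorphic {E : ℂ → ℂ} (hE : DifferentiableOn ℂ E (Metric.ball 0 1))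
    (hE₁ : ∀ z ∈ Metric.ball (0 : ℂ) 1, ‖E z‖ ≤ 1) {a b : ℂ} (ha : ‖a‖ < 1) (hb : ‖b‖ < 1)
    (hEb : ‖E b‖ < 1) :
    ‖E b - E a‖ * ‖1 - conj b * a‖ ≤ ‖1 - conj (E b) * E a‖ * ‖b - a‖ := by
  -- The involution of the disc exchanging `0` and `b`. Composing `E` with it and with the analogous
  -- map for `E b` gives a function vanishing at `0`, to which the Schwarz lemma applies.
  set φ : ℂ → ℂ := fun z => (b - z) / (1 - conj b * z) with hφ
  have hφmap : ∀ z : ℂ, ‖z‖ < 1 → ‖φ z‖ < 1 := by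
    intro z hz
    have h0 := norm_pos_iff.2 (one_sub_conj_mul_ne_zero hb hz.le)
    rw [hφ, norm_div, div_lt_one h0]
    have h := norm_one_sub_conj_mul_sq b z
    have h1 : 0 < (1 - ‖b‖ ^ 2) * (1 - ‖z‖ ^ 2) := by
      apply mul_pos <;> nlinarith [norm_nonneg b, norm_nonneg z]
    exact lt_of_pow_lt_pow_left₀ 2 h0.le (by linarith)
  have hφd : ∀ z : ℂ, ‖z‖ < 1 → DifferentiableAt ℂ φ z := by
    intro z hz
    have := one_sub_conj_mul_ne_zero hb hz.le
    simp only [hφ]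
    fun_prop (disch := assumption)
  set h : ℂ → ℂ := fun z => (E b - E (φ z)) / (1 - conj (E b) * E (φ z)) with hh
  have hφ0 : φ 0 = b := by simp [hφ]
  have hbb := one_sub_conj_mul_ne_zero hb hb.le
  have hba := one_sub_conj_mul_ne_zero hb ha.le
  have hφa : φ (φ a) = a := by
    have hden : 1 - conj b * b ≠ 0 := hbb
    have e1 : b - (b - a) / (1 - conj b * a) = a * (1 - conj b * b) / (1 - conj b * a) := by
      rw [eq_div_iff hba, sub_mul, div_mul_cancel₀ _ hba]; ring
    have e2 : 1 - conj b * ((b - a) / (1 - conj b * a)) = (1 - conj b * b) / (1 - conj b * a) := by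
      rw [eq_div_iff hba, sub_mul, mul_assoc, div_mul_cancel₀ _ hba]; ring
    simp only [hφ]
    rw [e1, e2, div_div_div_cancel_right₀ hba, mul_div_cancel_right₀ _ hbb]
  have hhd : DifferentiableOn ℂ h (Metric.ball 0 1) := by
    intro z hz
    rw [mem_ball_zero_iff] at hz
    have h1 : DifferentiableAt ℂ (fun z => E (φ z)) z :=
      DifferentiableAt.comp z (hE.differentiableAt
        (Metric.isOpen_ball.mem_nhds (by simpa using hφmap z hz))) (hφd z hz)
    have h2 := one_sub_conj_mul_ne_zero hEb (hE₁ (φ z) (by simpa using hφmap z hz))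
    refine DifferentiableAt.differentiableWithinAt ?_
    exact ((differentiableAt_const _).sub h1).div
      ((differentiableAt_const _).sub ((differentiableAt_const _).mul h1)) h2
  have hmaps : Set.MapsTo h (Metric.ball 0 1) (Metric.closedBall 0 1) := by
    intro z hz
    rw [mem_ball_zero_iff] at hz
    have h3 := hE₁ (φ z) (by simpa using hφmap z hz)
    have h2 := norm_pos_iff.2 (one_sub_conj_mul_ne_zero hEb h3)
    rw [mem_closedBall_zero_iff, hh, norm_div, div_le_one h2]
    exact norm_sub_le_norm_one_sub_conj_mul hEb.le h3
  have key := Complex.norm_le_norm_of_mapsTo_ball hhd hmaps (by simp [hh, hφ0]) (hφmap a ha)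
  have h2 := norm_pos_iff.2 (one_sub_conj_mul_ne_zero hEb (hE₁ a (by simpa using ha)))
  simp only [hh, hφa] at key
  rw [norm_div, div_le_iff₀ h2, hφ, norm_div, div_mul_eq_mul_div,
    le_div_iff₀ (norm_pos_iff.2 hba)] at key
  linarith

/-- Squared, Schwarz–Pick reads `|1 - conj(E b) E a|² (1-|a|²)(1-|b|²) ≤ |1 - b̄ a|² (1-|E a|²)(1-|E
b|²)`. Bounding the first factor below by `(1-|E b|)²` and cancelling one `1-|E b|` leaves a form
linear in `1-|E a|²`. -/
theorem one_sub_sq_mul_le_of_holomorphic {E : ℂ → ℂ}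
    (hE : DifferentiableOn ℂ E (Metric.ball 0 1))
    (hE₁ : ∀ z ∈ Metric.ball (0 : ℂ) 1, ‖E z‖ ≤ 1) {a b : ℂ} (ha : ‖a‖ < 1) (hb : ‖b‖ < 1)
    (hEb : ‖E b‖ < 1) :
    (1 - ‖a‖ ^ 2) * (1 - ‖b‖ ^ 2) * (1 - ‖E b‖) ≤ 2 * (1 - ‖E a‖ ^ 2) * ‖1 - conj b * a‖ ^ 2 := by
  have h := norm_sub_mul_le_of_holomorphic hE hE₁ ha hb hEb
  have h1 := norm_one_sub_conj_mul_sq b a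
  have h2 := norm_one_sub_conj_mul_sq (E b) (E a)
  have hEa := hE₁ a (by simpa using ha)
  have h3 := one_sub_norm_le_norm_one_sub_conj_mul (a := E b) hEa
  have hsq := pow_le_pow_left₀ (by positivity) h 2
  rw [mul_pow, mul_pow] at hsq
  set X := ‖1 - conj b * a‖ ^ 2
  set Y := ‖1 - conj (E b) * E a‖ ^ 2
  have hY : (1 - ‖E b‖) ^ 2 ≤ Y := pow_le_pow_left₀ (by linarith) h3 2
  have h4 : Y * ((1 - ‖b‖ ^ 2) * (1 - ‖a‖ ^ 2)) ≤ X * ((1 - ‖E b‖ ^ 2) * (1 - ‖E a‖ ^ 2)) := by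
    have e1 : ‖b - a‖ ^ 2 = X - (1 - ‖b‖ ^ 2) * (1 - ‖a‖ ^ 2) := by linarith
    have e2 : ‖E b - E a‖ ^ 2 = Y - (1 - ‖E b‖ ^ 2) * (1 - ‖E a‖ ^ 2) := by linarith
    rw [e1, e2] at hsq
    nlinarith
  have hp : 0 < 1 - ‖E b‖ := by linarith
  have hab : 0 ≤ (1 - ‖b‖ ^ 2) * (1 - ‖a‖ ^ 2) := by
    apply mul_nonneg <;> nlinarith [norm_nonneg a, norm_nonneg b]
  have hX : 0 ≤ X * (1 - ‖E a‖ ^ 2) := by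
    apply mul_nonneg (by positivity); nlinarith [norm_nonneg (E a)]
  have h5 : (1 - ‖E b‖) * ((1 - ‖E b‖) * ((1 - ‖b‖ ^ 2) * (1 - ‖a‖ ^ 2))) ≤
      (1 - ‖E b‖) * (2 * (X * (1 - ‖E a‖ ^ 2))) := by
    calc _ = (1 - ‖E b‖) ^ 2 * ((1 - ‖b‖ ^ 2) * (1 - ‖a‖ ^ 2)) := by ring
      _ ≤ Y * ((1 - ‖b‖ ^ 2) * (1 - ‖a‖ ^ 2)) := by gcongr
      _ ≤ (1 - ‖E b‖) * (1 + ‖E b‖) * (X * (1 - ‖E a‖ ^ 2)) := by linarith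
      _ ≤ (1 - ‖E b‖) * 2 * (X * (1 - ‖E a‖ ^ 2)) := by gcongr; linarith
      _ = _ := by ring
  have h6 := le_of_mul_le_mul_left h5 hp
  linarith

/-! ### Connected level sets stay away from points where `|E|` is close to `1` -/

theorem cayley_re_pos {u z : ℂ} (hu : ‖u‖ = 1) (hz : ‖z‖ < 1) : 0 < ((u - z) / (u + z)).re := by
  have hne : u + z ≠ 0 := by
    intro h
    have : u = -z := eq_neg_of_add_eq_zero_left h
    rw [this, norm_neg] at hu
    linarith
  have h1 : u.re ^ 2 + u.im ^ 2 = 1 := by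
    have := Complex.normSq_eq_norm_sq u
    rw [Complex.normSq_apply, hu] at this
    linarith
  have h2 : z.re ^ 2 + z.im ^ 2 < 1 := by
    have := Complex.normSq_eq_norm_sq z
    rw [Complex.normSq_apply] at this
    nlinarith [norm_nonneg z]
  rw [Complex.div_re, ← add_div]
  refine div_pos ?_ (Complex.normSq_pos.2 hne)
  simp only [Complex.sub_re, Complex.add_re, Complex.sub_im, Complex.add_im]
  nlinarith

theorem norm_cayley_inv_lt_one {u X : ℂ} (hu : ‖u‖ = 1) (hX : 0 < X.re) :
    ‖u * ((1 - X) / (1 + X))‖ < 1 := by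
  have hne : 1 + X ≠ 0 := by
    intro h
    have := congrArg Complex.re h
    simp at this
    linarith
  rw [norm_mul, hu, one_mul, norm_div, div_lt_one (norm_pos_iff.2 hne)]
  refine lt_of_pow_lt_pow_left₀ 2 (norm_nonneg _) ?_
  simp only [← Complex.normSq_eq_norm_sq, Complex.normSq_apply, Complex.sub_re, Complex.sub_im,
    Complex.add_re, Complex.add_im, Complex.one_re, Complex.one_im]
  nlinarith

/-- With the Cayley coordinate `X = (u - z)/(u + z)`, the map `(2/π) log(X/R) - 1` takes the disc to
the strip `|Im| < 1` and the arcs `|X| = R`, `|X| = R e^π` to the lines `Re = -1`, `Re = 1`. A path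
in the level set from `z₁` to `z₂` becomes a crossing of the square, and `X = R e^{π/2}` is its
centre. -/
theorem norm_pow_four_le_of_isConnected {E : ℂ → ℂ}
    (hE : DifferentiableOn ℂ E (Metric.ball 0 1))
    (hE₁ : ∀ z ∈ Metric.ball (0 : ℂ) 1, ‖E z‖ ≤ 1) {ε : ℝ}
    (hΩ : IsConnected {z : ℂ | z ∈ Metric.ball (0 : ℂ) 1 ∧ ‖E z‖ < ε})
    {u z₁ z₂ : ℂ} (hu : ‖u‖ = 1) (h₁ : ‖z₁‖ < 1) (h₂ : ‖z₂‖ < 1) (hE₁ε : ‖E z₁‖ < ε)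
    (hE₂ε : ‖E z₂‖ < ε) {R : ℝ} (hR : 0 < R) (hz₁ : ‖(u - z₁) / (u + z₁)‖ ≤ R)
    (hz₂ : R * Real.exp Real.pi ≤ ‖(u - z₂) / (u + z₂)‖) :
    ‖E (u * ((1 - (R * Real.exp (Real.pi / 2) : ℝ)) / (1 + (R * Real.exp (Real.pi / 2) : ℝ))))‖ ^ 4
      ≤ ε := by
  have hpi := Real.pi_pos
  set Ω := {z : ℂ | z ∈ Metric.ball (0 : ℂ) 1 ∧ ‖E z‖ < ε} with hΩdef
  have hΩo : IsOpen Ω := hE.continuousOn.norm.isOpen_inter_preimage Metric.isOpen_ball isOpen_Iio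
  have hΩp := hΩo.isConnected_iff_isPathConnected.1 hΩ
  have hj : JoinedIn Ω z₁ z₂ := hΩp.joinedIn _ ⟨by simpa using h₁, hE₁ε⟩ _ ⟨by simpa using h₂, hE₂ε⟩
  set X : ℂ → ℂ := fun z => (u - z) / (u + z) with hX
  have hXne : ∀ z : ℂ, ‖z‖ < 1 → u + z ≠ 0 := by
    intro z hz h
    have : u = -z := eq_neg_of_add_eq_zero_left h
    rw [this, norm_neg] at hu
    linarith
  set Λ : ℂ → ℂ := fun z => (2 / Real.pi : ℝ) * Complex.log (X z * (R⁻¹ : ℝ)) - 1 with hΛ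
  have hXR : ∀ z : ℂ, ‖z‖ < 1 → 0 < (X z * (R⁻¹ : ℝ)).re := by
    intro z hz
    rw [Complex.re_mul_ofReal]
    exact mul_pos (cayley_re_pos hu hz) (inv_pos.2 hR)
  have hΛc : ContinuousOn Λ Ω := by
    intro z hz
    have hz' : ‖z‖ < 1 := by simpa using hz.1
    have hne := hXne z hz'
    refine ContinuousAt.continuousWithinAt ?_
    have h1 : ContinuousAt X z := by
      simp only [hX]; fun_prop (disch := assumption)
    have h2 : ContinuousAt (fun z => Complex.log (X z * (R⁻¹ : ℝ))) z :=
      (h1.mul continuousAt_const).clog (Or.inl (hXR z hz'))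
    exact (continuousAt_const.mul h2).sub continuousAt_const
  set F : ℂ → ℂ := fun ζ => E (u * ((1 - R * Complex.exp ((Real.pi / 2 : ℝ) * (ζ + 1))) /
    (1 + R * Complex.exp ((Real.pi / 2 : ℝ) * (ζ + 1))))) with hF
  have hre : ∀ ζ : ℂ, |ζ.im| < 1 → 0 < (R * Complex.exp ((Real.pi / 2 : ℝ) * (ζ + 1))).re := by
    intro ζ hζ
    rw [Complex.re_ofReal_mul, Complex.exp_re]
    have hcos : 0 < Real.cos (((Real.pi / 2 : ℝ) : ℂ) * (ζ + 1)).im := by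
      rw [Complex.im_ofReal_mul]
      obtain ⟨h3, h4⟩ := abs_lt.1 hζ
      refine Real.cos_pos_of_mem_Ioo ⟨?_, ?_⟩ <;> simp <;> nlinarith
    positivity
  have hFd : DifferentiableOn ℂ F {z | |z.im| < 1} := by
    intro ζ hζ
    have h3 := hre ζ hζ
    have h4 := norm_cayley_inv_lt_one hu h3
    refine DifferentiableAt.differentiableWithinAt ?_
    refine DifferentiableAt.comp (g := E) ζ
      (hE.differentiableAt (Metric.isOpen_ball.mem_nhds (by simpa using h4))) ?_
    have hne : 1 + R * Complex.exp ((Real.pi / 2 : ℝ) * (ζ + 1)) ≠ 0 := by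
      intro h
      have := congrArg Complex.re h
      rw [Complex.add_re] at this
      simp only [Complex.one_re, Complex.zero_re] at this
      linarith
    fun_prop (disch := assumption)
  have hF1 : ∀ z : ℂ, |z.im| < 1 → ‖F z‖ ≤ 1 := fun ζ hζ =>
    hE₁ _ (by simpa using norm_cayley_inv_lt_one hu (hre ζ hζ))
  have hXnz : ∀ z : ℂ, ‖z‖ < 1 → X z * (R⁻¹ : ℝ) ≠ 0 := by
    intro z hz h
    have := hXR z hz
    rw [h] at this
    simp at this
  have hFΛ : ∀ z : ℂ, ‖z‖ < 1 → F (Λ z) = E z := by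
    intro z hz
    have e1 : ((Real.pi / 2 : ℝ) : ℂ) * (Λ z + 1) = Complex.log (X z * (R⁻¹ : ℝ)) := by
      simp only [hΛ, sub_add_cancel, ← mul_assoc, ← Complex.ofReal_mul]
      rw [show Real.pi / 2 * (2 / Real.pi) = 1 by field_simp, Complex.ofReal_one, one_mul]
    have e2 : (R : ℂ) * (X z * (R⁻¹ : ℝ)) = X z := by
      rw [mul_left_comm, ← Complex.ofReal_mul, mul_inv_cancel₀ hR.ne', Complex.ofReal_one, mul_one]
    simp only [hF]
    rw [e1, Complex.exp_log (hXnz z hz), e2]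
    congr 1
    have hne := hXne z hz
    have hu0 : u ≠ 0 := by rintro rfl; simp at hu
    have e3 : 1 - (u - z) / (u + z) = 2 * z / (u + z) := by field_simp; ring
    have e4 : 1 + (u - z) / (u + z) = 2 * u / (u + z) := by field_simp; ring
    simp only [hX]
    rw [e3, e4, div_div_div_cancel_right₀ hne]
    field_simp
  have hΛre : ∀ z : ℂ, (Λ z).re = 2 / Real.pi * Real.log (‖X z‖ * R⁻¹) - 1 := by
    intro z
    simp only [hΛ]
    rw [Complex.sub_re, Complex.re_ofReal_mul, Complex.log_re, norm_mul, Complex.norm_real,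
      Real.norm_of_nonneg (inv_pos.2 hR).le, Complex.one_re]
  obtain ⟨γ, hγ⟩ := hj
  have hγ1 : ∀ s, ‖γ s‖ < 1 := fun s => by simpa using (hγ s).1
  set γ' : Path (Λ z₁) (Λ z₂) := γ.map' (hΛc.mono (by rintro _ ⟨s, rfl⟩; exact hγ s)) with hγ'
  have key := norm_pow_four_le_of_crossing hFd hF1 (c := ε) γ' ?_ ?_ ?_ ?_
  · have : F 0 = E (u * ((1 - (R * Real.exp (Real.pi / 2) : ℝ)) /
        (1 + (R * Real.exp (Real.pi / 2) : ℝ)))) := by simp [hF]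
    rwa [this] at key
  · rw [hΛre]
    have : Real.log (‖X z₁‖ * R⁻¹) ≤ 0 := by
      refine Real.log_nonpos (by positivity) ?_
      rw [← div_eq_mul_inv, div_le_one hR]
      exact hz₁
    have := mul_nonpos_of_nonneg_of_nonpos (show 0 ≤ 2 / Real.pi by positivity) this
    linarith
  · rw [hΛre]
    have : Real.pi ≤ Real.log (‖X z₂‖ * R⁻¹) := by
      rw [Real.le_log_iff_exp_le]
      · rw [← div_eq_mul_inv, le_div_iff₀ hR]
        linarith
      · have : 0 < ‖X z₂‖ := lt_of_lt_of_le (by positivity) hz₂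
        positivity
    have := mul_le_mul_of_nonneg_left this (show 0 ≤ 2 / Real.pi by positivity)
    rw [div_mul_cancel₀ _ hpi.ne'] at this
    linarith
  · intro s
    change |(Λ (γ s)).im| < 1
    have h3 := (Complex.abs_arg_lt_pi_div_two_iff).2 (Or.inl (hXR _ (hγ1 s)))
    simp only [hΛ]
    rw [Complex.sub_im, Complex.im_ofReal_mul, Complex.log_im, Complex.one_im, sub_zero, abs_mul,
      abs_of_pos (by positivity), div_mul_eq_mul_div, div_lt_one hpi]
    linarith
  · intro s
    change ‖F (Λ (γ s))‖ ≤ ε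
    rw [hFΛ _ (hγ1 s)]
    exact (hγ s).2.le


/-- Schwarz–Pick with `b` fixed and `|1 - b̄ a| ≤ 2`. It bounds the diagonal kernel values `k_a(a)`
from below. -/
theorem exists_lower_bound_one_sub_sq {E : ℂ → ℂ} (hE : DifferentiableOn ℂ E (Metric.ball 0 1))
    (hE₁ : ∀ z ∈ Metric.ball (0 : ℂ) 1, ‖E z‖ ≤ 1) {b : ℂ} (hb : ‖b‖ < 1) (hEb : ‖E b‖ < 1) :
    ∃ c : ℝ, 0 < c ∧ ∀ a : ℂ, ‖a‖ < 1 → c * (1 - ‖a‖ ^ 2) ≤ 1 - ‖E a‖ ^ 2 := by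
  have hb2 : 0 < 1 - ‖b‖ ^ 2 := by nlinarith [norm_nonneg b]
  have hE2 : 0 < 1 - ‖E b‖ := by linarith
  refine ⟨(1 - ‖b‖ ^ 2) * (1 - ‖E b‖) / 8, by positivity, fun a ha => ?_⟩
  have h := one_sub_sq_mul_le_of_holomorphic hE hE₁ ha hb hEb
  have hEa := hE₁ a (by simpa using ha)
  have h0 : 0 ≤ 1 - ‖E a‖ ^ 2 := by nlinarith [norm_nonneg (E a)]
  have h1 : ‖1 - conj b * a‖ ≤ 2 := by
    refine (norm_sub_le _ _).trans ?_
    rw [norm_one, norm_mul, RCLike.norm_conj]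
    nlinarith [norm_nonneg a, norm_nonneg b]
  have h2 : ‖1 - conj b * a‖ ^ 2 ≤ 4 := by nlinarith [norm_nonneg (1 - conj b * a)]
  nlinarith [mul_le_mul_of_nonneg_left h2 h0]

/-- The arithmetic of Schwarz–Pick for two points on one radius, at distances `α` and `(1-t)/(1+t)`
from the origin; `1 - α ≤ t` makes `|1 - b̄ a|` at most `3t/(1+t)`. -/
theorem mul_le_of_schwarz_pick {α t η ε m : ℝ} (hα0 : 0 ≤ α) (hα : α < 1) (ht0 : 0 < t)
    (htα : 1 - α ≤ t) (hη0 : 0 ≤ η) (hε : ε < 1) (hm4 : (1 - ε) / 4 ≤ 1 - m)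
    (hSP : (1 - α ^ 2) * (1 - ((1 - t) / (1 + t)) ^ 2) * (1 - m) ≤
      2 * η * (1 - α * ((1 - t) / (1 + t))) ^ 2) : (1 - α) * (1 - ε) ≤ 18 * η * t := by
  have h1 : 1 - ((1 - t) / (1 + t)) ^ 2 = 4 * t / (1 + t) ^ 2 := by field_simp; ring
  have h2 : 1 - α * ((1 - t) / (1 + t)) = (1 - α + t * (1 + α)) / (1 + t) := by field_simp; ring
  rw [h1, h2, div_pow] at hSP
  have h3 : (1 - α ^ 2) * (4 * t) * (1 - m) ≤ 2 * η * (1 - α + t * (1 + α)) ^ 2 := by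
    have hp : 0 < (1 + t) ^ 2 := by positivity
    have := mul_le_mul_of_nonneg_right hSP hp.le
    calc _ = (1 - α ^ 2) * (4 * t / (1 + t) ^ 2) * (1 - m) * (1 + t) ^ 2 := by field_simp
      _ ≤ 2 * η * ((1 - α + t * (1 + α)) ^ 2 / (1 + t) ^ 2) * (1 + t) ^ 2 := this
      _ = _ := by field_simp
  have h4 : (1 - α + t * (1 + α)) ^ 2 ≤ (3 * t) ^ 2 := by
    apply pow_le_pow_left₀
    · have := mul_nonneg ht0.le (by linarith : 0 ≤ 1 + α); linarith
    · nlinarith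
  have h6 : (1 - α) * (4 * t) * ((1 - ε) / 4) ≤ (1 - α ^ 2) * (4 * t) * (1 - m) := by
    have a1 : 0 ≤ 1 - ε := by linarith
    have a2 : 1 - α ≤ 1 - α ^ 2 := by nlinarith
    have a3 : 0 ≤ 1 - α ^ 2 := by linarith
    exact mul_le_mul (mul_le_mul_of_nonneg_right a2 (by positivity)) hm4 (by positivity)
      (by positivity)
  have h7 := mul_le_mul_of_nonneg_left h4 (show 0 ≤ 2 * η by positivity)
  refine le_of_mul_le_mul_right (a := t) ?_ ht0
  linarith

/-- Were the connected level set to come within `R = c(1-|a|)/(1-|E a|²)` of `u`, it would also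
reach points far from `u`. Then `|E|` would be bounded away from `1` at the point of the radius with
Cayley coordinate `R e^{π/2}`, and Schwarz–Pick between that point and `a` would make `1-|E a|²`
larger than it is. -/
theorem exists_gap_of_isConnected {E : ℂ → ℂ} (hE : DifferentiableOn ℂ E (Metric.ball 0 1))
    (hE₁ : ∀ z ∈ Metric.ball (0 : ℂ) 1, ‖E z‖ ≤ 1) {ε : ℝ} (hε₀ : 0 < ε) (hε : ε < 1)
    (hΩ : IsConnected {z : ℂ | z ∈ Metric.ball (0 : ℂ) 1 ∧ ‖E z‖ < ε}) :
    ∃ c : ℝ, 0 < c ∧ c ≤ 1 ∧ (∀ a : ℂ, ‖a‖ < 1 → c * (1 - ‖a‖ ^ 2) ≤ 1 - ‖E a‖ ^ 2) ∧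
      ∀ a u : ℂ, ‖a‖ < 1 → ‖u‖ = 1 → a = ‖a‖ * u → 1 - ‖E a‖ ^ 2 ≤ c →
        ∀ z : ℂ, ‖z‖ < 1 → ‖u - z‖ * (1 - ‖E a‖ ^ 2) ≤ c * (1 - ‖a‖) → ε ≤ ‖E z‖ := by
  have hpi := Real.pi_pos
  obtain ⟨z₁, hz₁⟩ := hΩ.nonempty
  have hΩo : IsOpen {z : ℂ | z ∈ Metric.ball (0 : ℂ) 1 ∧ ‖E z‖ < ε} :=
    hE.continuousOn.norm.isOpen_inter_preimage Metric.isOpen_ball isOpen_Iio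
  obtain ⟨z₂, hne, hz₂⟩ : ∃ z₂, z₂ ≠ z₁ ∧ z₂ ∈ {z : ℂ | z ∈ Metric.ball (0 : ℂ) 1 ∧ ‖E z‖ < ε} := by
    have : ∀ᶠ z in 𝓝[≠] z₁, z ∈ {z : ℂ | z ∈ Metric.ball (0 : ℂ) 1 ∧ ‖E z‖ < ε} :=
      nhdsWithin_le_nhds (hΩo.mem_nhds hz₁)
    obtain ⟨z, h1, h2⟩ := (this.and self_mem_nhdsWithin).exists
    exact ⟨z, h2, h1⟩
  have hz₁' : ‖z₁‖ < 1 := by simpa using hz₁.1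
  have hz₂' : ‖z₂‖ < 1 := by simpa using hz₂.1
  obtain ⟨c₀, hc₀, hlow⟩ := exists_lower_bound_one_sub_sq hE hE₁ hz₁' (hz₁.2.trans hε)
  set d := ‖z₂ - z₁‖ with hd
  have hd0 : 0 < d := norm_pos_iff.2 (sub_ne_zero.2 hne)
  have hd2 : d ≤ 2 := (norm_sub_le _ _).trans (by linarith)
  set e := Real.exp Real.pi with he
  have he0 : 1 ≤ e := Real.one_le_exp hpi.le
  -- The four entries serve, in order, to have `c ≤ 1`, to stay below the constant of
  -- `exists_lower_bound_one_sub_sq`, to contradict Schwarz–Pick at the end (`18 c e^π < 1 - ε`),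
  -- and to force `R e^π ≤ d/4`.
  set c := min (min 1 c₀) (min ((1 - ε) / (36 * e)) (c₀ * d / (4 * e))) with hc
  have hc1 : c ≤ 1 := (min_le_left _ _).trans (min_le_left _ _)
  have hc2 : c ≤ c₀ := (min_le_left _ _).trans (min_le_right _ _)
  have hc3 : c * (36 * e) ≤ 1 - ε := by
    rw [← le_div_iff₀ (by positivity)]
    exact (min_le_right _ _).trans (min_le_left _ _)
  have hc4 : c * (4 * e) ≤ c₀ * d := by
    rw [← le_div_iff₀ (by positivity)]
    exact (min_le_right _ _).trans (min_le_right _ _)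
  have hcpos : 0 < c := by
    have : 0 < 1 - ε := by linarith
    refine lt_min (lt_min one_pos hc₀) (lt_min (by positivity) (by positivity))
  refine ⟨c, hcpos, hc1, fun a ha => ?_, ?_⟩
  · refine le_trans ?_ (hlow a ha)
    gcongr
    nlinarith [norm_nonneg a]
  intro a u ha hu hau hη z hz hzR
  by_contra! hEz
  set α := ‖a‖ with hα
  set η := 1 - ‖E a‖ ^ 2 with hηdef
  have hα0 : 0 ≤ α := norm_nonneg a
  have hηlow : c₀ * (1 - α) ≤ η := by
    refine le_trans ?_ (hlow a ha)
    gcongr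
    nlinarith
  have hη0 : 0 < η := lt_of_lt_of_le (mul_pos hc₀ (by linarith)) hηlow
  set R := c * (1 - α) / η with hR
  have hRη : R * η = c * (1 - α) := div_mul_cancel₀ _ hη0.ne'
  have hR0 : 0 < R := div_pos (mul_pos hcpos (by linarith)) hη0
  have hRc : R * c₀ ≤ c := by
    have : R * (c₀ * (1 - α)) ≤ c * (1 - α) := by rw [← hRη]; gcongr
    have h2 : (R * c₀) * (1 - α) ≤ c * (1 - α) := by linarith
    exact le_of_mul_le_mul_right h2 (by linarith)
  have hRd : R * e ≤ d / 4 := by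
    have h1 : (R * e) * c₀ ≤ (d / 4) * c₀ := by
      calc (R * e) * c₀ = (R * c₀) * e := by ring
        _ ≤ c * e := by gcongr
        _ ≤ (d / 4) * c₀ := by linarith
    exact le_of_mul_le_mul_right h1 hc₀
  have hR1 : R ≤ 1 := by nlinarith
  have hzR' : ‖u - z‖ ≤ R := by
    rw [hR, le_div_iff₀ hη0]; exact hzR
  have hXz : ‖(u - z) / (u + z)‖ ≤ R := by
    have h1 : 1 ≤ ‖u + z‖ := by
      have h2 : u + z = 2 * u - (u - z) := by ring
      have h3 := norm_sub_norm_le (2 * u) (u - z)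
      rw [← h2, norm_mul, hu] at h3
      norm_num at h3
      linarith
    rw [norm_div]
    exact (div_le_self (norm_nonneg _) h1).trans hzR'
  -- Two points at distance `d` cannot both be within `d/2` of `u`, so the far point is at a
  -- distance independent of `u`.
  have hfar : ∃ z', ‖z'‖ < 1 ∧ ‖E z'‖ < ε ∧ d / 2 ≤ ‖u - z'‖ := by
    by_contra! hcon
    have h1 := hcon z₁ hz₁' hz₁.2
    have h2 := hcon z₂ hz₂' hz₂.2
    have h3 : d ≤ ‖u - z₁‖ + ‖u - z₂‖ := by
      rw [hd, show z₂ - z₁ = (u - z₁) - (u - z₂) by ring]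
      exact norm_sub_le _ _
    linarith
  obtain ⟨z', hz'1, hEz', hz'd⟩ := hfar
  have hXz' : R * e ≤ ‖(u - z') / (u + z')‖ := by
    have hne : 0 < ‖u + z'‖ := by
      have := norm_sub_norm_le u (-z')
      rw [hu, norm_neg, sub_neg_eq_add] at this
      linarith
    have hle : ‖u + z'‖ ≤ 2 := (norm_add_le _ _).trans (by linarith)
    rw [norm_div, le_div_iff₀ hne]
    nlinarith
  have hM := norm_pow_four_le_of_isConnected hE hE₁ hΩ hu hz hz'1 hEz hEz' hR0 hXz hXz'
  set t := R * Real.exp (Real.pi / 2) with ht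
  have he2 : 1 ≤ Real.exp (Real.pi / 2) := Real.one_le_exp (by positivity)
  have he3 : Real.exp (Real.pi / 2) ≤ e := Real.exp_le_exp.2 (by linarith)
  have ht0 : 0 < t := by positivity
  have htR : R ≤ t := le_mul_of_one_le_right hR0.le he2
  -- The smallness `1 - |E a|² ≤ c` enters here: it gives `1 - |a| ≤ R`.
  have htα : 1 - α ≤ t := by
    refine le_trans ?_ htR
    have : c * (1 - α) ≤ c * R := by rw [← hRη, mul_comm]; gcongr
    exact le_of_mul_le_mul_left this hcpos
  set β := (1 - t) / (1 + t) with hβ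
  set b : ℂ := u * ((1 - (t : ℝ)) / (1 + (t : ℝ))) with hb
  have hbβ : b = u * (β : ℝ) := by rw [hb, hβ]; push_cast; rfl
  have hb1 : ‖b‖ < 1 := norm_cayley_inv_lt_one hu (by simpa using ht0)
  set m := ‖E b‖ with hm
  have hm0 : 0 ≤ m := norm_nonneg _
  have hm1 : m ≤ 1 := hE₁ b (by simpa using hb1)
  have hm4 : (1 - ε) / 4 ≤ 1 - m := by
    have : 1 - m ^ 4 ≤ 4 * (1 - m) := by
      have h1 : 1 - m ^ 4 = (1 - m) * ((1 + m) * (1 + m ^ 2)) := by ring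
      have h2 : (1 + m) * (1 + m ^ 2) ≤ 4 := by
        have := pow_le_one₀ (n := 2) hm0 hm1
        calc (1 + m) * (1 + m ^ 2) ≤ 2 * 2 := by gcongr <;> linarith
          _ = 4 := by norm_num
      rw [h1, mul_comm 4]
      exact mul_le_mul_of_nonneg_left h2 (by linarith)
    linarith
  have hSP := one_sub_sq_mul_le_of_holomorphic hE hE₁ ha hb1 (show m < 1 by linarith)
  have hbn : ‖b‖ ^ 2 = β ^ 2 := by
    rw [hbβ, norm_mul, hu, one_mul, Complex.norm_real, Real.norm_eq_abs, sq_abs]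
  have hβα : ‖1 - conj b * a‖ ^ 2 = (1 - α * β) ^ 2 := by
    have hcu : conj u * u = 1 := by
      rw [mul_comm, Complex.mul_conj, Complex.normSq_eq_norm_sq, hu]; simp
    have : 1 - conj b * a = ((1 - α * β : ℝ) : ℂ) := by
      rw [hbβ, hau, map_mul, Complex.conj_ofReal]
      push_cast
      linear_combination -(β : ℂ) * α * hcu
    rw [this, Complex.norm_real, Real.norm_eq_abs, sq_abs]
  rw [hbn, hβα] at hSP
  have h8 := mul_le_of_schwarz_pick hα0 ha ht0 htα hη0.le hε hm4 hSP
  have h9 : η * t ≤ c * (1 - α) * e := by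
    calc η * t = (R * η) * Real.exp (Real.pi / 2) := by rw [ht]; ring
      _ ≤ (R * η) * e := by gcongr
      _ = _ := by rw [hRη]
  have h10 : (1 - α) * (1 - ε) ≤ (1 - α) * ((1 - ε) / 2) := by
    have : (1 - α) * (c * (36 * e)) ≤ (1 - α) * (1 - ε) :=
      mul_le_mul_of_nonneg_left hc3 (by linarith)
    linarith
  have h11 := le_of_mul_le_mul_left h10 (by linarith)
  linarith


/-! ### Cauchy's formula on rectangles -/

/-- The contour integral of `g` over the boundary of `[a, b] × [c, d]`. -/
def rectIntegral (g : ℂ → ℂ) (a b c d : ℝ) : ℂ :=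
  (∫ x : ℝ in a..b, g (x + c * Complex.I)) - (∫ x : ℝ in a..b, g (x + d * Complex.I)) +
    Complex.I * (∫ y : ℝ in c..d, g (b + y * Complex.I)) -
    Complex.I * (∫ y : ℝ in c..d, g (a + y * Complex.I))

/-- The boundary of the rectangle `[a, b] × [c, d]`. -/
def rectSides (a b c d : ℝ) : Set ℂ :=
  {z | (z.re ∈ Set.Icc a b ∧ z.im ∈ Set.Icc c d) ∧ (z.re = a ∨ z.re = b ∨ z.im = c ∨ z.im = d)}

theorem rectIntegral_congr {g k : ℂ → ℂ} {a b c d : ℝ} (hab : a ≤ b) (hcd : c ≤ d)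
    (h : Set.EqOn g k (rectSides a b c d)) : rectIntegral g a b c d = rectIntegral k a b c d := by
  unfold rectIntegral
  congr 1
  · congr 1
    · congr 1
      · refine intervalIntegral.integral_congr fun x hx => h ?_
        rw [Set.uIcc_of_le hab] at hx
        simp [rectSides, hcd]
        exact hx
      · refine intervalIntegral.integral_congr fun x hx => h ?_
        rw [Set.uIcc_of_le hab] at hx
        simp [rectSides, hcd]
        exact hx
    · congr 1
      refine intervalIntegral.integral_congr fun x hx => h ?_
      rw [Set.uIcc_of_le hcd] at hx
      simp [rectSides, hab]
      exact hx
  · congr 1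
    refine intervalIntegral.integral_congr fun x hx => h ?_
    rw [Set.uIcc_of_le hcd] at hx
    simp [rectSides, hab]
    exact hx

theorem intervalIntegrable_rectSides {g : ℂ → ℂ} {a b c d : ℝ} (hab : a ≤ b) (hcd : c ≤ d)
    (hg : ContinuousOn g (rectSides a b c d)) :
    (IntervalIntegrable (fun x : ℝ => g (x + c * Complex.I)) volume a b ∧
      IntervalIntegrable (fun x : ℝ => g (x + d * Complex.I)) volume a b) ∧
    (IntervalIntegrable (fun y : ℝ => g (b + y * Complex.I)) volume c d ∧
      IntervalIntegrable (fun y : ℝ => g (a + y * Complex.I)) volume c d) := by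
  refine ⟨⟨?_, ?_⟩, ⟨?_, ?_⟩⟩ <;>
  · refine ContinuousOn.intervalIntegrable (hg.comp (Continuous.continuousOn (by fun_prop)) ?_)
    intro x hx
    rw [Set.uIcc_of_le (by assumption)] at hx
    simp [rectSides, hcd, hab]
    exact hx

theorem rectIntegral_add {g k : ℂ → ℂ} {a b c d : ℝ} (hab : a ≤ b) (hcd : c ≤ d)
    (hg : ContinuousOn g (rectSides a b c d)) (hk : ContinuousOn k (rectSides a b c d)) :
    rectIntegral (fun z => g z + k z) a b c d =
      rectIntegral g a b c d + rectIntegral k a b c d := by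
  obtain ⟨⟨g1, g2⟩, g3, g4⟩ := intervalIntegrable_rectSides hab hcd hg
  obtain ⟨⟨k1, k2⟩, k3, k4⟩ := intervalIntegrable_rectSides hab hcd hk
  unfold rectIntegral
  rw [intervalIntegral.integral_add g1 k1, intervalIntegral.integral_add g2 k2,
    intervalIntegral.integral_add g3 k3, intervalIntegral.integral_add g4 k4]
  ring

theorem rectIntegral_const_mul (e : ℂ) (g : ℂ → ℂ) (a b c d : ℝ) :
    rectIntegral (fun z => e * g z) a b c d = e * rectIntegral g a b c d := by
  unfold rectIntegral
  simp only [intervalIntegral.integral_const_mul]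
  ring

theorem log_I_mul {z : ℂ} (hz : 0 < z.re) :
    Complex.log (Complex.I * z) = Complex.log z + Real.pi / 2 * Complex.I := by
  have hz0 : z ≠ 0 := by rintro rfl; simp at hz
  have h := abs_lt.1 (Complex.abs_arg_lt_pi_div_two_iff.2 (Or.inl hz))
  rw [(Complex.log_mul_eq_add_log_iff Complex.I_ne_zero hz0).2
    (by rw [Complex.arg_I]; constructor <;> linarith), Complex.log_I]
  ring

/-- On each side `z - ξ` stays in an open half plane; multiplying by a fourth root of unity `e`
moves it to the right half plane, where `log (e (z - ξ))` is a primitive. Comparing the branches at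
the four corners contributes `iπ/2` each. -/
theorem rectIntegral_inv_sub {a b c d : ℝ} {ξ : ℂ} (ha : a < ξ.re) (hb : ξ.re < b)
    (hc : c < ξ.im) (hd : ξ.im < d) :
    rectIntegral (fun z => (z - ξ)⁻¹) a b c d = 2 * Real.pi * Complex.I := by
  have horiz : ∀ (y : ℝ) (e : ℂ), e ≠ 0 → (∀ x : ℝ, 0 < (e * (x + y * Complex.I - ξ)).re) →
      ∫ x : ℝ in a..b, (x + y * Complex.I - ξ)⁻¹ =
        Complex.log (e * (b + y * Complex.I - ξ)) - Complex.log (e * (a + y * Complex.I - ξ)) := by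
    intro y e he hre
    have hne : ∀ x : ℝ, x + y * Complex.I - ξ ≠ 0 := fun x h => by
      have := hre x; rw [h, mul_zero] at this; simp at this
    refine intervalIntegral.integral_eq_sub_of_hasDerivAt
      (f := fun x : ℝ => Complex.log (e * (x + y * Complex.I - ξ))) (fun x _ => ?_) ?_
    · have h1 : HasDerivAt (fun x : ℝ => e * ((x : ℂ) + y * Complex.I - ξ)) e x := by
        simpa using (((hasDerivAt_id x).ofReal_comp.add_const _).sub_const ξ).const_mul e
      have := h1.clog_real (Or.inl (hre x))
      exact this.congr_deriv (div_mul_cancel_left₀ he _)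
    · refine Continuous.intervalIntegrable ?_ _ _
      exact Continuous.inv₀ (by fun_prop) hne
  have vert : ∀ (x : ℝ) (e : ℂ), e ≠ 0 → (∀ y : ℝ, 0 < (e * (x + y * Complex.I - ξ)).re) →
      Complex.I * ∫ y : ℝ in c..d, (x + y * Complex.I - ξ)⁻¹ =
        Complex.log (e * (x + d * Complex.I - ξ)) - Complex.log (e * (x + c * Complex.I - ξ)) := by
    intro x e he hre
    have hne : ∀ y : ℝ, x + y * Complex.I - ξ ≠ 0 := fun y h => by
      have := hre y; rw [h, mul_zero] at this; simp at this
    rw [← intervalIntegral.integral_const_mul]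
    refine intervalIntegral.integral_eq_sub_of_hasDerivAt
      (f := fun y : ℝ => Complex.log (e * (x + y * Complex.I - ξ))) (fun y _ => ?_) ?_
    · have h1 : HasDerivAt (fun y : ℝ => e * ((x : ℂ) + y * Complex.I - ξ)) (e * Complex.I) y := by
        simpa using ((((hasDerivAt_id y).ofReal_comp.mul_const Complex.I).const_add
          (x : ℂ)).sub_const ξ).const_mul e
      have := h1.clog_real (Or.inl (hre y))
      exact this.congr_deriv ((mul_div_mul_left _ _ he).trans (div_eq_mul_inv _ _))
    · refine Continuous.intervalIntegrable ?_ _ _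
      exact continuous_const.mul (Continuous.inv₀ (by fun_prop) hne)
  unfold rectIntegral
  simp only
  rw [horiz c Complex.I Complex.I_ne_zero (fun x => by simpa using hc),
    horiz d (-Complex.I) (neg_ne_zero.2 Complex.I_ne_zero) (fun x => by simpa using hd),
    vert b 1 one_ne_zero (fun y => by simpa using hb),
    vert a (-1) (neg_ne_zero.2 one_ne_zero) (fun y => by simpa using ha)]
  have e1 := log_I_mul (z := b + c * Complex.I - ξ) (by simpa using hb)
  have e2 := log_I_mul (z := -Complex.I * (b + d * Complex.I - ξ)) (by simpa using hd)
  have e3 := log_I_mul (z := -1 * (a + d * Complex.I - ξ)) (by simpa using ha)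
  have e4 := log_I_mul (z := Complex.I * (a + c * Complex.I - ξ)) (by simpa using hc)
  rw [← mul_assoc, mul_neg, Complex.I_mul_I, neg_neg] at e2
  rw [← mul_assoc, mul_neg_one] at e3
  rw [← mul_assoc, Complex.I_mul_I] at e4
  simp only [one_mul] at *
  rw [e1, e2, e3, e4]
  ring

theorem sub_ne_zero_of_mem_rectSides {a b c d : ℝ} {ξ z : ℂ} (ha : a < ξ.re) (hb : ξ.re < b)
    (hc : c < ξ.im) (hd : ξ.im < d) (hz : z ∈ rectSides a b c d) : z - ξ ≠ 0 := by
  intro h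
  obtain rfl := sub_eq_zero.1 h
  rcases hz.2 with h | h | h | h <;> linarith

/-- `dslope` removes the singularity at `ξ`, and what is left is `f ξ` times the integral of `1/(z -
ξ)`. -/
theorem rectIntegral_div_sub {f : ℂ → ℂ} {a b c d : ℝ} {ξ : ℂ} (ha : a < ξ.re) (hb : ξ.re < b)
    (hc : c < ξ.im) (hd : ξ.im < d) (hf : DifferentiableOn ℂ f (Set.Icc a b ×ℂ Set.Icc c d)) :
    rectIntegral (fun z => f z * (z - ξ)⁻¹) a b c d = 2 * Real.pi * Complex.I * f ξ := by
  have hab : a ≤ b := by linarith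
  have hcd : c ≤ d := by linarith
  have hsub : rectSides a b c d ⊆ Set.Icc a b ×ℂ Set.Icc c d := fun z hz => hz.1
  have hnhds : Set.Icc a b ×ℂ Set.Icc c d ∈ 𝓝 ξ := by
    refine mem_of_superset ((isOpen_Ioo.reProdIm isOpen_Ioo).mem_nhds (x := ξ)
      (s := Set.Ioo a b ×ℂ Set.Ioo c d) ⟨⟨ha, hb⟩, ⟨hc, hd⟩⟩) ?_
    exact Set.inter_subset_inter (Set.preimage_mono Set.Ioo_subset_Icc_self)
      (Set.preimage_mono Set.Ioo_subset_Icc_self)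
  have h0 : rectIntegral (dslope f ξ) a b c d = 0 := by
    have := Complex.integral_boundary_rect_eq_zero_of_differentiableOn (dslope f ξ)
      (a + c * Complex.I) (b + d * Complex.I)
      (by simpa [Set.uIcc_of_le hab, Set.uIcc_of_le hcd] using
        (Complex.differentiableOn_dslope hnhds).2 hf)
    simpa [rectIntegral] using this
  have hne : ∀ z ∈ rectSides a b c d, z - ξ ≠ 0 := fun z hz =>
    sub_ne_zero_of_mem_rectSides ha hb hc hd hz
  have hinv : ContinuousOn (fun z => (z - ξ)⁻¹) (rectSides a b c d) :=
    ContinuousOn.inv₀ (by fun_prop) hne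
  have e : rectIntegral (fun z => f z * (z - ξ)⁻¹) a b c d =
      rectIntegral (fun z => dslope f ξ z + f ξ * (z - ξ)⁻¹) a b c d := by
    refine rectIntegral_congr hab hcd fun z hz => ?_
    have := hne z hz
    rw [dslope_of_ne f (sub_ne_zero.1 this), slope_def_field]
    field_simp
    ring
  rw [e, rectIntegral_add hab hcd, h0, rectIntegral_const_mul, rectIntegral_inv_sub ha hb hc hd]
  · ring
  · exact ((Complex.differentiableOn_dslope hnhds).2 hf).continuousOn.mono hsub
  · exact continuousOn_const.mul hinv


/-! ### Boundary regularity where `|f|` is bounded below -/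

/-- Three of the four sides of `rectIntegral`, estimated by the supremum of the integrand. -/
theorem norm_rectIntegral_sub_bottom_le {g : ℂ → ℂ} {a b c d M : ℝ} (hab : a ≤ b) (hcd : c ≤ d)
    (hg : ∀ z ∈ rectSides a b c d, (z.re = a ∨ z.re = b ∨ z.im = d) → ‖g z‖ ≤ M) :
    ‖rectIntegral g a b c d - ∫ x : ℝ in a..b, g (x + c * Complex.I)‖ ≤
      M * (b - a) + M * (d - c) + M * (d - c) := by
  have h1 : ‖∫ x : ℝ in a..b, g (x + d * Complex.I)‖ ≤ M * |b - a| := by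
    refine intervalIntegral.norm_integral_le_of_norm_le_const fun x hx => ?_
    rw [Set.uIoc_of_le hab] at hx
    exact hg _ ⟨by simp [hcd, hx.1.le, hx.2], by simp⟩ (by simp)
  have h2 : ‖∫ y : ℝ in c..d, g (b + y * Complex.I)‖ ≤ M * |d - c| := by
    refine intervalIntegral.norm_integral_le_of_norm_le_const fun x hx => ?_
    rw [Set.uIoc_of_le hcd] at hx
    exact hg _ ⟨by simp [hab, hx.1.le, hx.2], by simp⟩ (by simp)
  have h3 : ‖∫ y : ℝ in c..d, g (a + y * Complex.I)‖ ≤ M * |d - c| := by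
    refine intervalIntegral.norm_integral_le_of_norm_le_const fun x hx => ?_
    rw [Set.uIoc_of_le hcd] at hx
    exact hg _ ⟨by simp [hab, hx.1.le, hx.2], by simp⟩ (by simp)
  rw [abs_of_nonneg (sub_nonneg.2 hab)] at h1
  rw [abs_of_nonneg (sub_nonneg.2 hcd)] at h2 h3
  have e : rectIntegral g a b c d - ∫ x : ℝ in a..b, g (x + c * Complex.I) =
      -(∫ x : ℝ in a..b, g (x + d * Complex.I)) +
        Complex.I * (∫ y : ℝ in c..d, g (b + y * Complex.I)) -
        Complex.I * (∫ y : ℝ in c..d, g (a + y * Complex.I)) := by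
    unfold rectIntegral; ring
  rw [e]
  refine (norm_sub_le _ _).trans (add_le_add ((norm_add_le _ _).trans (add_le_add ?_ ?_)) ?_)
  · rwa [norm_neg]
  · rwa [norm_mul, Complex.norm_I, one_mul]
  · rwa [norm_mul, Complex.norm_I, one_mul]

theorem norm_rectIntegral_add_top_le {g : ℂ → ℂ} {a b c d M : ℝ} (hab : a ≤ b) (hcd : c ≤ d)
    (hg : ∀ z ∈ rectSides a b c d, (z.re = a ∨ z.re = b ∨ z.im = c) → ‖g z‖ ≤ M) :
    ‖rectIntegral g a b c d + ∫ x : ℝ in a..b, g (x + d * Complex.I)‖ ≤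
      M * (b - a) + M * (d - c) + M * (d - c) := by
  have h1 : ‖∫ x : ℝ in a..b, g (x + c * Complex.I)‖ ≤ M * |b - a| := by
    refine intervalIntegral.norm_integral_le_of_norm_le_const fun x hx => ?_
    rw [Set.uIoc_of_le hab] at hx
    exact hg _ ⟨by simp [hcd, hx.1.le, hx.2], by simp⟩ (by simp)
  have h2 : ‖∫ y : ℝ in c..d, g (b + y * Complex.I)‖ ≤ M * |d - c| := by
    refine intervalIntegral.norm_integral_le_of_norm_le_const fun x hx => ?_
    rw [Set.uIoc_of_le hcd] at hx
    exact hg _ ⟨by simp [hab, hx.1.le, hx.2], by simp⟩ (by simp)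
  have h3 : ‖∫ y : ℝ in c..d, g (a + y * Complex.I)‖ ≤ M * |d - c| := by
    refine intervalIntegral.norm_integral_le_of_norm_le_const fun x hx => ?_
    rw [Set.uIoc_of_le hcd] at hx
    exact hg _ ⟨by simp [hab, hx.1.le, hx.2], by simp⟩ (by simp)
  rw [abs_of_nonneg (sub_nonneg.2 hab)] at h1
  rw [abs_of_nonneg (sub_nonneg.2 hcd)] at h2 h3
  have e : rectIntegral g a b c d + ∫ x : ℝ in a..b, g (x + d * Complex.I) =
      (∫ x : ℝ in a..b, g (x + c * Complex.I)) +
        Complex.I * (∫ y : ℝ in c..d, g (b + y * Complex.I)) -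
        Complex.I * (∫ y : ℝ in c..d, g (a + y * Complex.I)) := by
    unfold rectIntegral; ring
  rw [e]
  refine (norm_sub_le _ _).trans (add_le_add ((norm_add_le _ _).trans (add_le_add h1 ?_)) ?_)
  · rwa [norm_mul, Complex.norm_I, one_mul]
  · rwa [norm_mul, Complex.norm_I, one_mul]

theorem norm_inv_sub_sub_inv_sub_le {z ξ ξ' : ℂ} {m : ℝ} (hm : 0 < m) (h : m ≤ ‖z - ξ‖)
    (h' : m ≤ ‖z - ξ'‖) : ‖(z - ξ)⁻¹ - (z - ξ')⁻¹‖ ≤ ‖ξ - ξ'‖ / (m * m) := by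
  have h0 : z - ξ ≠ 0 := norm_pos_iff.1 (hm.trans_le h)
  have h0' : z - ξ' ≠ 0 := norm_pos_iff.1 (hm.trans_le h')
  rw [inv_sub_inv h0 h0', norm_div, norm_mul, sub_sub_sub_cancel_left]
  gcongr

/-- A function on a rectangle above the real axis with modulus in `[ε, 1]` and unimodular vertical
limits is Lipschitz on a smaller rectangle. -/
theorem norm_sub_le_of_unimodular_limits {f : ℂ → ℂ} {A ε : ℝ} (hA : 0 < A) (hε : 0 < ε)
    (hf : DifferentiableOn ℂ f {z | |z.re| < 2 * A ∧ 0 < z.im ∧ z.im < 2 * A})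
    (hf₁ : ∀ z : ℂ, |z.re| < 2 * A → 0 < z.im → z.im < 2 * A → ‖f z‖ ≤ 1)
    (hfε : ∀ z : ℂ, |z.re| < 2 * A → 0 < z.im → z.im < 2 * A → ε ≤ ‖f z‖)
    (hlim : ∀ᵐ x : ℝ, x ∈ Set.Ioc (-A) A → ∃ w : ℂ, ‖w‖ = 1 ∧
      Tendsto (fun h : ℝ => f (x + h * Complex.I)) (𝓝[>] 0) (𝓝 w))
    {ξ ξ' : ℂ} (hξ : |ξ.re| ≤ A / 2) (hξ0 : 0 < ξ.im) (hξ1 : ξ.im ≤ A / 2)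
    (hξ' : |ξ'.re| ≤ A / 2) (hξ'0 : 0 < ξ'.im) (hξ'1 : ξ'.im ≤ A / 2) :
    ‖f ξ - f ξ'‖ ≤ 32 / (ε * A) * ‖ξ - ξ'‖ := by
  have hpi := Real.pi_gt_three
  set V : Set ℂ := {z | |z.re| < 2 * A ∧ 0 < z.im ∧ z.im < 2 * A} with hV
  have hVo : IsOpen V := (isOpen_lt (continuous_abs.comp Complex.continuous_re)
    continuous_const).inter ((isOpen_lt continuous_const Complex.continuous_im).inter
      (isOpen_lt Complex.continuous_im continuous_const))
  have hε1 : ε ≤ 1 := (hfε ξ (by linarith) hξ0 (by linarith)).trans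
    (hf₁ ξ (by linarith) hξ0 (by linarith))
  have hξr := abs_le.1 hξ
  have hξr' := abs_le.1 hξ'
  -- The reflection of `f`, holomorphic below the axis and bounded by `1/ε` there. Where the limit
  -- of `f` is unimodular it has the same limit, so Cauchy's theorem can be used on both sides of
  -- the axis without extending `f` across it.
  set fs : ℂ → ℂ := fun z => (conj (f (conj z)))⁻¹ with hfs
  have hfne : ∀ z ∈ V, f z ≠ 0 := fun z hz => norm_pos_iff.1 (hε.trans_le (hfε z hz.1 hz.2.1 hz.2.2))
  have hconjV : ∀ z : ℂ, |z.re| < 2 * A → z.im < 0 → -(2 * A) < z.im → conj z ∈ V := by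
    intro z h1 h2 h3
    refine ⟨by simpa using h1, by simpa using h2, ?_⟩
    rw [Complex.conj_im]; linarith
  have hfsd : ∀ z : ℂ, |z.re| < 2 * A → z.im < 0 → -(2 * A) < z.im → DifferentiableAt ℂ fs z := by
    intro z h1 h2 h3
    have hz := hconjV z h1 h2 h3
    refine DifferentiableAt.inv ?_ (by simpa using hfne _ hz)
    have := (hf.differentiableAt (hVo.mem_nhds hz)).conj_conj
    rwa [Complex.conj_conj] at this
  have hfsn : ∀ z : ℂ, |z.re| < 2 * A → z.im < 0 → -(2 * A) < z.im → ‖fs z‖ ≤ ε⁻¹ := by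
    intro z h1 h2 h3
    have hz := hconjV z h1 h2 h3
    rw [hfs]
    simp only [norm_inv, RCLike.norm_conj]
    exact inv_anti₀ hε (hfε _ hz.1 hz.2.1 hz.2.2)
  have hfn : ∀ z ∈ V, ‖f z‖ ≤ ε⁻¹ := fun z hz =>
    (hf₁ z hz.1 hz.2.1 hz.2.2).trans ((one_le_inv₀ hε).2 hε1)
  -- A difference of Cauchy kernels, so that every estimate carries the factor `|ξ - ξ'|`.
  set κ : ℂ → ℂ := fun z => (z - ξ)⁻¹ - (z - ξ')⁻¹ with hκ
  set D : ℝ → ℂ := fun h => ∫ x : ℝ in (-A)..A,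
    (f (x + h * Complex.I) * κ (x + h * Complex.I) -
      fs (x + (-h : ℝ) * Complex.I) * κ (x + (-h : ℝ) * Complex.I)) with hD
  set m : ℝ := min ξ.im ξ'.im / 2 with hm
  have hm0 : 0 < m := half_pos (lt_min hξ0 hξ'0)
  have hmξ : 2 * m ≤ ξ.im := by rw [hm]; linarith [min_le_left ξ.im ξ'.im]
  have hmξ' : 2 * m ≤ ξ'.im := by rw [hm]; linarith [min_le_right ξ.im ξ'.im]
  have hnear : ∀ z ζ : ℂ, z.im ≤ m → 2 * m ≤ ζ.im → m ≤ ‖z - ζ‖ := by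
    intro z ζ h1 h2
    have := Complex.abs_im_le_norm (z - ζ)
    rw [Complex.sub_im] at this
    have h3 := neg_abs_le (z.im - ζ.im)
    linarith
  have hκcont : ∀ h : ℝ, h ≤ m → Continuous fun x : ℝ => κ (x + h * Complex.I) := by
    intro h hh
    refine Continuous.sub ?_ ?_ <;> refine Continuous.inv₀ (by fun_prop) fun x => ?_
    · exact norm_pos_iff.1 (hm0.trans_le (hnear _ _ (by simpa using hh) hmξ))
    · exact norm_pos_iff.1 (hm0.trans_le (hnear _ _ (by simpa using hh) hmξ'))
  have hmem : ∀ x ∈ Set.Icc (-A) A, ∀ h : ℝ, 0 < h → h ≤ m → ((x : ℂ) + h * Complex.I) ∈ V := by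
    intro x hx h h0 hm
    have : |x| ≤ A := abs_le.2 hx
    refine ⟨by simp; linarith, by simpa using h0, by simp; linarith⟩
  have hfcont : ∀ h : ℝ, 0 < h → h ≤ m →
      ContinuousOn (fun x : ℝ => f (x + h * Complex.I) * κ (x + h * Complex.I)) (Set.Icc (-A) A) := by
    intro h h0 hm
    refine ContinuousOn.mul ?_ (hκcont h hm).continuousOn
    exact hf.continuousOn.comp (Continuous.continuousOn (by fun_prop)) fun x hx => hmem x hx h h0 hm
  have hfscont : ∀ h : ℝ, 0 < h → h ≤ m →
      ContinuousOn (fun x : ℝ => fs (x + (-h : ℝ) * Complex.I) * κ (x + (-h : ℝ) * Complex.I))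
        (Set.Icc (-A) A) := by
    intro h h0 hm
    refine ContinuousOn.mul ?_ (hκcont (-h) (by linarith)).continuousOn
    intro x hx
    have hx' : |x| ≤ A := abs_le.2 hx
    refine ContinuousAt.comp_continuousWithinAt (g := fs) (f := fun x : ℝ => (x : ℂ) + (-h : ℝ) * Complex.I)
      (hfsd _ (by simp; linarith) (by simpa using h0) (by simp; linarith)).continuousAt ?_
    exact Continuous.continuousWithinAt (by fun_prop)
  -- The contour above the axis gives `2πi (f ξ - f ξ')`, the one below gives `0`. Apart from the
  -- sides at heights `±h`, collected in `D h`, all sides are at distance at least `A/2` from `ξ`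
  -- and `ξ'`, with total length at most `8A`; hence the constant `32`.
  have hkey : ∀ h : ℝ, 0 < h → h ≤ m →
      ‖2 * Real.pi * Complex.I * (f ξ - f ξ') - D h‖ ≤ 32 / (ε * A) * ‖ξ - ξ'‖ := by
    intro h h0 hhm
    have hAA : -A ≤ A := by linarith
    have hhA : h ≤ A := by linarith
    have hsideκ : ∀ z : ℂ, (|z.re| = A ∨ |z.im| = A) → ‖κ z‖ ≤ ‖ξ - ξ'‖ / (A / 2 * (A / 2)) := by
      intro z hz
      have aux : ∀ ζ : ℂ, |ζ.re| ≤ A / 2 → 0 < ζ.im → ζ.im ≤ A / 2 → A / 2 ≤ ‖z - ζ‖ := by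
        intro ζ h1 h2 h3
        rcases hz with hz | hz
        · have e1 := Complex.abs_re_le_norm (z - ζ)
          rw [Complex.sub_re] at e1
          have e2 := abs_sub_abs_le_abs_sub z.re ζ.re
          linarith
        · have e1 := Complex.abs_im_le_norm (z - ζ)
          rw [Complex.sub_im] at e1
          have e2 := abs_sub_abs_le_abs_sub z.im ζ.im
          rw [abs_of_pos h2] at e2
          linarith
      exact norm_inv_sub_sub_inv_sub_le (by positivity) (aux ξ hξ hξ0 hξ1) (aux ξ' hξ' hξ'0 hξ'1)
    set M := ε⁻¹ * (‖ξ - ξ'‖ / (A / 2 * (A / 2))) with hM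
    have hM0 : 0 ≤ M := by positivity
    have hup : rectIntegral (fun z => f z * κ z) (-A) A h A =
        2 * Real.pi * Complex.I * (f ξ - f ξ') := by
      have hfd : DifferentiableOn ℂ f (Set.Icc (-A) A ×ℂ Set.Icc h A) := by
        refine hf.mono fun z hz => ?_
        have : |z.re| ≤ A := abs_le.2 hz.1
        exact ⟨by linarith, by linarith [hz.2.1], by linarith [hz.2.2]⟩
      have e1 := rectIntegral_div_sub (ξ := ξ) (by linarith) (by linarith) (by linarith)
        (by linarith) hfd
      have e2 := rectIntegral_div_sub (ξ := ξ') (by linarith) (by linarith) (by linarith)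
        (by linarith) hfd
      have hc : ∀ ζ : ℂ, |ζ.re| ≤ A / 2 → 2 * m ≤ ζ.im → ζ.im ≤ A / 2 →
          ContinuousOn (fun z => f z * (z - ζ)⁻¹) (rectSides (-A) A h A) := by
        intro ζ h1 h2 h3
        have h1' := abs_le.1 h1
        refine (hfd.continuousOn.mono fun z hz => hz.1).mul (ContinuousOn.inv₀ (by fun_prop) ?_)
        exact fun z hz => sub_ne_zero_of_mem_rectSides (by linarith) (by linarith) (by linarith)
          (by linarith) hz
      have e3 := rectIntegral_add (k := fun z => -1 * (f z * (z - ξ')⁻¹)) (a := -A) (b := A) (c := h) (d := A) (by linarith) (by linarith)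
        (hc ξ hξ hmξ hξ1) ((continuousOn_const (c := (-1 : ℂ))).mul (hc ξ' hξ' hmξ' hξ'1))
      rw [rectIntegral_const_mul, e1, e2] at e3
      rw [mul_sub, sub_eq_add_neg, ← neg_one_mul (2 * Real.pi * Complex.I * f ξ'), ← e3]
      congr 1
      ext z
      simp only [hκ]
      ring
    have hlow : rectIntegral (fun z => fs z * κ z) (-A) A (-A) (-h) = 0 := by
      have := Complex.integral_boundary_rect_eq_zero_of_differentiableOn (fun z => fs z * κ z)
        ((-A : ℝ) + (-A : ℝ) * Complex.I) (A + (-h : ℝ) * Complex.I) ?_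
      · simpa [rectIntegral] using this
      · intro z hz
        simp only [Complex.add_re, Complex.ofReal_re, Complex.re_ofReal_mul, Complex.I_re, mul_zero,
          add_zero, Complex.add_im, Complex.ofReal_im, Complex.im_ofReal_mul, Complex.I_im, mul_one,
          zero_add, Set.uIcc_of_le hAA, Set.uIcc_of_le (neg_le_neg hhA)] at hz
        have h1 : |z.re| ≤ A := abs_le.2 hz.1
        have h2 := hz.2.1
        have h3 := hz.2.2
        have n1 : z - ξ ≠ 0 := norm_pos_iff.1 (hm0.trans_le (hnear _ _ (by linarith) hmξ))
        have n2 : z - ξ' ≠ 0 := norm_pos_iff.1 (hm0.trans_le (hnear _ _ (by linarith) hmξ'))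
        refine DifferentiableAt.differentiableWithinAt ?_
        refine (hfsd z (by linarith) (by linarith) (by linarith)).mul ?_
        simp only [hκ]
        fun_prop (disch := assumption)
    have b1 := norm_rectIntegral_sub_bottom_le (g := fun z => f z * κ z) (M := M) hAA hhA
      (fun z hz hz' => by
        have h1 : |z.re| ≤ A := abs_le.2 hz.1.1
        have h2 := hz.1.2.1
        have h3 := hz.1.2.2
        rw [norm_mul]
        refine mul_le_mul (hfn z ⟨by linarith, by linarith, by linarith⟩) (hsideκ z ?_)
          (norm_nonneg _) (by positivity)
        rcases hz' with h | h | h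
        · left; rw [h, abs_neg, abs_of_pos hA]
        · left; rw [h, abs_of_pos hA]
        · right; rw [h, abs_of_pos hA])
    have b2 := norm_rectIntegral_add_top_le (g := fun z => fs z * κ z) (M := M) hAA
      (neg_le_neg hhA)
      (fun z hz hz' => by
        have h1 : |z.re| ≤ A := abs_le.2 hz.1.1
        have h2 := hz.1.2.1
        have h3 := hz.1.2.2
        rw [norm_mul]
        refine mul_le_mul (hfsn z (by linarith) (by linarith) (by linarith)) (hsideκ z ?_)
          (norm_nonneg _) (by positivity)
        rcases hz' with h | h | h
        · left; rw [h, abs_neg, abs_of_pos hA]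
        · left; rw [h, abs_of_pos hA]
        · right; rw [h, abs_neg, abs_of_pos hA])
    rw [hup] at b1
    rw [hlow, zero_add] at b2
    have eD : D h = (∫ x : ℝ in (-A)..A, f (x + h * Complex.I) * κ (x + h * Complex.I)) -
        ∫ x : ℝ in (-A)..A, fs (x + (-h : ℝ) * Complex.I) * κ (x + (-h : ℝ) * Complex.I) := by
      refine intervalIntegral.integral_sub ?_ ?_
      · refine ContinuousOn.intervalIntegrable ?_
        rw [Set.uIcc_of_le hAA]; exact hfcont h h0 hhm
      · refine ContinuousOn.intervalIntegrable ?_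
        rw [Set.uIcc_of_le hAA]; exact hfscont h h0 hhm
    rw [eD, sub_sub_eq_add_sub, add_sub_right_comm]
    refine (norm_add_le _ _).trans ((add_le_add b1 b2).trans ?_)
    have hM2 : 32 / (ε * A) * ‖ξ - ξ'‖ = M * (8 * A) := by
      rw [hM]; field_simp; ring
    rw [hM2]
    nlinarith
  -- The integrands at heights `h` and `-h` have the same limit almost everywhere because `1 / conj
  -- w = w` for `|w| = 1`. Staying `m` away from the poles provides a constant dominating function.
  have hDlim : Tendsto D (𝓝[>] 0) (𝓝 0) := by
    have hsmall : ∀ᶠ h : ℝ in 𝓝[>] 0, 0 < h ∧ h ≤ m := by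
      filter_upwards [Ioc_mem_nhdsGT hm0] with h hh using hh
    have := intervalIntegral.tendsto_integral_filter_of_dominated_convergence (μ := volume)
      (a := -A) (b := A) (l := 𝓝[>] (0 : ℝ)) (f := fun _ => (0 : ℂ))
      (F := fun (h : ℝ) (x : ℝ) => f (x + h * Complex.I) * κ (x + h * Complex.I) -
        fs (x + (-h : ℝ) * Complex.I) * κ (x + (-h : ℝ) * Complex.I))
      (fun _ => ε⁻¹ * (‖ξ - ξ'‖ / (m * m)) + ε⁻¹ * (‖ξ - ξ'‖ / (m * m))) ?_ ?_ ?_ ?_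
    · rwa [intervalIntegral.integral_zero] at this
    · filter_upwards [hsmall] with h hh
      have : Set.uIoc (-A) A ⊆ Set.Icc (-A) A := by
        rw [Set.uIoc_of_le (by linarith)]; exact Set.Ioc_subset_Icc_self
      exact (((hfcont h hh.1 hh.2).sub (hfscont h hh.1 hh.2)).mono this).aestronglyMeasurable
        measurableSet_uIoc
    · filter_upwards [hsmall] with h hh
      refine ae_of_all _ fun x hx => ?_
      rw [Set.uIoc_of_le (by linarith)] at hx
      have hx' : |x| ≤ A := abs_le.2 ⟨hx.1.le, hx.2⟩
      refine (norm_sub_le _ _).trans (add_le_add ?_ ?_)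
      · rw [norm_mul]
        refine mul_le_mul (hfn _ (hmem x ⟨hx.1.le, hx.2⟩ h hh.1 hh.2)) ?_ (norm_nonneg _)
          (by positivity)
        exact norm_inv_sub_sub_inv_sub_le hm0 (hnear _ _ (by simpa using hh.2) hmξ)
          (hnear _ _ (by simpa using hh.2) hmξ')
      · rw [norm_mul]
        refine mul_le_mul (hfsn _ (by simp; linarith) (by simpa using hh.1)
          (by simp; linarith [hh.2])) ?_ (norm_nonneg _) (by positivity)
        exact norm_inv_sub_sub_inv_sub_le hm0 (hnear _ _ (by simp; linarith [hh.1]) hmξ)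
          (hnear _ _ (by simp; linarith [hh.1]) hmξ')
    · exact intervalIntegrable_const
    · filter_upwards [hlim] with x hx hxA
      rw [Set.uIoc_of_le (by linarith)] at hxA
      obtain ⟨w, hw, hwt⟩ := hx hxA
      have hw0 : w ≠ 0 := norm_pos_iff.1 (by rw [hw]; exact one_pos)
      have hww : (conj w)⁻¹ = w := by
        rw [Complex.inv_def]
        simp [Complex.normSq_eq_norm_sq, hw]
      have hκt : ∀ e : ℝ → ℝ, Tendsto e (𝓝[>] 0) (𝓝 0) →
          Tendsto (fun h => κ (x + (e h : ℝ) * Complex.I)) (𝓝[>] 0) (𝓝 (κ x)) := by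
        intro e he
        have h1 : ContinuousAt κ x := by
          have n1 : (x : ℂ) - ξ ≠ 0 :=
            norm_pos_iff.1 (hm0.trans_le (hnear _ _ (by simpa using hm0.le) hmξ))
          have n2 : (x : ℂ) - ξ' ≠ 0 :=
            norm_pos_iff.1 (hm0.trans_le (hnear _ _ (by simpa using hm0.le) hmξ'))
          simp only [hκ]
          fun_prop (disch := assumption)
        refine h1.tendsto.comp ?_
        have h2 : Continuous fun y : ℝ => (x : ℂ) + y * Complex.I := by fun_prop
        have h3 := (h2.tendsto 0).comp he
        rwa [Complex.ofReal_zero, zero_mul, add_zero] at h3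
      have hid : Tendsto (fun h : ℝ => h) (𝓝[>] 0) (𝓝 0) := tendsto_id.mono_left nhdsWithin_le_nhds
      have t1 := hwt.mul (hκt _ hid)
      have t2 : Tendsto (fun h : ℝ => fs (x + (-h : ℝ) * Complex.I)) (𝓝[>] 0) (𝓝 w) := by
        have := ((Complex.continuous_conj.tendsto w).comp hwt).inv₀ (by simpa using hw0)
        rw [hww] at this
        refine this.congr fun h => ?_
        simp [hfs]
      have t3 := t2.mul (hκt (fun h => -h) (by simpa using hid.neg))
      simpa using t1.sub t3
  have hfin : ‖2 * Real.pi * Complex.I * (f ξ - f ξ')‖ ≤ 32 / (ε * A) * ‖ξ - ξ'‖ := by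
    have h1 : Tendsto (fun h => ‖2 * Real.pi * Complex.I * (f ξ - f ξ') - D h‖) (𝓝[>] 0)
        (𝓝 ‖2 * Real.pi * Complex.I * (f ξ - f ξ')‖) := by
      have h2 := ((tendsto_const_nhds (x := 2 * Real.pi * Complex.I * (f ξ - f ξ'))).sub hDlim).norm
      rwa [sub_zero] at h2
    refine le_of_tendsto h1 ?_
    filter_upwards [Ioc_mem_nhdsGT hm0] with h hh using hkey h hh.1 hh.2
  refine le_trans ?_ hfin
  rw [norm_mul, norm_mul, norm_mul, Complex.norm_I, Complex.norm_real,
    Real.norm_of_nonneg Real.pi_pos.le]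
  norm_num
  nlinarith [norm_nonneg (f ξ - f ξ')]


/-! ### The supremum bound for reproducing kernels of one-component inner functions -/

theorem ζ_coe (x : ℝ) : ζ (x : UnitAddCircle) = Complex.exp (2 * Real.pi * Complex.I * x) := by
  rw [ζ, AddCircle.toCircle_apply_mk, Circle.coe_exp]
  congr 1
  push_cast
  ring

theorem exists_ζ_coe_eq {u : ℂ} (hu : ‖u‖ = 1) : ∃ x : ℝ, ζ (x : UnitAddCircle) = u := by
  refine ⟨u.arg / (2 * Real.pi), ?_⟩
  have h := Complex.norm_mul_exp_arg_mul_I u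
  rw [hu, Complex.ofReal_one, one_mul] at h
  have hpi : (Real.pi : ℂ) ≠ 0 := Complex.ofReal_ne_zero.2 Real.pi_ne_zero
  rw [ζ_coe]
  refine Eq.trans (congrArg Complex.exp ?_) h
  push_cast
  field_simp

theorem ae_coe_add_of_ae {p : UnitAddCircle → Prop} (h : ∀ᵐ t ∂σ, p t) (x₀ : ℝ) :
    ∀ᵐ x : ℝ, x ∈ Set.Ioc (-(1 / 2) : ℝ) (1 / 2) → p ((x + x₀ : ℝ) : UnitAddCircle) := by
  have hvol : (volume : Measure UnitAddCircle) = σ := by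
    rw [AddCircle.volume_eq_smul_haarAddCircle]; simp
  rw [← hvol] at h
  have h1 := (AddCircle.measurePreserving_mk 1 (x₀ - 1 / 2)).quasiMeasurePreserving.ae h
  rw [ae_restrict_iff' measurableSet_Ioc] at h1
  have h2 := (measurePreserving_add_right volume x₀).quasiMeasurePreserving.ae h1
  filter_upwards [h2] with x hx hx'
  exact hx ⟨by linarith [hx'.1], by linarith [hx'.2]⟩

theorem tendsto_exp_neg_nhdsLT :
    Tendsto (fun h : ℝ => Real.exp (-(2 * Real.pi * h))) (𝓝[>] 0) (𝓝[<] 1) := by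
  refine tendsto_nhdsWithin_iff.2 ⟨?_, ?_⟩
  · have : Continuous fun h : ℝ => Real.exp (-(2 * Real.pi * h)) := by fun_prop
    have := (this.tendsto 0).mono_left (nhdsWithin_le_nhds (s := Set.Ioi 0))
    simpa using this
  · filter_upwards [self_mem_nhdsWithin] with h hh
    rw [Set.mem_Iio, Real.exp_lt_one_iff]
    have := mul_pos (mul_pos two_pos Real.pi_pos) hh
    linarith

theorem norm_log_sub_log_le {z w : ℂ} (hz : ‖z - 1‖ ≤ 1 / 2) (hw : ‖w - 1‖ ≤ 1 / 2) :
    ‖Complex.log z - Complex.log w‖ ≤ 2 * ‖z - w‖ := by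
  have hre : ∀ x ∈ Metric.closedBall (1 : ℂ) (1 / 2), 1 / 2 ≤ x.re := by
    intro x hx
    rw [mem_closedBall_iff_norm] at hx
    have := (abs_le.1 ((Complex.abs_re_le_norm (x - 1)).trans hx)).1
    rw [Complex.sub_re, Complex.one_re] at this
    linarith
  refine Convex.norm_image_sub_le_of_norm_hasDerivWithin_le (f' := fun x => x⁻¹)
    (s := Metric.closedBall (1 : ℂ) (1 / 2)) (fun x hx => ?_) (fun x hx => ?_)
    (convex_closedBall _ _) (by simpa [dist_eq_norm] using hw) (by simpa [dist_eq_norm] using hz)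
  · exact (Complex.hasDerivAt_log (Or.inl (by linarith [hre x hx]))).hasDerivWithinAt
  · rw [norm_inv]
    have h1 := hre x hx
    have h2 := (le_abs_self x.re).trans (Complex.abs_re_le_norm x)
    rw [inv_le_comm₀ (by linarith) two_pos]
    linarith

/-- Near a boundary point `u`, an inner function bounded below in modulus is Lipschitz. -/
theorem IsInner.norm_sub_le {E : ℂ → ℂ} (hE : IsInner E) {u : ℂ} (hu : ‖u‖ = 1) {R ε : ℝ}
    (hR₀ : 0 < R) (hR₁ : R ≤ 1) (hε : 0 < ε)
    (hEε : ∀ z : ℂ, ‖z‖ < 1 → ‖u - z‖ ≤ R → ε ≤ ‖E z‖) {z w : ℂ} (hz : ‖z‖ < 1) (hw : ‖w‖ < 1)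
    (hzR : ‖u - z‖ ≤ R / 50) (hwR : ‖u - w‖ ≤ R / 50) :
    ‖E z - E w‖ ≤ 3200 / (ε * R) * ‖z - w‖ := by
  have hpi := Real.pi_gt_three
  have hpi' := Real.pi_lt_four
  have hu0 : u ≠ 0 := by rintro rfl; simp at hu
  obtain ⟨x₀, hx₀⟩ := exists_ζ_coe_eq hu
  rw [ζ_coe] at hx₀
  -- In the coordinate `u exp(2πiξ)` radii become vertical lines. This `A` puts the image of the
  -- rectangle of size `2A` inside `|u - z| ≤ R`, while points with `|u - z| ≤ R/50` have
  -- coordinates in the rectangle of size `A/2`.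
  set A := R / 100 with hA
  have hA0 : 0 < A := by positivity
  set f : ℂ → ℂ := fun ξ => E (u * Complex.exp (2 * Real.pi * Complex.I * ξ)) with hf
  have hnorm : ∀ ξ : ℂ, ‖u * Complex.exp (2 * Real.pi * Complex.I * ξ)‖ =
      Real.exp (-(2 * Real.pi * ξ.im)) := by
    intro ξ
    rw [norm_mul, hu, one_mul, Complex.norm_exp]
    simp
  have hlt : ∀ ξ : ℂ, 0 < ξ.im → ‖u * Complex.exp (2 * Real.pi * Complex.I * ξ)‖ < 1 := by
    intro ξ hξ
    rw [hnorm, Real.exp_lt_one_iff]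
    have := mul_pos (mul_pos two_pos Real.pi_pos) hξ
    linarith
  have hclose : ∀ ξ : ℂ, |ξ.re| < 2 * A → 0 < ξ.im → ξ.im < 2 * A →
      ‖u - u * Complex.exp (2 * Real.pi * Complex.I * ξ)‖ ≤ R := by
    intro ξ h1 h2 h3
    have h4 : ‖ξ‖ ≤ R / 25 := by
      have := Complex.norm_le_abs_re_add_abs_im ξ
      rw [abs_of_pos h2] at this
      linarith
    have h5 : ‖2 * Real.pi * Complex.I * ξ‖ ≤ 8 * (R / 25) := by
      rw [norm_mul, norm_mul, norm_mul, Complex.norm_I, Complex.norm_real,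
        Real.norm_of_nonneg Real.pi_pos.le]
      norm_num
      nlinarith [norm_nonneg ξ]
    have h6 := Complex.norm_exp_sub_one_le (x := 2 * Real.pi * Complex.I * ξ) (by linarith)
    have h7 : u - u * Complex.exp (2 * Real.pi * Complex.I * ξ) =
        -(u * (Complex.exp (2 * Real.pi * Complex.I * ξ) - 1)) := by ring
    rw [h7, norm_neg, norm_mul, hu, one_mul]
    linarith
  set Λ : ℂ → ℂ := fun z => Complex.log (z / u) / (2 * Real.pi * Complex.I) with hΛ
  have h2pi : (2 * Real.pi * Complex.I : ℂ) ≠ 0 := Complex.two_pi_I_ne_zero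
  have hn2pi : ‖(2 * Real.pi * Complex.I : ℂ)‖ = 2 * Real.pi := by
    rw [norm_mul, norm_mul, Complex.norm_I, Complex.norm_real,
        Real.norm_of_nonneg Real.pi_pos.le]
    norm_num
  have hdist : ∀ z : ℂ, ‖z / u - 1‖ = ‖u - z‖ := by
    intro z
    have : z / u - 1 = (z - u) / u := by rw [sub_div, div_self hu0]
    rw [this, norm_div, hu, div_one, norm_sub_rev]
  have hΛmem : ∀ z : ℂ, ‖z‖ < 1 → ‖u - z‖ ≤ R / 50 →
      (|(Λ z).re| ≤ A / 2 ∧ 0 < (Λ z).im ∧ (Λ z).im ≤ A / 2) ∧ f (Λ z) = E z := by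
    intro z hz hzR
    have h1 : ‖z / u - 1‖ ≤ R / 50 := by rwa [hdist]
    have hz0 : z / u ≠ 0 := by
      intro h
      rw [h, zero_sub, norm_neg, norm_one] at h1
      linarith
    have h2 : ‖Complex.log (z / u)‖ ≤ 3 / 2 * ‖z / u - 1‖ := by
      have := Complex.norm_log_one_add_half_le_self (z := z / u - 1) (by linarith)
      rwa [add_sub_cancel] at this
    have h3 : ‖Λ z‖ ≤ A / 2 := by
      rw [hΛ]
      simp only
      rw [norm_div, hn2pi, div_le_iff₀ (by positivity)]
      nlinarith
    have hexp : u * Complex.exp (2 * Real.pi * Complex.I * Λ z) = z := by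
      rw [hΛ]
      simp only
      rw [mul_div_cancel₀ _ h2pi, Complex.exp_log hz0, mul_div_cancel₀ _ hu0]
    have him : 0 < (Λ z).im := by
      have := hnorm (Λ z)
      rw [hexp] at this
      rw [this, Real.exp_lt_one_iff] at hz
      by_contra! hcon
      have := mul_nonpos_of_nonneg_of_nonpos (by positivity : 0 ≤ 2 * Real.pi) hcon
      linarith
    refine ⟨⟨(Complex.abs_re_le_norm _).trans h3, him,
      (le_abs_self _).trans ((Complex.abs_im_le_norm _).trans h3)⟩, ?_⟩
    rw [hf]
    simp only
    rw [hexp]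
  obtain ⟨⟨z1, z2, z3⟩, z4⟩ := hΛmem z hz hzR
  obtain ⟨⟨w1, w2, w3⟩, w4⟩ := hΛmem w hw hwR
  have key := norm_sub_le_of_unimodular_limits (f := f) hA0 hε ?_
    (fun ξ _ h2 _ => hE.norm_le_one _ (by simpa using hlt ξ h2))
    (fun ξ h1 h2 h3 => hEε _ (hlt ξ h2) (hclose ξ h1 h2 h3)) ?_ z1 z2 z3 w1 w2 w3
  · rw [z4, w4] at key
    have h1 : ‖Λ z - Λ w‖ ≤ ‖z - w‖ := by
      have h2 := norm_log_sub_log_le (z := z / u) (w := w / u) (by rw [hdist]; linarith)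
        (by rw [hdist]; linarith)
      rw [← sub_div, norm_div, hu, div_one] at h2
      rw [hΛ]
      simp only
      rw [← sub_div, norm_div, hn2pi, div_le_iff₀ (by positivity)]
      nlinarith [norm_nonneg (z - w)]
    refine key.trans ?_
    have h3 : 32 / (ε * A) = 3200 / (ε * R) := by rw [hA]; field_simp; norm_num
    rw [h3]
    gcongr
  · intro ξ hξ
    refine DifferentiableAt.differentiableWithinAt ?_
    exact DifferentiableAt.comp (g := E) ξ (hE.differentiableOn.differentiableAt
      (Metric.isOpen_ball.mem_nhds (by simpa using hlt ξ hξ.2.1))) (by fun_prop)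
  · filter_upwards [ae_coe_add_of_ae hE.norm_bdry x₀] with x hx hxA
    obtain ⟨v, hv, hvt⟩ := hx ⟨by linarith [hxA.1], by linarith [hxA.2]⟩
    refine ⟨v, hv, (hvt.comp tendsto_exp_neg_nhdsLT).congr fun h => ?_⟩
    simp only [hf, Function.comp_apply]
    rw [ζ_coe, ← hx₀, Complex.ofReal_exp, ← Complex.exp_add, ← Complex.exp_add]
    congr 2
    push_cast
    linear_combination (-2 * Real.pi * h : ℂ) * Complex.I_mul_I

/-- The content is `|k_a| ≲ k_a(a)`. Put `η = 1 - |E a|²`. If `η` is not small, `|1 - ā z| ≥ 1 -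
|a|` suffices. Otherwise let `R` be the gap `c(1-|a|)/η` around `u = a/|a|`. For `z` far from `u` on
the scale `R`, the denominator is at least of order `R`. For `z` near `u`, write `1 - conj(E a) E z
= η + conj(E a)(E a - E z)` and use the Lipschitz bound with constant of order `1/R`. -/
theorem exists_kernel_bound_of_isOneComponent {E : ℂ → ℂ} (hE : IsInner E)
    (hE₁ : IsOneComponent E) :
    ∃ c C : ℝ, 0 < c ∧ 0 < C ∧ (∀ a : ℂ, ‖a‖ < 1 → c * (1 - ‖a‖ ^ 2) ≤ 1 - ‖E a‖ ^ 2) ∧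
      ∀ a z : ℂ, ‖a‖ < 1 → ‖z‖ < 1 →
        ‖1 - conj (E a) * E z‖ * (1 - ‖a‖ ^ 2) ≤ C * (1 - ‖E a‖ ^ 2) * ‖1 - conj a * z‖ := by
  obtain ⟨ε, hε0, hε1, hΩ⟩ := hE₁
  obtain ⟨c, hc0, hc1, hlow, hgap⟩ :=
    exists_gap_of_isConnected hE.differentiableOn hE.norm_le_one hε0 hε1 hΩ
  have hC2 : 400 / c ≤ 400 / c + 2 + 6400 / (ε * c) := by
    have : 0 ≤ 6400 / (ε * c) := by positivity
    linarith
  have hC3 : 2 + 6400 / (ε * c) ≤ 400 / c + 2 + 6400 / (ε * c) := by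
    have : 0 ≤ 400 / c := by positivity
    linarith
  set C := 400 / c + 2 + 6400 / (ε * c) with hC
  refine ⟨c, C, hc0, by positivity, hlow, fun a z ha hz => ?_⟩
  set η := 1 - ‖E a‖ ^ 2 with hη
  have hEa := hE.norm_le_one a (by simpa using ha)
  have hEz := hE.norm_le_one z (by simpa using hz)
  have ha0 := norm_nonneg a
  have ha2 : 0 < 1 - ‖a‖ ^ 2 := by nlinarith
  have hη0 : 0 < η := lt_of_lt_of_le (by positivity) (hlow a ha)
  have hden := one_sub_norm_le_norm_one_sub_conj_mul (a := a) hz.le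
  have hden0 := norm_nonneg (1 - conj a * z)
  have ha3 : 1 - ‖a‖ ^ 2 ≤ 2 * (1 - ‖a‖) := by nlinarith
  have hnum : ‖1 - conj (E a) * E z‖ ≤ 2 := by
    refine (norm_sub_le _ _).trans ?_
    rw [norm_one, norm_mul, RCLike.norm_conj]
    nlinarith [norm_nonneg (E a), norm_nonneg (E z)]
  have htriv : ‖1 - conj (E a) * E z‖ * (1 - ‖a‖ ^ 2) ≤ 4 * (1 - ‖a‖) := by
    nlinarith [norm_nonneg (1 - conj (E a) * E z)]
  have hfinish : ∀ X : ℝ, 4 * (1 - ‖a‖) ≤ X → X ≤ 400 / c * η * ‖1 - conj a * z‖ →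
      ‖1 - conj (E a) * E z‖ * (1 - ‖a‖ ^ 2) ≤ C * η * ‖1 - conj a * z‖ := by
    intro X h1 h2
    refine (htriv.trans (h1.trans h2)).trans ?_
    gcongr
  by_cases hsmall : c / 100 ≤ η
  · refine hfinish (4 * ‖1 - conj a * z‖) (by linarith) ?_
    have : 4 ≤ 400 / c * η := by
      rw [div_mul_eq_mul_div, le_div_iff₀ hc0]
      linarith
    gcongr
  push Not at hsmall
  have hahalf : 1 / 2 < ‖a‖ := by
    by_contra! hcon
    have h1 := hlow a ha
    have h2 : 3 / 4 ≤ 1 - ‖a‖ ^ 2 := by nlinarith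
    have h3 := mul_le_mul_of_nonneg_left h2 hc0.le
    linarith
  have hna : (‖a‖ : ℂ) ≠ 0 := Complex.ofReal_ne_zero.2 (by linarith)
  set u : ℂ := a / ‖a‖ with hu
  have hau : a = ‖a‖ * u := by rw [hu, mul_div_cancel₀ _ hna]
  have hu1 : ‖u‖ = 1 := by
    rw [hu, norm_div, Complex.norm_real, norm_norm, div_self (by linarith)]
  set R := c * (1 - ‖a‖) / η with hR
  have hRη : R * η = c * (1 - ‖a‖) := div_mul_cancel₀ _ hη0.ne'
  have hR0 : 0 < R := div_pos (mul_pos hc0 (by linarith)) hη0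
  have hR1 : R ≤ 1 := by
    rw [hR, div_le_one hη0]
    refine le_trans ?_ (hlow a ha)
    gcongr
    nlinarith
  have haR : 1 - ‖a‖ ≤ R / 100 := by
    have : c * (1 - ‖a‖) ≤ c * (R / 100) := by rw [← hRη]; nlinarith
    exact le_of_mul_le_mul_left this hc0
  have hgap' : ∀ z : ℂ, ‖z‖ < 1 → ‖u - z‖ ≤ R → ε ≤ ‖E z‖ := by
    intro w hw hwR
    refine hgap a u ha hu1 hau (by linarith) w hw ?_
    rw [← hRη]
    gcongr
  have hua : ‖u - a‖ = 1 - ‖a‖ := by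
    have : u - a = ((1 - ‖a‖ : ℝ) : ℂ) * u := by
      conv_lhs => rw [hau]
      push_cast; ring
    rw [this, norm_mul, hu1, mul_one, Complex.norm_real, Real.norm_of_nonneg (by linarith)]
  have hza := norm_sub_le_norm_one_sub_conj_mul ha.le hz.le
  by_cases hfar : ‖u - z‖ ≤ R / 50
  · have hLip := hE.norm_sub_le hu1 hR0 hR1 hε0 hgap' ha hz (by linarith) hfar
    have h1 : ‖1 - conj (E a) * E z‖ ≤ η + 3200 / (ε * R) * ‖a - z‖ := by
      have e : 1 - conj (E a) * E z = ((1 - ‖E a‖ ^ 2 : ℝ) : ℂ) + conj (E a) * (E a - E z) := by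
        have := Complex.mul_conj (E a)
        rw [Complex.normSq_eq_norm_sq] at this
        push_cast at this ⊢
        linear_combination -this
      rw [e]
      refine (norm_add_le _ _).trans (add_le_add ?_ ?_)
      · rw [Complex.norm_real, Real.norm_of_nonneg hη0.le]
      · rw [norm_mul, RCLike.norm_conj]
        exact (mul_le_of_le_one_left (norm_nonneg _) hEa).trans hLip
    have h2 : 3200 / (ε * R) * (2 * (1 - ‖a‖)) = 6400 / (ε * c) * η := by
      have : 1 - ‖a‖ = R * η / c := by rw [hRη, mul_div_cancel_left₀ _ hc0.ne']
      rw [this]; field_simp; norm_num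
    calc ‖1 - conj (E a) * E z‖ * (1 - ‖a‖ ^ 2)
        ≤ (η + 3200 / (ε * R) * ‖a - z‖) * (2 * (1 - ‖a‖)) := by gcongr
      _ = 2 * η * (1 - ‖a‖) + (3200 / (ε * R) * (2 * (1 - ‖a‖))) * ‖a - z‖ := by ring
      _ = 2 * η * (1 - ‖a‖) + 6400 / (ε * c) * η * ‖a - z‖ := by rw [h2]
      _ ≤ 2 * η * ‖1 - conj a * z‖ + 6400 / (ε * c) * η * ‖1 - conj a * z‖ := by gcongr
      _ = (2 + 6400 / (ε * c)) * η * ‖1 - conj a * z‖ := by ring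
      _ ≤ C * η * ‖1 - conj a * z‖ := by gcongr
  · push Not at hfar
    have h1 : R / 100 ≤ ‖a - z‖ := by
      have h2 : ‖u - z‖ ≤ ‖u - a‖ + ‖a - z‖ := by
        rw [show u - z = (u - a) + (a - z) by ring]; exact norm_add_le _ _
      linarith
    refine hfinish (4 * (R * η / c)) ?_ ?_
    · rw [hRη, mul_div_cancel_left₀ _ hc0.ne']
    · have h2 : R ≤ 100 * ‖1 - conj a * z‖ := by linarith
      calc 4 * (R * η / c) = 4 / c * η * R := by ring
        _ ≤ 4 / c * η * (100 * ‖1 - conj a * z‖) := by gcongr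
        _ = _ := by ring


/-! ### Bounded holomorphic functions and their boundary functions -/

/-- `φ` is the radial boundary function of the bounded holomorphic function `G` on the disc. -/
structure HasBoundary (G : ℂ → ℂ) (φ : UnitAddCircle → ℂ) : Prop where
  differentiableOn : DifferentiableOn ℂ G (Metric.ball 0 1)
  bounded : ∃ M : ℝ, ∀ z : ℂ, ‖z‖ < 1 → ‖G z‖ ≤ M
  tendsto : ∀ᵐ t ∂σ, Tendsto (fun r : ℝ => G ((r : ℂ) * ζ t)) (𝓝[<] (1 : ℝ)) (𝓝 (φ t))

theorem norm_ofReal_mul_ζ_lt_one {r : ℝ} (hr₀ : 0 < r) (hr₁ : r < 1) (t : UnitAddCircle) :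
    ‖(r : ℂ) * ζ t‖ < 1 := by
  rwa [norm_mul, norm_ζ, mul_one, Complex.norm_real, Real.norm_of_nonneg hr₀.le]

theorem eventually_nhdsLT_one : ∀ᶠ r : ℝ in 𝓝[<] 1, 0 < r ∧ r < 1 := by
  filter_upwards [Ioo_mem_nhdsLT (zero_lt_one' ℝ)] with r hr using hr

theorem tendsto_ofReal_mul_ζ (t : UnitAddCircle) :
    Tendsto (fun r : ℝ => (r : ℂ) * ζ t) (𝓝[<] (1 : ℝ)) (𝓝 (ζ t)) := by
  have : Continuous fun r : ℝ => (r : ℂ) * ζ t := by fun_prop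
  simpa using (this.tendsto 1).mono_left nhdsWithin_le_nhds

namespace HasBoundary

variable {G H : ℂ → ℂ} {φ ψ : UnitAddCircle → ℂ}

theorem continuous_dilation (h : HasBoundary G φ) {r : ℝ} (hr₀ : 0 < r) (hr₁ : r < 1) :
    Continuous fun t : UnitAddCircle => G ((r : ℂ) * ζ t) :=
  h.differentiableOn.continuousOn.comp_continuous (continuous_const.mul continuous_ζ)
    fun t => by simpa using norm_ofReal_mul_ζ_lt_one hr₀ hr₁ t

theorem aestronglyMeasurable (h : HasBoundary G φ) : AEStronglyMeasurable φ σ := by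
  refine aestronglyMeasurable_of_tendsto_ae (𝓝[<] (1 : ℝ))
    (f := fun (r : ℝ) t => if 0 < r ∧ r < 1 then G ((r : ℂ) * ζ t) else 0) (fun r => ?_) ?_
  · by_cases hr : 0 < r ∧ r < 1
    · simp only [hr, and_self, if_true]
      exact (h.continuous_dilation hr.1 hr.2).aestronglyMeasurable
    · simp only [hr, if_false]
      exact aestronglyMeasurable_const
  · filter_upwards [h.tendsto] with t ht
    refine ht.congr' ?_
    filter_upwards [eventually_nhdsLT_one] with r hr
    simp [hr]

theorem exists_ae_norm_le (h : HasBoundary G φ) : ∃ M : ℝ, ∀ᵐ t ∂σ, ‖φ t‖ ≤ M := by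
  obtain ⟨M, hM⟩ := h.bounded
  refine ⟨M, ?_⟩
  filter_upwards [h.tendsto] with t ht
  refine le_of_tendsto ht.norm ?_
  filter_upwards [eventually_nhdsLT_one] with r hr
  exact hM _ (norm_ofReal_mul_ζ_lt_one hr.1 hr.2 t)

theorem memLp_top (h : HasBoundary G φ) : MemLp φ ∞ σ := by
  obtain ⟨M, hM⟩ := h.exists_ae_norm_le
  exact memLp_top_of_bound h.aestronglyMeasurable M hM

theorem integrable_mul (h : HasBoundary G φ) {f : UnitAddCircle → ℂ} (hf : Integrable f σ) :
    Integrable (fun t => f t * φ t) σ := by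
  obtain ⟨M, hM⟩ := h.exists_ae_norm_le
  exact hf.mul_bdd h.aestronglyMeasurable hM

theorem of_continuousOn (hd : DifferentiableOn ℂ G (Metric.ball 0 1))
    (hc : ContinuousOn G (Metric.closedBall 0 1)) : HasBoundary G (fun t => G (ζ t)) where
  differentiableOn := hd
  bounded := by
    obtain ⟨M, hM⟩ := (isCompact_closedBall (0 : ℂ) 1).exists_bound_of_continuousOn hc
    exact ⟨M, fun z hz => hM z (by simpa using hz.le)⟩
  tendsto := ae_of_all _ fun t => by
    refine (hc (ζ t) (by simp [norm_ζ])).tendsto.comp (tendsto_nhdsWithin_iff.2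
      ⟨tendsto_ofReal_mul_ζ t, ?_⟩)
    filter_upwards [eventually_nhdsLT_one] with r hr
    simpa using (norm_ofReal_mul_ζ_lt_one hr.1 hr.2 t).le

theorem const (c : ℂ) : HasBoundary (fun _ => c) (fun _ => c) :=
  of_continuousOn (differentiableOn_const c) continuousOn_const

theorem id : HasBoundary (fun z => z) ζ :=
  of_continuousOn differentiableOn_id continuousOn_id

theorem cauchy {a : ℂ} (ha : ‖a‖ < 1) :
    HasBoundary (fun z => (1 - conj a * z)⁻¹) (fun t => (1 - conj a * ζ t)⁻¹) := by
  refine of_continuousOn (G := fun z => (1 - conj a * z)⁻¹) ?_ ?_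
  · refine DifferentiableOn.inv (by fun_prop) fun z hz => ?_
    exact one_sub_conj_mul_ne_zero ha (by simpa using (mem_ball_zero_iff.1 hz).le)
  · refine ContinuousOn.inv₀ (by fun_prop) fun z hz => ?_
    exact one_sub_conj_mul_ne_zero ha (by simpa using hz)

theorem mul (hG : HasBoundary G φ) (hH : HasBoundary H ψ) :
    HasBoundary (fun z => G z * H z) (fun t => φ t * ψ t) where
  differentiableOn := hG.differentiableOn.mul hH.differentiableOn
  bounded := by
    obtain ⟨M, hM⟩ := hG.bounded
    obtain ⟨N, hN⟩ := hH.bounded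
    refine ⟨M * N, fun z hz => ?_⟩
    rw [norm_mul]
    exact mul_le_mul (hM z hz) (hN z hz) (norm_nonneg _) ((norm_nonneg _).trans (hM z hz))
  tendsto := by
    filter_upwards [hG.tendsto, hH.tendsto] with t h1 h2 using h1.mul h2

theorem sub (hG : HasBoundary G φ) (hH : HasBoundary H ψ) :
    HasBoundary (fun z => G z - H z) (fun t => φ t - ψ t) where
  differentiableOn := hG.differentiableOn.sub hH.differentiableOn
  bounded := by
    obtain ⟨M, hM⟩ := hG.bounded
    obtain ⟨N, hN⟩ := hH.bounded
    exact ⟨M + N, fun z hz => (norm_sub_le _ _).trans (add_le_add (hM z hz) (hN z hz))⟩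
  tendsto := by
    filter_upwards [hG.tendsto, hH.tendsto] with t h1 h2 using h1.sub h2

/-- Boundedness survives the division: near `a` by compactness, elsewhere because `|z - a|` is
bounded below. -/
theorem dslope (hG : HasBoundary G φ) {a : ℂ} (ha : ‖a‖ < 1) :
    HasBoundary (dslope G a) (fun t => (φ t - G a) / (ζ t - a)) := by
  have hnhds : Metric.ball (0 : ℂ) 1 ∈ 𝓝 a := Metric.isOpen_ball.mem_nhds (by simpa using ha)
  have hd := (Complex.differentiableOn_dslope hnhds).2 hG.differentiableOn
  refine ⟨hd, ?_, ?_⟩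
  · obtain ⟨M, hM⟩ := hG.bounded
    set r := (1 + ‖a‖) / 2 with hr
    have har : ‖a‖ < r := by rw [hr]; linarith
    have hr1 : r < 1 := by rw [hr]; linarith
    obtain ⟨N, hN⟩ := (isCompact_closedBall (0 : ℂ) r).exists_bound_of_continuousOn
      (hd.continuousOn.mono (Metric.closedBall_subset_ball hr1))
    refine ⟨max N ((M + M) / (r - ‖a‖)), fun z hz => ?_⟩
    by_cases hzr : ‖z‖ ≤ r
    · exact le_max_of_le_left (hN z (by simpa using hzr))
    · push Not at hzr
      refine le_max_of_le_right ?_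
      have h1 : r - ‖a‖ ≤ ‖z - a‖ := by
        have := norm_sub_norm_le z a
        linarith
      have hne : z ≠ a := by rintro rfl; linarith
      rw [dslope_of_ne G hne, slope_def_field, norm_div]
      have h2 : ‖G z - G a‖ ≤ M + M := (norm_sub_le _ _).trans (add_le_add (hM z hz) (hM a ha))
      have h3 : 0 ≤ M + M := (norm_nonneg _).trans h2
      have h4 : 0 < r - ‖a‖ := by linarith
      gcongr
  · filter_upwards [hG.tendsto] with t ht
    have hne : ζ t - a ≠ 0 := by
      intro h
      rw [← sub_eq_zero.1 h, norm_ζ] at ha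
      exact lt_irrefl _ ha
    refine ((ht.sub_const (G a)).div ((tendsto_ofReal_mul_ζ t).sub_const a) hne).congr' ?_
    have hev : ∀ᶠ r : ℝ in 𝓝[<] 1, (r : ℂ) * ζ t ≠ a :=
      (tendsto_ofReal_mul_ζ t).eventually_ne (sub_ne_zero.1 hne)
    filter_upwards [hev] with r hr
    rw [dslope_of_ne G hr, slope_def_field]
    rfl

theorem congr_ae (hG : HasBoundary G φ) (h : φ =ᵐ[σ] ψ) : HasBoundary G ψ where
  differentiableOn := hG.differentiableOn
  bounded := hG.bounded
  tendsto := by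
    filter_upwards [hG.tendsto, h] with t h1 h2
    rwa [← h2]

end HasBoundary

/-! ### Fourier coefficients and Cauchy integrals of boundary functions -/

theorem fourier_eq_ζ_zpow (k : ℤ) (t : UnitAddCircle) : fourier k t = ζ t ^ k := by
  rw [fourier_apply, AddCircle.toCircle_zsmul, Circle.coe_zpow]
  rfl

theorem fourierCoeff_eq_integral (f : UnitAddCircle → ℂ) (n : ℤ) :
    fourierCoeff f n = ∫ t, f t * fourier (-n) t ∂σ := by
  rw [fourierCoeff]
  refine integral_congr_ae (ae_of_all _ fun t => ?_)
  simp [mul_comm]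

theorem norm_fourier_apply (k : ℤ) (t : UnitAddCircle) : ‖fourier k t‖ = 1 := by
  rw [fourier_eq_ζ_zpow, norm_zpow, norm_ζ, one_zpow]

theorem fourierCoeff_mul_fourier (f : UnitAddCircle → ℂ) (k n : ℤ) :
    fourierCoeff (fun t => f t * fourier k t) n = fourierCoeff f (n - k) := by
  rw [fourierCoeff_eq_integral, fourierCoeff_eq_integral]
  refine integral_congr_ae (ae_of_all _ fun t => ?_)
  simp only
  rw [mul_assoc, ← fourier_add]
  congr 3
  ring

theorem integrable_mul_fourier {f : UnitAddCircle → ℂ} (hf : Integrable f σ) (k : ℤ) :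
    Integrable (fun t => f t * fourier k t) σ :=
  hf.mul_bdd (c := 1) (ContinuousMap.continuous _).aestronglyMeasurable
    (ae_of_all _ fun t => (norm_fourier_apply k t).le)

/-- Multiplication by the boundary function of a bounded holomorphic function does not create
Fourier coefficients of lower index. -/
theorem HasBoundary.fourierCoeff_mul_eq_zero {G : ℂ → ℂ} {φ : UnitAddCircle → ℂ}
    (hG : HasBoundary G φ) {f : UnitAddCircle → ℂ} (hf : Integrable f σ) {m : ℤ}
    (hfm : ∀ n < m, fourierCoeff f n = 0) {n : ℤ} (hn : n < m) :
    fourierCoeff (fun t => f t * φ t) n = 0 := by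
  -- A dilate of `G` has an absolutely convergent expansion in nonnegative frequencies, which may be
  -- integrated against `f` term by term. Dominated convergence then lets `r → 1`.
  have hdil : ∀ r : ℝ, 0 < r → r < 1 →
      ∫ t, f t * fourier (-n) t * G ((r : ℂ) * ζ t) ∂σ = 0 := by
    intro r hr0 hr1
    set c : ℕ → ℂ := fun k => ((k.factorial : ℂ)⁻¹ * iteratedDeriv k G 0) * (r : ℂ) ^ k with hc
    have hsum : ∀ t : UnitAddCircle, HasSum (fun k : ℕ => c k * fourier k t) (G ((r : ℂ) * ζ t)) := by
      intro t
      have := Complex.hasSum_taylorSeries_on_ball hG.differentiableOn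
        (z := (r : ℂ) * ζ t) (by simpa using norm_ofReal_mul_ζ_lt_one hr0 hr1 t)
      refine this.congr_fun fun k => ?_
      rw [fourier_eq_ζ_zpow, zpow_natCast, sub_zero, mul_pow, smul_eq_mul, smul_eq_mul, hc]
      ring
    have hsummable : Summable fun k => ‖c k‖ := by
      have := (hsum 0).summable.norm
      refine this.congr fun k => ?_
      rw [norm_mul, norm_fourier_apply, mul_one]
    have hint : ∀ k : ℕ, Integrable (fun t => f t * fourier (-n) t * (c k * fourier k t)) σ := by
      intro k
      have := ((integrable_mul_fourier (integrable_mul_fourier hf (-n)) k).const_mul (c k))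
      refine this.congr (ae_of_all _ fun t => ?_)
      simp only
      ring
    have hS := hasSum_integral_of_summable_integral_norm hint ?_
    · have hz : ∀ k : ℕ, ∫ t, f t * fourier (-n) t * (c k * fourier k t) ∂σ = 0 := by
        intro k
        have h1 : fourierCoeff f (n - k) = 0 := hfm _ (by omega)
        rw [← fourierCoeff_mul_fourier, fourierCoeff_eq_integral] at h1
        rw [← mul_zero (c k), ← h1, ← integral_const_mul]
        refine integral_congr_ae (ae_of_all _ fun t => ?_)
        simp only
        ring
      simp only [hz] at hS
      have h2 := hS.unique hasSum_zero
      rw [← h2]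
      refine integral_congr_ae (ae_of_all _ fun t => ?_)
      exact ((hsum t).mul_left _).tsum_eq.symm
    · refine (hsummable.mul_right (∫ t, ‖f t‖ ∂σ)).congr fun k => ?_
      rw [← integral_const_mul]
      refine integral_congr_ae (ae_of_all _ fun t => ?_)
      simp only [norm_mul, norm_fourier_apply]
      ring
  obtain ⟨M, hM⟩ := hG.bounded
  have hlim : Tendsto (fun r : ℝ => ∫ t, f t * fourier (-n) t * G ((r : ℂ) * ζ t) ∂σ) (𝓝[<] 1)
      (𝓝 (∫ t, f t * fourier (-n) t * φ t ∂σ)) := by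
    refine tendsto_integral_filter_of_dominated_convergence (fun t => ‖f t‖ * M) ?_ ?_ ?_ ?_
    · filter_upwards [eventually_nhdsLT_one] with r hr
      exact (integrable_mul_fourier hf (-n)).aestronglyMeasurable.mul
        (hG.continuous_dilation hr.1 hr.2).aestronglyMeasurable
    · filter_upwards [eventually_nhdsLT_one] with r hr
      refine ae_of_all _ fun t => ?_
      rw [norm_mul, norm_mul, norm_fourier_apply, mul_one]
      exact mul_le_mul_of_nonneg_left (hM _ (norm_ofReal_mul_ζ_lt_one hr.1 hr.2 t)) (norm_nonneg _)
    · exact hf.norm.mul_const M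
    · filter_upwards [hG.tendsto] with t ht using ht.const_mul _
  have hlim0 : Tendsto (fun r : ℝ => ∫ t, f t * fourier (-n) t * G ((r : ℂ) * ζ t) ∂σ) (𝓝[<] 1)
      (𝓝 0) := by
    refine tendsto_const_nhds.congr' ?_
    filter_upwards [eventually_nhdsLT_one] with r hr using (hdil r hr.1 hr.2).symm
  rw [fourierCoeff_eq_integral, ← tendsto_nhds_unique hlim hlim0]
  refine integral_congr_ae (ae_of_all _ fun t => ?_)
  simp only
  ring

theorem HasBoundary.integral_mul_eq_zero {G : ℂ → ℂ} {φ : UnitAddCircle → ℂ}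
    (hG : HasBoundary G φ) {f : UnitAddCircle → ℂ} (hf : Integrable f σ)
    (hf₁ : ∀ n < (1 : ℤ), fourierCoeff f n = 0) : ∫ t, f t * φ t ∂σ = 0 := by
  have := hG.fourierCoeff_mul_eq_zero hf hf₁ zero_lt_one
  rw [fourierCoeff_eq_integral] at this
  simpa using this

theorem conj_ζ_mul (t : UnitAddCircle) : conj (ζ t) * ζ t = 1 := by
  rw [mul_comm, Complex.mul_conj, Complex.normSq_eq_norm_sq, norm_ζ]
  simp

theorem ζ_sub_ne_zero {a : ℂ} (ha : ‖a‖ < 1) (t : UnitAddCircle) : ζ t - a ≠ 0 := by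
  intro h
  rw [← sub_eq_zero.1 h, norm_ζ] at ha
  exact lt_irrefl _ ha

theorem one_sub_mul_conj_ζ_ne_zero {a : ℂ} (ha : ‖a‖ < 1) (t : UnitAddCircle) :
    1 - a * conj (ζ t) ≠ 0 := by
  have := one_sub_conj_mul_ne_zero (a := conj a) (b := conj (ζ t)) (by simpa) (by simp [norm_ζ])
  rwa [Complex.conj_conj] at this

theorem integrable_mul_cauchy {a : ℂ} (ha : ‖a‖ < 1) {f : UnitAddCircle → ℂ}
    (hf : Integrable f σ) : Integrable (fun t => f t * (1 - a * conj (ζ t))⁻¹) σ := by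
  refine hf.mul_bdd (c := (1 - ‖a‖)⁻¹) ?_ ?_
  · exact ((continuous_const.sub (continuous_const.mul
      (Complex.continuous_conj.comp continuous_ζ))).inv₀
        (one_sub_mul_conj_ζ_ne_zero ha)).aestronglyMeasurable
  · refine ae_of_all _ fun t => ?_
    rw [norm_inv]
    refine inv_anti₀ (by linarith) ?_
    have := one_sub_norm_le_norm_one_sub_conj_mul (a := conj a) (b := conj (ζ t)) (by simp [norm_ζ])
    rwa [Complex.conj_conj, RCLike.norm_conj] at this

/-- The Cauchy integral of a product is the product of the values. -/
theorem HasBoundary.integral_mul_cauchy {G : ℂ → ℂ} {φ : UnitAddCircle → ℂ}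
    (hG : HasBoundary G φ) {f : UnitAddCircle → ℂ} (hf : Integrable f σ)
    (hf₀ : ∀ n < (0 : ℤ), fourierCoeff f n = 0) {a : ℂ} (ha : ‖a‖ < 1) :
    ∫ t, f t * φ t * (1 - a * conj (ζ t))⁻¹ ∂σ =
      G a * ∫ t, f t * (1 - a * conj (ζ t))⁻¹ ∂σ := by
  -- On the circle `1/(1 - a ζ̄) = ζ/(ζ - a)`, so the difference of the two sides is the integral of
  -- `f ζ`, which has only positive frequencies, against the boundary function of `(G - G a)/(z -
  -- a)`.
  have h1 := (hG.dslope ha).integral_mul_eq_zero (f := fun t => f t * fourier 1 t)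
    (integrable_mul_fourier hf 1) (fun n hn => by
      rw [fourierCoeff_mul_fourier]; exact hf₀ _ (by omega))
  rw [← sub_eq_zero, ← integral_const_mul, ← integral_sub, ← h1]
  · refine integral_congr_ae (ae_of_all _ fun t => ?_)
    simp only
    have e1 := ζ_sub_ne_zero ha t
    have e2 := one_sub_mul_conj_ζ_ne_zero ha t
    have e3 := conj_ζ_mul t
    have e4 : (1 - a * conj (ζ t))⁻¹ = ζ t / (ζ t - a) := by
      rw [inv_eq_one_div, div_eq_div_iff e2 e1]
      linear_combination a * e3
    rw [fourier_one, e4]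
    change _ = f t * ζ t * _
    ring
  · exact integrable_mul_cauchy ha (hG.integrable_mul hf)
  · exact (integrable_mul_cauchy ha hf).const_mul _

theorem fourierCoeff_one_eq_zero {n : ℤ} (hn : n ≠ 0) :
    fourierCoeff (fun _ : UnitAddCircle => (1 : ℂ)) n = 0 := by
  have h := congrFun (fourierCoeff_fourier (T := 1) 0) n
  rw [Pi.single_eq_of_ne hn] at h
  rw [← h]
  congr 1
  ext t
  simp

/-- The conjugate of the mean of `1/(1 - ā z)` over the circle, which is its value at `0`. -/
theorem integral_cauchy {a : ℂ} (ha : ‖a‖ < 1) :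
    ∫ t, (1 - a * conj (ζ t))⁻¹ ∂σ = 1 := by
  have h : ∫ t, (1 : ℂ) * (1 - conj a * ζ t)⁻¹ ∂σ = 1 := by
    have h1 := (HasBoundary.dslope (HasBoundary.cauchy ha) (a := 0) (by simp)).integral_mul_eq_zero
      (f := fun t => 1 * fourier 1 t)
      (integrable_mul_fourier (integrable_const 1) 1) (fun n hn => by
        rw [fourierCoeff_mul_fourier]; exact fourierCoeff_one_eq_zero (by omega))
    have h2 : Integrable (fun t => (1 : ℂ) * (1 - conj a * ζ t)⁻¹) σ :=
      (HasBoundary.cauchy ha).integrable_mul (integrable_const 1)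
    have h3 : ∫ _t : UnitAddCircle, (1 : ℂ) ∂σ = 1 := by simp
    rw [← sub_eq_zero, ← h1]
    nth_rw 3 [← h3]
    rw [← integral_sub h2 (integrable_const 1)]
    refine integral_congr_ae (ae_of_all _ fun t => ?_)
    have : ζ t ≠ 0 := by
      intro h
      have := norm_ζ t
      simp [h] at this
    simp only [fourier_one]
    change _ = 1 * ζ t * _
    rw [mul_zero, sub_zero, inv_one, sub_zero]
    field_simp
  have h4 := congrArg conj h
  rw [← integral_conj, map_one] at h4
  refine Eq.trans (integral_congr_ae (ae_of_all _ fun t => ?_)) h4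
  simp

theorem HasBoundary.integral_cauchy_eq {G : ℂ → ℂ} {φ : UnitAddCircle → ℂ}
    (hG : HasBoundary G φ) {a : ℂ} (ha : ‖a‖ < 1) :
    ∫ t, φ t * (1 - a * conj (ζ t))⁻¹ ∂σ = G a := by
  have := hG.integral_mul_cauchy (f := fun _ => 1) (integrable_const 1)
    (fun n hn => fourierCoeff_one_eq_zero hn.ne) ha
  simpa [integral_cauchy ha] using this


/-! ### Inner functions and their reproducing kernels -/

theorem HasBoundary.ae_bdry_eq {G : ℂ → ℂ} {φ : UnitAddCircle → ℂ} (hG : HasBoundary G φ) :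
    ∀ᵐ t ∂σ, bdry G t = φ t := by
  filter_upwards [hG.tendsto] with t ht using ht.limUnder_eq

namespace IsInner

variable {I E : ℂ → ℂ}

theorem hasBoundary (hI : IsInner I) : HasBoundary I (bdry I) where
  differentiableOn := hI.differentiableOn
  bounded := ⟨1, fun z hz => hI.norm_le_one z (by simpa using hz)⟩
  tendsto := by
    filter_upwards [hI.norm_bdry] with t ht
    obtain ⟨w, -, hw⟩ := ht
    exact tendsto_nhds_limUnder ⟨w, hw⟩

theorem ae_norm_bdry_eq_one (hI : IsInner I) : ∀ᵐ t ∂σ, ‖bdry I t‖ = 1 := by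
  filter_upwards [hI.norm_bdry] with t ht
  obtain ⟨w, hw1, hw⟩ := ht
  rw [bdry, hw.limUnder_eq, hw1]

theorem ae_bdry_mul (hI : IsInner I) (hE : IsInner E) :
    ∀ᵐ t ∂σ, bdry (I * E) t = bdry I t * bdry E t :=
  (hI.hasBoundary.mul hE.hasBoundary).ae_bdry_eq

protected theorem mul (hI : IsInner I) (hE : IsInner E) : IsInner (I * E) where
  differentiableOn := hI.differentiableOn.mul hE.differentiableOn
  norm_le_one z hz := by
    rw [Pi.mul_apply, norm_mul]
    exact mul_le_one₀ (hI.norm_le_one z hz) (norm_nonneg _) (hE.norm_le_one z hz)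
  norm_bdry := by
    filter_upwards [hI.norm_bdry, hE.norm_bdry] with t h1 h2
    obtain ⟨w, hw1, hw⟩ := h1
    obtain ⟨v, hv1, hv⟩ := h2
    exact ⟨w * v, by rw [norm_mul, hw1, hv1, one_mul], hw.mul hv⟩

end IsInner

/-- The value at `z` of the reproducing kernel at `a`. -/
def kernelFun (I : ℂ → ℂ) (a z : ℂ) : ℂ := (1 - conj (I a) * I z) * (1 - conj a * z)⁻¹

/-- The boundary function of `z ↦ z (I z - I a) / (z - a)`, the conjugate kernel. -/
def conjKernel (I : ℂ → ℂ) (a : ℂ) (t : UnitAddCircle) : ℂ :=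
  ζ t * ((bdry I t - I a) / (ζ t - a))

variable {I E J : ℂ → ℂ}

theorem IsInner.hasBoundary_kernel (hI : IsInner I) (a : Complex.UnitDisc) :
    HasBoundary (kernelFun I a) (kernel I a) :=
  (((HasBoundary.const 1).sub ((HasBoundary.const (conj (I a))).mul hI.hasBoundary)).mul
    (HasBoundary.cauchy a.norm_lt_one)).congr_ae (ae_of_all _ fun t => by
      rw [kernel, div_eq_mul_inv])

theorem IsInner.hasBoundary_conjKernel (hI : IsInner I) (a : Complex.UnitDisc) :
    HasBoundary (fun z => z * dslope I a z) (conjKernel I a) :=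
  HasBoundary.id.mul (hI.hasBoundary.dslope a.norm_lt_one)

theorem mul_conj_of_norm_eq_one {w : ℂ} (hw : ‖w‖ = 1) : w * conj w = 1 := by
  rw [Complex.mul_conj, Complex.normSq_eq_norm_sq, hw]
  simp

/-- On the circle conjugation inverts both `ζ` and `I`. As the conjugate kernel has only positive
frequencies, this is the factorisation that places `k_a` in `K_I`. -/
theorem IsInner.ae_kernel_eq (hI : IsInner I) (a : Complex.UnitDisc) :
    ∀ᵐ t ∂σ, kernel I a t = bdry I t * conj (conjKernel I a t) := by
  filter_upwards [hI.ae_norm_bdry_eq_one] with t ht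
  have e1 := mul_conj_of_norm_eq_one ht
  have e2 := conj_ζ_mul t
  have n1 : 1 - conj (a : ℂ) * ζ t ≠ 0 :=
    one_sub_conj_mul_ne_zero a.norm_lt_one (norm_ζ t).le
  have n2 : conj (ζ t) - conj (a : ℂ) ≠ 0 := by
    rw [← map_sub]
    exact (map_ne_zero _).2 (ζ_sub_ne_zero a.norm_lt_one t)
  rw [kernel, conjKernel]
  simp only [map_mul, map_div₀, map_sub]
  rw [← mul_assoc, ← mul_div_assoc, div_eq_div_iff n1 n2]
  linear_combination (-(conj (ζ t)) * (1 - conj (a : ℂ) * ζ t)) * e1 +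
    (1 - conj (I a) * bdry I t) * (conj (a : ℂ)) * e2

theorem IsInner.memLp_kernel (hI : IsInner I) (a : Complex.UnitDisc) (r : ℝ≥0∞) :
    MemLp (kernel I a) r σ :=
  (hI.hasBoundary_kernel a).memLp_top.mono_exponent le_top

theorem conj_kernel (I : ℂ → ℂ) (a : Complex.UnitDisc) (t : UnitAddCircle) :
    conj (kernel I a t) =
      (1 - I a * conj (bdry I t)) * (1 - (a : ℂ) * conj (ζ t))⁻¹ := by
  rw [kernel, map_div₀]
  simp [div_eq_mul_inv]

theorem integrable_conj {f : UnitAddCircle → ℂ} (hf : Integrable f σ) :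
    Integrable (fun t => conj (f t)) σ :=
  hf.mono (Complex.continuous_conj.comp_aestronglyMeasurable hf.1) (ae_of_all _ fun t => by simp)

theorem integral_conj_mul_cauchy_eq_zero {g : UnitAddCircle → ℂ} (hg : Integrable g σ)
    (hg₁ : ∀ n < (1 : ℤ), fourierCoeff g n = 0) {a : ℂ} (ha : ‖a‖ < 1) :
    ∫ t, conj (g t) * (1 - a * conj (ζ t))⁻¹ ∂σ = 0 := by
  have h := congrArg conj ((HasBoundary.cauchy ha).integral_mul_eq_zero hg hg₁)
  rw [← integral_conj, map_zero] at h
  refine Eq.trans (integral_congr_ae (ae_of_all _ fun t => ?_)) h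
  simp

theorem HasBoundary.fourierCoeff_eq_zero {G : ℂ → ℂ} {φ : UnitAddCircle → ℂ}
    (hG : HasBoundary G φ) {n : ℤ} (hn : n < 0) : fourierCoeff φ n = 0 := by
  have := hG.fourierCoeff_mul_eq_zero (f := fun _ => 1) (integrable_const 1) (m := 0)
    (fun n hn => fourierCoeff_one_eq_zero hn.ne) hn
  simpa using this

theorem HasBoundary.integrable {G : ℂ → ℂ} {φ : UnitAddCircle → ℂ}
    (hG : HasBoundary G φ) : Integrable φ σ := by
  simpa using hG.integrable_mul (f := fun _ => 1) (integrable_const 1)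

theorem IsInner.fourierCoeff_conjKernel (hI : IsInner I) (a : Complex.UnitDisc) {n : ℤ}
    (hn : n < 1) : fourierCoeff (conjKernel I a) n = 0 := by
  have h := hI.hasBoundary.dslope a.norm_lt_one
  have := fourierCoeff_mul_fourier (fun t => (bdry I t - I a) / (ζ t - a)) 1 n
  rw [h.fourierCoeff_eq_zero (by omega)] at this
  rw [← this]
  refine congrFun (fourierCoeff_congr_ae (ae_of_all _ fun t => ?_)) n
  rw [conjKernel, fourier_one, mul_comm]
  rfl

/-- `‖k_a‖₂² = k_a(a)`. -/
theorem IsInner.integral_kernel_mul_conj (hI : IsInner I) (a : Complex.UnitDisc) :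
    ∫ t, kernel I a t * conj (kernel I a t) ∂σ = kernelFun I a a := by
  have ha := a.norm_lt_one
  -- Since `conj k_a = (1 - I(a) Ī)/(1 - a ζ̄)`, the integral splits into the Cauchy integral of
  -- `k_a`, equal to `k_a(a)`, and that of `k_a Ī`, which vanishes because `k_a Ī` is the conjugate
  -- of a function in `H_0`.
  have h1 := (hI.hasBoundary_kernel a).integral_cauchy_eq ha
  have h2 := integral_conj_mul_cauchy_eq_zero (hI.hasBoundary_conjKernel a).integrable
    (fun n hn => hI.fourierCoeff_conjKernel a hn) ha
  rw [← h1, ← sub_zero (∫ t, kernel I a t * (1 - (a : ℂ) * conj (ζ t))⁻¹ ∂σ), ← mul_zero (I a), ← h2, ← integral_const_mul,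
    ← integral_sub]
  · refine integral_congr_ae ?_
    filter_upwards [hI.ae_kernel_eq a, hI.ae_norm_bdry_eq_one] with t h3 h4
    have h5 := mul_conj_of_norm_eq_one h4
    rw [conj_kernel]
    have h6 : kernel I a t * conj (bdry I t) = conj (conjKernel I a t) := by
      rw [h3]
      linear_combination (conj (conjKernel I a t)) * h5
    linear_combination (-(I a) * (1 - (a : ℂ) * conj (ζ t))⁻¹) * h6
  · exact integrable_mul_cauchy ha (hI.hasBoundary_kernel a).integrable
  · refine (integrable_mul_cauchy ha ?_).const_mul _
    exact integrable_conj (hI.hasBoundary_conjKernel a).integrable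

theorem kernelFun_self (I : ℂ → ℂ) (a : ℂ) :
    kernelFun I a a = (((1 - ‖I a‖ ^ 2) / (1 - ‖a‖ ^ 2) : ℝ) : ℂ) := by
  have h : ∀ w : ℂ, conj w * w = ((‖w‖ ^ 2 : ℝ) : ℂ) := fun w => by
    rw [mul_comm, Complex.mul_conj, Complex.normSq_eq_norm_sq]
  rw [kernelFun, h, h]
  push_cast
  rw [div_eq_mul_inv]

/-! ### Structure of `K^p_I` -/

section Spaces

variable {p s : ℝ≥0∞} [Fact (1 ≤ p)] [Fact (1 ≤ s)]

theorem eval_apply (I : ℂ → ℂ) (a : Complex.UnitDisc) (f : K p I) :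
    eval p I a f = ∫ t, (f : Lp ℂ p σ) t * (1 - (a : ℂ) * conj (ζ t))⁻¹ ∂σ := rfl

/-- The product of a function in `K^p_I` and a reproducing kernel of `K_E` lies in `K^s_{IE}`. -/
theorem exists_mul_kernel_mem (hI : IsInner I) (hE : IsInner E) (hsp : s ≤ p) (h : K p I)
    (a : Complex.UnitDisc) :
    ∃ f : K s (I * E), ((f : Lp ℂ s σ) =ᵐ[σ] fun t => (h : Lp ℂ p σ) t * kernel E a t) ∧
      ∀ b : Complex.UnitDisc, eval s (I * E) b f = eval p I b h * kernelFun E a b := by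
  obtain ⟨f, hf, g, hg, hfg⟩ := h
  have hmem : ∀ {G : ℂ → ℂ} {φ : UnitAddCircle → ℂ}, HasBoundary G φ → ∀ u : Lp ℂ p σ,
      MemLp (fun t => u t * φ t) s σ := by
    intro G φ hG u
    exact (MemLp.mul' (r := p) hG.memLp_top (Lp.memLp u)).mono_exponent hsp
  have hk := hE.hasBoundary_kernel a
  have hk' := hE.hasBoundary_conjKernel a
  have hfi := integrable_Lp p f
  have hgi := integrable_Lp p g
  have e1 := (hmem hk f).coeFn_toLp
  have e2 := (hmem hk' g).coeFn_toLp
  -- With `f = I ḡ` and `k_a = E conj(k̃_a)`, where `k̃_a` is the conjugate kernel, the product is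
  -- `IE` times the conjugate of `g k̃_a`, which has only positive frequencies.
  refine ⟨⟨(hmem hk f).toLp, ?_, (hmem hk' g).toLp, ?_, ?_⟩, e1, fun b => ?_⟩
  · intro n hn
    rw [fourierCoeff_congr_ae e1]
    exact hk.fourierCoeff_mul_eq_zero hfi hf hn
  · intro n hn
    rw [fourierCoeff_congr_ae e2]
    exact hk'.fourierCoeff_mul_eq_zero hgi hg hn
  · filter_upwards [e1, e2, hfg, hE.ae_kernel_eq a, hI.ae_bdry_mul hE] with t h1 h2 h3 h4 h5
    rw [h1, h2, h3, h4, h5, map_mul]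
    ring
  · rw [eval_apply, eval_apply, mul_comm (∫ _, _ ∂σ)]
    rw [← hk.integral_mul_cauchy hfi hf b.norm_lt_one]
    refine integral_congr_ae ?_
    filter_upwards [e1] with t h1
    rw [h1]

/-- The part of `conj k_a` containing `J(a) J̄` contributes nothing: for `f` in the space, `f J̄` is
the conjugate of a function in `H_0`, and the Cauchy integral kills it. -/
theorem integral_mul_conj_kernel (hJ : IsInner J) (a : Complex.UnitDisc) (f : K s J) :
    ∫ t, (f : Lp ℂ s σ) t * conj (kernel J a t) ∂σ = eval s J a f := by
  obtain ⟨f, hf, g, hg, hfg⟩ := f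
  have ha := a.norm_lt_one
  have h2 := integral_conj_mul_cauchy_eq_zero (integrable_Lp s g) hg ha
  rw [eval_apply, ← sub_zero (∫ t, _ * (1 - (a : ℂ) * conj (ζ t))⁻¹ ∂σ), ← mul_zero (J a), ← h2,
    ← integral_const_mul, ← integral_sub]
  · refine integral_congr_ae ?_
    filter_upwards [hfg, hJ.ae_norm_bdry_eq_one] with t h3 h4
    have h5 := mul_conj_of_norm_eq_one h4
    have h6 : f t * conj (bdry J t) = conj (g t) := by
      rw [h3]
      linear_combination (conj (g t)) * h5
    rw [conj_kernel]
    linear_combination (-(J a) * (1 - (a : ℂ) * conj (ζ t))⁻¹) * h6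
  · exact integrable_mul_cauchy ha (integrable_Lp s f)
  · refine (integrable_mul_cauchy ha ?_).const_mul _
    exact integrable_conj (integrable_Lp s g)

theorem norm_integral_mul_le {f g : UnitAddCircle → ℂ} {s s' : ℝ≥0∞} (hs' : 1 / s + 1 / s' = 1)
    (hf : MemLp f s σ) (hg : MemLp g s' σ) :
    ‖∫ t, f t * g t ∂σ‖ ≤ (eLpNorm f s σ).toReal * (eLpNorm g s' σ).toReal := by
  have : ENNReal.HolderTriple s s' 1 := ⟨by simpa using hs'⟩
  have h := eLpNorm_smul_le_mul_eLpNorm (p := s) (q := s') (r := 1) hg.1 hf.1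
  refine (norm_integral_le_integral_norm _).trans ?_
  change ∫ t, ‖(f * g) t‖ ∂σ ≤ _
  rw [integral_norm_eq_lintegral_enorm (hf.1.mul hg.1), ← eLpNorm_one_eq_lintegral_enorm,
    ← ENNReal.toReal_mul]
  exact ENNReal.toReal_mono (ENNReal.mul_ne_top hf.2.ne hg.2.ne) h

/-- Hölder in the reproducing formula. Only this direction of the comparison between the two
normalisations is needed. -/
theorem norm_eval_le (hJ : IsInner J) {s' : ℝ≥0∞} (hs' : 1 / s + 1 / s' = 1)
    (a : Complex.UnitDisc) : ‖eval s J a‖ ≤ kernelNorm J s' a := by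
  refine ContinuousLinearMap.opNorm_le_bound _ ENNReal.toReal_nonneg fun f => ?_
  rw [← integral_mul_conj_kernel hJ, mul_comm]
  have := norm_integral_mul_le hs' (Lp.memLp (f : Lp ℂ s σ)) (hJ.memLp_kernel a s').star
  rw [eLpNorm_star] at this
  exact this

theorem continuous_integral_mul {w : UnitAddCircle → ℂ} {C : ℝ} (hw : AEStronglyMeasurable w σ)
    (hC : ∀ᵐ t ∂σ, ‖w t‖ ≤ C) : Continuous fun f : Lp ℂ s σ => ∫ t, f t * w t ∂σ := by
  have hC0 : 0 ≤ C := by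
    obtain ⟨t, ht⟩ := hC.exists
    exact (norm_nonneg _).trans ht
  have hi : ∀ f : Lp ℂ s σ, Integrable (fun t => f t * w t) σ := fun f =>
    (integrable_Lp s f).mul_bdd hw hC
  refine (LipschitzWith.of_dist_le_mul (K := C.toNNReal) fun f g => ?_).continuous
  rw [dist_eq_norm, dist_eq_norm, ← integral_sub (hi f) (hi g), Real.coe_toNNReal C hC0]
  refine (norm_integral_le_integral_norm _).trans ?_
  refine le_trans ?_ (mul_le_mul_of_nonneg_left (integral_norm_le s (f - g)) hC0)
  rw [← integral_const_mul]
  refine integral_mono_ae ((hi f).sub (hi g)).norm ((integrable_Lp s _).norm.const_mul _) ?_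
  filter_upwards [hC, Lp.coeFn_sub f g] with t h1 h2
  rw [h2, Pi.sub_apply, ← sub_mul, norm_mul, mul_comm]
  exact mul_le_mul_of_nonneg_right h1 (norm_nonneg _)

theorem fourierCoeff_mul_conj (u f : UnitAddCircle → ℂ) (n : ℤ) :
    fourierCoeff (fun t => u t * conj (f t)) n =
      conj (∫ t, f t * (conj (u t) * fourier n t) ∂σ) := by
  rw [fourierCoeff_eq_integral, ← integral_conj]
  refine integral_congr_ae (ae_of_all _ fun t => ?_)
  simp only [map_mul, Complex.conj_conj, fourier_neg]
  ring

/-- Since `|J| = 1`, the function `g` of the definition must be `J f̄`. Eliminating it turns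
membership into the vanishing of integrals that depend continuously on `f`. -/
theorem mem_K_iff (hJ : IsInner J) (f : Lp ℂ s σ) :
    f ∈ K s J ↔ (∀ n < (0 : ℤ), ∫ t, f t * fourier (-n) t ∂σ = 0) ∧
      ∀ n < (1 : ℤ), ∫ t, f t * (conj (bdry J t) * fourier n t) ∂σ = 0 := by
  have hm : MemLp (fun t => bdry J t * conj (f t)) s σ :=
    MemLp.mul' (r := s) (Lp.memLp f).star hJ.hasBoundary.memLp_top
  have key : (∀ n < (1 : ℤ), fourierCoeff (fun t => bdry J t * conj (f t)) n = 0) ↔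
      ∀ n < (1 : ℤ), ∫ t, f t * (conj (bdry J t) * fourier n t) ∂σ = 0 := by
    refine forall₂_congr fun n _ => ?_
    rw [fourierCoeff_mul_conj, map_eq_zero]
  rw [← key]
  constructor
  · rintro ⟨hf, g, hg, hfg⟩
    refine ⟨fun n hn => by rw [← fourierCoeff_eq_integral]; exact hf n hn, fun n hn => ?_⟩
    rw [← hg n hn]
    refine congrFun (fourierCoeff_congr_ae ?_) n
    filter_upwards [hfg, hJ.ae_norm_bdry_eq_one] with t h1 h2
    have h3 := mul_conj_of_norm_eq_one h2
    rw [h1, map_mul, Complex.conj_conj, ← mul_assoc, h3, one_mul]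
  · rintro ⟨hf, hg⟩
    refine ⟨fun n hn => by rw [fourierCoeff_eq_integral]; exact hf n hn, hm.toLp, fun n hn => ?_, ?_⟩
    · rw [fourierCoeff_congr_ae hm.coeFn_toLp]
      exact hg n hn
    · filter_upwards [hm.coeFn_toLp, hJ.ae_norm_bdry_eq_one] with t h1 h2
      have h3 := mul_conj_of_norm_eq_one h2
      rw [h1, map_mul, Complex.conj_conj, ← mul_assoc, h3, one_mul]

theorem isClosed_K (hJ : IsInner J) : IsClosed (K s J : Set (Lp ℂ s σ)) := by
  have : (K s J : Set (Lp ℂ s σ)) =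
      (⋂ n : ℤ, ⋂ _ : n < 0, {f | ∫ t, f t * fourier (-n) t ∂σ = 0}) ∩
        ⋂ n : ℤ, ⋂ _ : n < 1, {f | ∫ t, f t * (conj (bdry J t) * fourier n t) ∂σ = 0} := by
    ext f
    simp only [SetLike.mem_coe, mem_K_iff hJ, Set.mem_inter_iff, Set.mem_iInter, Set.mem_ofPred_eq]
  rw [this]
  refine IsClosed.inter (isClosed_iInter fun n => isClosed_iInter fun _ => ?_)
    (isClosed_iInter fun n => isClosed_iInter fun _ => ?_)
  · exact isClosed_eq (continuous_integral_mul (C := 1)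
      (ContinuousMap.continuous _).aestronglyMeasurable
      (ae_of_all _ fun t => (norm_fourier_apply _ t).le)) continuous_const
  · refine isClosed_eq (continuous_integral_mul (C := 1) ?_ ?_) continuous_const
    · exact hJ.hasBoundary.aestronglyMeasurable.star.mul
        (ContinuousMap.continuous _).aestronglyMeasurable
    · filter_upwards [hJ.ae_norm_bdry_eq_one] with t h1
      rw [norm_mul, RCLike.norm_conj, h1, norm_fourier_apply, one_mul]

end Spaces


/-! ### Norms of reproducing kernels of one-component inner functions -/

/-- The value `k_a^E(a) = ‖k_a^E‖₂²`. -/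
def kernelDiag (E : ℂ → ℂ) (a : Complex.UnitDisc) : ℝ := (1 - ‖E a‖ ^ 2) / (1 - ‖(a : ℂ)‖ ^ 2)

theorem one_sub_norm_sq_pos (a : Complex.UnitDisc) : 0 < 1 - ‖(a : ℂ)‖ ^ 2 := by
  nlinarith [a.norm_lt_one, norm_nonneg (a : ℂ)]

/-- Hölder applied to `‖k_a‖_2² = k_a(a)`; the source of the lower bounds for kernel norms. -/
theorem IsInner.kernelDiag_le_mul (hE : IsInner E) {p p' : ℝ≥0∞} (h : 1 / p + 1 / p' = 1)
    (a : Complex.UnitDisc) : kernelDiag E a ≤ kernelNorm E p a * kernelNorm E p' a := by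
  have h1 := norm_integral_mul_le h (hE.memLp_kernel a p) (hE.memLp_kernel a p').star
  rw [eLpNorm_star] at h1
  refine le_trans ?_ h1
  change _ ≤ ‖∫ t, kernel E a t * conj (kernel E a t) ∂σ‖
  rw [hE.integral_kernel_mul_conj, kernelFun_self, Complex.norm_real]
  exact Real.le_norm_self _

/-- Gives the decay `|k_a| ≤ 1/|x - x₀|` away from the direction of `a`. Replacing `|a| w` by `w` at
most doubles the distance to `1`, and `|1 - w| = 2 |sin π(x - x₀)| ≥ 4 |x - x₀|`. -/
theorem two_mul_abs_le_norm_one_sub {a : ℂ} (ha : ‖a‖ ≤ 1) {x₀ : ℝ}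
    (hx₀ : a = ‖a‖ * ζ (x₀ : UnitAddCircle)) {x : ℝ} (hx : |x - x₀| ≤ 1 / 2) :
    2 * |x - x₀| ≤ ‖1 - conj a * ζ (x : UnitAddCircle)‖ := by
  set w : ℂ := Complex.exp (2 * Real.pi * Complex.I * ((x - x₀ : ℝ) : ℂ)) with hw
  have h1 : conj a * ζ (x : UnitAddCircle) = ‖a‖ * w := by
    have h2 : ζ (x : UnitAddCircle) = ζ (x₀ : UnitAddCircle) * w := by
      rw [ζ_coe, ζ_coe, hw, ← Complex.exp_add]
      congr 1
      push_cast
      ring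
    have h3 := conj_ζ_mul (x₀ : UnitAddCircle)
    have h4 : conj a = ‖a‖ * conj (ζ (x₀ : UnitAddCircle)) := by
      conv_lhs => rw [hx₀]
      rw [map_mul, Complex.conj_ofReal]
    rw [h2, h4]
    linear_combination (‖a‖ * w) * h3
  have hw1 : ‖w‖ = 1 := by
    rw [hw, Complex.norm_exp]
    simp
  have h5 : ‖1 - w‖ ≤ 2 * ‖1 - (‖a‖ : ℂ) * w‖ := by
    have h6 : ‖(‖a‖ : ℂ) * w - w‖ = 1 - ‖a‖ := by
      have : (‖a‖ : ℂ) * w - w = -(((1 - ‖a‖ : ℝ) : ℂ) * w) := by push_cast; ring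
      rw [this, norm_neg, norm_mul, hw1, mul_one, Complex.norm_real,
        Real.norm_of_nonneg (by linarith)]
    have h7 : 1 - ‖a‖ ≤ ‖1 - (‖a‖ : ℂ) * w‖ := by
      have := norm_sub_norm_le (1 : ℂ) ((‖a‖ : ℂ) * w)
      rwa [norm_one, norm_mul, hw1, mul_one, Complex.norm_real, norm_norm] at this
    have h8 : 1 - w = (1 - (‖a‖ : ℂ) * w) + ((‖a‖ : ℂ) * w - w) := by ring
    rw [h8]
    refine (norm_add_le _ _).trans ?_
    linarith
  have h9 : 4 * |x - x₀| ≤ ‖1 - w‖ := by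
    have e : ‖1 - w‖ = 2 * |Real.sin (Real.pi * (x - x₀))| := by
      rw [norm_sub_rev, hw, show (2 * Real.pi * Complex.I * ((x - x₀ : ℝ) : ℂ)) =
        Complex.I * ((2 * (Real.pi * (x - x₀)) : ℝ) : ℂ) by push_cast; ring,
        Complex.norm_exp_I_mul_ofReal_sub_one, Real.norm_eq_abs, abs_mul, abs_two]
      congr 3
      ring
    have hpi := Real.pi_pos
    have h10 := Real.mul_abs_le_abs_sin (x := Real.pi * (x - x₀)) (by
      rw [abs_mul, abs_of_pos hpi]
      nlinarith)
    rw [abs_mul, abs_of_pos hpi, ← mul_assoc, div_mul_cancel₀ _ hpi.ne'] at h10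
    linarith
  rw [h1]
  linarith

theorem exists_eq_norm_mul_ζ (a : ℂ) : ∃ x₀ : ℝ, a = ‖a‖ * ζ (x₀ : UnitAddCircle) := by
  by_cases ha : a = 0
  · exact ⟨0, by simp [ha]⟩
  · have hn : (‖a‖ : ℂ) ≠ 0 := by simpa using ha
    obtain ⟨x₀, hx₀⟩ := exists_ζ_coe_eq (u := a / ‖a‖) (by
      rw [norm_div, Complex.norm_real, norm_norm, div_self (by simpa using ha)])
    exact ⟨x₀, by rw [hx₀, mul_div_cancel₀ _ hn]⟩

/-- The integral of `‖f‖ ^ r` for a function on the circle dominated by `min (M, 1 / |x|)`. -/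
theorem exists_integral_rpow_le {r : ℝ} (hr : 1 < r) :
    ∃ K : ℝ, 0 < K ∧ ∀ (f : UnitAddCircle → ℂ) (M x₀ : ℝ), 0 < M → (∀ᵐ t ∂σ, ‖f t‖ ≤ M) →
      (∀ᵐ t ∂σ, ∀ x : ℝ, (x : UnitAddCircle) = t → |x - x₀| ≤ 1 / 2 → |x - x₀| * ‖f t‖ ≤ 1) →
      ∫ t, ‖f t‖ ^ r ∂σ ≤ K * M ^ (r - 1) := by
  set g : ℝ → ℝ := fun y => (1 + ‖y‖) ^ (-r) with hg
  have hgi : Integrable g := integrable_one_add_norm (by simpa using hr)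
  have hg0 : ∀ y, 0 ≤ g y := fun y => by positivity
  refine ⟨2 ^ r * (∫ y, g y) + 1, ?_, fun f M x₀ hM h1 h2 => ?_⟩
  · have : 0 ≤ ∫ y, g y := integral_nonneg fun y => hg0 y
    positivity
  have hvol : (volume : Measure UnitAddCircle) = σ := by
    rw [AddCircle.volume_eq_smul_haarAddCircle]; simp
  have hae : ∀ᵐ x : ℝ ∂(volume.restrict (Set.Ioc (x₀ - 1 / 2) (x₀ - 1 / 2 + 1))),
      ‖f (x : UnitAddCircle)‖ ^ r ≤ (2 * M) ^ r * g (M * (x - x₀)) := by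
    have h3 := h1.and h2
    rw [← hvol] at h3
    have h4 := (AddCircle.measurePreserving_mk 1 (x₀ - 1 / 2)).quasiMeasurePreserving.ae h3
    rw [ae_restrict_iff' measurableSet_Ioc] at h4 ⊢
    filter_upwards [h4] with x hx hxI
    obtain ⟨hx1, hx2⟩ := hx hxI
    have hx3 := hx2 x rfl (abs_le.2 ⟨by linarith [hxI.1], by linarith [hxI.2]⟩)
    set F := ‖f (x : UnitAddCircle)‖ with hF
    have hF0 : 0 ≤ F := norm_nonneg _
    -- The sum of `F ≤ M` and `M |x - x₀| F ≤ M`. The majorant is a fixed profile, integrable to the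
    -- power `r > 1`, rescaled by `M`; this produces `M^{r-1}`.
    have h5 : F ≤ 2 * M * (1 + M * |x - x₀|)⁻¹ := by
      have hpos : 0 < 1 + M * |x - x₀| := by positivity
      rw [← div_eq_mul_inv, le_div_iff₀ hpos]
      nlinarith
    calc F ^ r ≤ (2 * M * (1 + M * |x - x₀|)⁻¹) ^ r := Real.rpow_le_rpow hF0 h5 (by linarith)
      _ = (2 * M) ^ r * g (M * (x - x₀)) := by
        rw [Real.mul_rpow (by positivity) (by positivity), hg]
        simp only
        rw [Real.rpow_neg (by positivity), Real.inv_rpow (by positivity), norm_mul,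
          Real.norm_of_nonneg hM.le, Real.norm_eq_abs]
  have hi : Integrable (fun x : ℝ => (2 * M) ^ r * g (M * (x - x₀))) := by
    refine Integrable.const_mul ?_ _
    exact (hgi.comp_mul_left' hM.ne').comp_sub_right x₀
  have hval : ∫ x : ℝ, (2 * M) ^ r * g (M * (x - x₀)) = 2 ^ r * (∫ y, g y) * M ^ (r - 1) := by
    rw [integral_const_mul, integral_sub_right_eq_self (fun x => g (M * x)) x₀,
      Measure.integral_comp_mul_left, abs_of_pos (inv_pos.2 hM), smul_eq_mul,
      Real.mul_rpow (by positivity) hM.le, Real.rpow_sub hM, Real.rpow_one]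
    field_simp
  calc ∫ t, ‖f t‖ ^ r ∂σ
      = ∫ x in Set.Ioc (x₀ - 1 / 2) (x₀ - 1 / 2 + 1), ‖f (x : UnitAddCircle)‖ ^ r := by
        rw [← hvol]
        exact (AddCircle.integral_preimage 1 (x₀ - 1 / 2) fun t => ‖f t‖ ^ r).symm
    _ ≤ ∫ x in Set.Ioc (x₀ - 1 / 2) (x₀ - 1 / 2 + 1), (2 * M) ^ r * g (M * (x - x₀)) :=
        integral_mono_of_nonneg (ae_of_all _ fun x => by positivity) hi.integrableOn hae
    _ ≤ ∫ x : ℝ, (2 * M) ^ r * g (M * (x - x₀)) :=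
        setIntegral_le_integral hi (ae_of_all _ fun x => by have := hg0 (M * (x - x₀)); positivity)
    _ ≤ _ := by
        rw [hval]
        have : 0 ≤ M ^ (r - 1) := by positivity
        nlinarith

theorem kernelNorm_rpow (hE : IsInner E) (a : Complex.UnitDisc) {r : ℝ≥0∞} (hr₀ : r ≠ 0)
    (hr : r ≠ ∞) : kernelNorm E r a ^ r.toReal = ∫ t, ‖kernel E a t‖ ^ r.toReal ∂σ := by
  have hpos : 0 < r.toReal := ENNReal.toReal_pos hr₀ hr
  have hi : 0 ≤ ∫ t, ‖kernel E a t‖ ^ r.toReal ∂σ := integral_nonneg fun t => by positivity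
  rw [kernelNorm, (hE.memLp_kernel a r).eLpNorm_eq_integral_rpow_norm hr₀ hr,
    ENNReal.toReal_ofReal (by positivity), Real.rpow_inv_rpow hi hpos.ne']

theorem kernelNorm_nonneg (E : ℂ → ℂ) (r : ℝ≥0∞) (a : Complex.UnitDisc) : 0 ≤ kernelNorm E r a :=
  ENNReal.toReal_nonneg

/-- The one-component property is used through the following bounds. -/
theorem exists_kernelNorm_le (hE : IsInner E) (hE₁ : IsOneComponent E) :
    (∃ c : ℝ, 0 < c ∧ ∀ a : Complex.UnitDisc, c ≤ kernelDiag E a) ∧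
    ∀ r : ℝ≥0∞, 1 < r → ∃ K : ℝ, 0 < K ∧ ∀ a : Complex.UnitDisc,
      kernelNorm E r a ≤ K * kernelDiag E a ^ (1 - r.toReal⁻¹) := by
  obtain ⟨c, C, hc, hC, hlow, hbound⟩ := exists_kernel_bound_of_isOneComponent hE hE₁
  have hdiag : ∀ a : Complex.UnitDisc, c ≤ kernelDiag E a := fun a => by
    rw [kernelDiag, le_div_iff₀ (one_sub_norm_sq_pos a)]
    exact hlow a a.norm_lt_one
  refine ⟨⟨c, hc, hdiag⟩, fun r hr => ?_⟩
  have hsup : ∀ a : Complex.UnitDisc, ∀ᵐ t ∂σ, ‖kernel E a t‖ ≤ C * kernelDiag E a := by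
    intro a
    filter_upwards [(hE.hasBoundary_kernel a).tendsto] with t ht
    refine le_of_tendsto ht.norm ?_
    filter_upwards [eventually_nhdsLT_one] with ρ hρ
    have hz := norm_ofReal_mul_ζ_lt_one hρ.1 hρ.2 t
    have := hbound a _ a.norm_lt_one hz
    have hne := norm_pos_iff.2 (one_sub_conj_mul_ne_zero a.norm_lt_one hz.le)
    rw [kernelFun, norm_mul, norm_inv, ← div_eq_mul_inv, div_le_iff₀ hne, kernelDiag,
      mul_div_assoc', div_mul_eq_mul_div, le_div_iff₀ (one_sub_norm_sq_pos a)]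
    exact this
  by_cases hr' : r = ∞
  · subst hr'
    refine ⟨C, hC, fun a => ?_⟩
    have hpos : 0 < C * kernelDiag E a := mul_pos hC (hc.trans_le (hdiag a))
    -- Here `r.toReal` and its inverse are `0`, so the exponent is `1`, as it should be for the sup
    -- norm.
    simp only [ENNReal.toReal_top, inv_zero, sub_zero, Real.rpow_one]
    rw [kernelNorm, eLpNorm_exponent_top]
    refine ENNReal.toReal_le_of_le_ofReal hpos.le ?_
    exact eLpNormEssSup_le_of_ae_bound (hsup a)
  · have hr1 : 1 < r.toReal := by
      rw [← ENNReal.toReal_one]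
      exact (ENNReal.toReal_lt_toReal ENNReal.one_ne_top hr').2 hr
    have hr0 : 0 < r.toReal := by linarith
    obtain ⟨K, hK, hKf⟩ := exists_integral_rpow_le hr1
    refine ⟨(K * C ^ (r.toReal - 1)) ^ r.toReal⁻¹, by positivity, fun a => ?_⟩
    have hN : 0 < kernelDiag E a := hc.trans_le (hdiag a)
    obtain ⟨x₀, hx₀⟩ := exists_eq_norm_mul_ζ (a : ℂ)
    have h1 := hKf (kernel E a) (C * kernelDiag E a) x₀ (mul_pos hC hN) (hsup a) (by
      filter_upwards [hE.ae_norm_bdry_eq_one] with t ht x hxt hx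
      have h2 := two_mul_abs_le_norm_one_sub a.norm_lt_one.le hx₀ hx
      have hne := norm_pos_iff.2 (one_sub_conj_mul_ne_zero a.norm_lt_one (norm_ζ t).le)
      rw [hxt] at h2
      rw [kernel, norm_div, mul_div_assoc', div_le_one hne]
      have h3 : ‖1 - conj (E a) * bdry E t‖ ≤ 2 := by
        refine (norm_sub_le _ _).trans ?_
        rw [norm_one, norm_mul, RCLike.norm_conj, ht, mul_one]
        linarith [hE.norm_le_one a (by simpa using a.norm_lt_one)]
      nlinarith [abs_nonneg (x - x₀)])
    rw [← kernelNorm_rpow hE a (by positivity) hr'] at h1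
    have h4 := Real.rpow_le_rpow (by have := kernelNorm_nonneg E r a; positivity) h1
      (inv_pos.2 hr0).le
    rw [Real.rpow_rpow_inv (kernelNorm_nonneg E r a) hr0.ne', Real.mul_rpow hC.le hN.le,
      ← mul_assoc, Real.mul_rpow (by positivity) (by positivity),
      ← Real.rpow_mul hN.le (r.toReal - 1), sub_mul, mul_inv_cancel₀ hr0.ne', one_mul] at h4
    exact h4

/-- With `N = k_a(a)`, the left side is at most of order `N^{1+1/p}` by the upper bounds at `s'` and
`q`. Duality and the upper bound at `p` give `‖k_a‖_{p'} ≳ N^{1/p}`. The exponent hypothesis is `1/s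
= 1/p + 1/q` rewritten in terms of `s'`. -/
theorem exists_kernelNorm_mul_le (hE : IsInner E) (hE₁ : IsOneComponent E) {p q p' s' : ℝ≥0∞}
    (hp : 1 < p) (hq : 1 < q) (hs' : 1 < s')
    (hpp' : 1 / p + 1 / p' = 1)
    (hexp : (1 - s'.toReal⁻¹) + (1 - q.toReal⁻¹) = 1 + p.toReal⁻¹) :
    ∃ K : ℝ, 0 < K ∧ ∀ a : Complex.UnitDisc,
      kernelNorm E s' a * kernelNorm E q a ≤ K * (kernelNorm E p' a * kernelDiag E a) := by
  obtain ⟨⟨c, hc, hdiag⟩, hU⟩ := exists_kernelNorm_le hE hE₁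
  obtain ⟨K₁, hK₁, h₁⟩ := hU s' hs'
  obtain ⟨K₂, hK₂, h₂⟩ := hU q hq
  obtain ⟨K₃, hK₃, h₃⟩ := hU p hp
  refine ⟨K₁ * K₂ * K₃, by positivity, fun a => ?_⟩
  have hN : 0 < kernelDiag E a := hc.trans_le (hdiag a)
  have h4 := hE.kernelDiag_le_mul hpp' a
  have h5 : kernelDiag E a ^ (1 + p.toReal⁻¹) ≤ K₃ * (kernelNorm E p' a * kernelDiag E a) := by
    have h6 : kernelDiag E a ≤ K₃ * kernelDiag E a ^ (1 - p.toReal⁻¹) * kernelNorm E p' a :=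
      h4.trans (mul_le_mul_of_nonneg_right (h₃ a) (kernelNorm_nonneg _ _ _))
    calc kernelDiag E a ^ (1 + p.toReal⁻¹) = kernelDiag E a * kernelDiag E a ^ p.toReal⁻¹ := by
          rw [Real.rpow_add hN, Real.rpow_one]
      _ ≤ K₃ * kernelDiag E a ^ (1 - p.toReal⁻¹) * kernelNorm E p' a *
          kernelDiag E a ^ p.toReal⁻¹ := by gcongr
      _ = K₃ * kernelNorm E p' a *
          (kernelDiag E a ^ (1 - p.toReal⁻¹) * kernelDiag E a ^ p.toReal⁻¹) := by ring
      _ = _ := by rw [← Real.rpow_add hN, sub_add_cancel, Real.rpow_one]; ring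
  calc kernelNorm E s' a * kernelNorm E q a
      ≤ (K₁ * kernelDiag E a ^ (1 - s'.toReal⁻¹)) * (K₂ * kernelDiag E a ^ (1 - q.toReal⁻¹)) :=
        mul_le_mul (h₁ a) (h₂ a) (kernelNorm_nonneg _ _ _) (by positivity)
    _ = K₁ * K₂ * kernelDiag E a ^ (1 + p.toReal⁻¹) := by
        rw [← hexp, Real.rpow_add hN]; ring
    _ ≤ K₁ * K₂ * (K₃ * (kernelNorm E p' a * kernelDiag E a)) := by gcongr
    _ = _ := by ring


/-! ### Random signs -/

section Signs

variable {ι Ω : Type*} [MeasurableSpace Ω] {P : Measure Ω} [IsProbabilityMeasure P]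
  {ε : ι → Ω → ℝ}

theorem IsBernoulliSigns.ae_eq_or (hε : IsBernoulliSigns P ε) (i : ι) :
    ∀ᵐ ω ∂P, ε i ω = 1 ∨ ε i ω = -1 := by
  have m1 : MeasurableSet {ω | ε i ω = 1} := hε.measurable i (measurableSet_singleton 1)
  have m2 : MeasurableSet {ω | ε i ω = -1} := hε.measurable i (measurableSet_singleton (-1))
  have hd : Disjoint {ω | ε i ω = 1} {ω | ε i ω = -1} := by
    rw [Set.disjoint_left]
    intro ω h1 h2
    rw [Set.mem_ofPred_eq] at h1 h2
    linarith
  have h : P ({ω | ε i ω = 1} ∪ {ω | ε i ω = -1}) = 1 := by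
    rw [measure_union hd m2, hε.prob_one, hε.prob_neg_one, ENNReal.add_halves]
  exact (mem_ae_iff_prob_eq_one (m1.union m2)).2 h

theorem IsBernoulliSigns.ae_abs_le (hε : IsBernoulliSigns P ε) (i : ι) :
    ∀ᵐ ω ∂P, |ε i ω| ≤ 1 := by
  filter_upwards [hε.ae_eq_or i] with ω h
  rcases h with h | h <;> simp [h]

theorem IsBernoulliSigns.integrable (hε : IsBernoulliSigns P ε) (i : ι) :
    Integrable (ε i) P :=
  Integrable.of_bound (hε.measurable i).aestronglyMeasurable 1 (hε.ae_abs_le i)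

theorem IsBernoulliSigns.integral_eq_zero (hε : IsBernoulliSigns P ε) (i : ι) :
    ∫ ω, ε i ω ∂P = 0 := by
  have m1 : MeasurableSet {ω | ε i ω = 1} := hε.measurable i (measurableSet_singleton 1)
  have h : ∀ᵐ ω ∂P, ε i ω = 2 * Set.indicator {ω | ε i ω = 1} 1 ω - 1 := by
    filter_upwards [hε.ae_eq_or i] with ω h
    rcases h with h | h <;> norm_num [Set.indicator_apply, h]
  have hint : Integrable (Set.indicator {ω | ε i ω = 1} (1 : Ω → ℝ)) P :=
    (integrable_const (1 : ℝ)).indicator m1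
  rw [integral_congr_ae h, integral_sub (hint.const_mul 2) (integrable_const 1),
    integral_const_mul, integral_indicator_one m1, measureReal_def, hε.prob_one]
  simp

theorem IsBernoulliSigns.integral_mul (hε : IsBernoulliSigns P ε) [DecidableEq ι] (i j : ι) :
    ∫ ω, ε i ω * ε j ω ∂P = if i = j then 1 else 0 := by
  split_ifs with h
  · subst h
    have h : ∀ᵐ ω ∂P, ε i ω * ε i ω = 1 := by
      filter_upwards [hε.ae_eq_or i] with ω h
      rcases h with h | h <;> simp [h]
    rw [integral_congr_ae h]
    simp
  · rw [(hε.indep.indepFun h).integral_fun_mul_eq_mul_integral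
      (hε.measurable i).aestronglyMeasurable (hε.measurable j).aestronglyMeasurable,
      hε.integral_eq_zero i, zero_mul]

theorem IsBernoulliSigns.integrable_mul (hε : IsBernoulliSigns P ε) (i j : ι) :
    Integrable (fun ω => ε i ω * ε j ω) P :=
  (hε.integrable j).bdd_mul (c := 1) (hε.measurable i).aestronglyMeasurable (hε.ae_abs_le i)

theorem IsBernoulliSigns.integrable_exp (hε : IsBernoulliSigns P ε) (i : ι) (x : ℝ) :
    Integrable (fun ω => Real.exp (ε i ω * x)) P := by
  refine Integrable.of_bound (C := Real.exp |x|)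
    (((hε.measurable i).mul_const x).exp).aestronglyMeasurable ?_
  filter_upwards [hε.ae_abs_le i] with ω h
  rw [Real.norm_eq_abs, Real.abs_exp, Real.exp_le_exp]
  refine (le_abs_self _).trans ?_
  rw [abs_mul]
  exact mul_le_of_le_one_left (abs_nonneg x) h

theorem IsBernoulliSigns.integral_exp (hε : IsBernoulliSigns P ε) (i : ι) (x : ℝ) :
    ∫ ω, Real.exp (ε i ω * x) ∂P = Real.cosh x := by
  have h : ∀ᵐ ω ∂P, Real.exp (ε i ω * x) = Real.cosh x + ε i ω * Real.sinh x := by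
    filter_upwards [hε.ae_eq_or i] with ω h
    rcases h with h | h
    · rw [h, one_mul, one_mul, Real.cosh_add_sinh]
    · rw [h, neg_one_mul, neg_one_mul, ← sub_eq_add_neg, Real.cosh_sub_sinh]
  rw [integral_congr_ae h, integral_add (integrable_const _) ((hε.integrable i).mul_const _),
    integral_mul_const, hε.integral_eq_zero]
  simp

/-- By independence the exponential moment is a product of hyperbolic cosines, and `cosh x ≤
exp(x²/2)`. -/
theorem IsBernoulliSigns.integral_exp_sum_le (hε : IsBernoulliSigns P ε) (F : Finset ι)
    (x : ι → ℝ) :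
    Integrable (fun ω => Real.exp (∑ i ∈ F, ε i ω * x i)) P ∧
    ∫ ω, Real.exp (∑ i ∈ F, ε i ω * x i) ∂P ≤ Real.exp ((∑ i ∈ F, x i ^ 2) / 2) := by
  have hind : iIndepFun (fun i ω => ε i ω * x i) P :=
    hε.indep.comp (fun i y => y * x i) fun i => measurable_id.mul_const _
  have hm : ∀ i, Measurable fun ω => ε i ω * x i := fun i => (hε.measurable i).mul_const _
  have hs : (fun ω => Real.exp (∑ i ∈ F, ε i ω * x i)) =
      fun ω => Real.exp (1 * (∑ i ∈ F, fun ω => ε i ω * x i) ω) := by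
    ext ω; rw [one_mul, Finset.sum_apply]
  constructor
  · rw [hs]
    exact hind.integrable_exp_mul_sum hm fun i _ => by
      simpa only [one_mul] using hε.integrable_exp i (x i)
  · rw [hs]
    change mgf (∑ i ∈ F, fun ω => ε i ω * x i) P 1 ≤ _
    rw [hind.mgf_sum hm F, Finset.sum_div, Real.exp_sum]
    refine Finset.prod_le_prod (fun i _ => mgf_nonneg) fun i _ => ?_
    simp only [mgf, one_mul]
    rw [hε.integral_exp]
    exact Real.cosh_le_exp_half_sq _

theorem exists_rpow_le_exp {r : ℝ} (hr : 0 ≤ r) :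
    ∃ C : ℝ, 0 < C ∧ ∀ x : ℝ, |x| ^ r ≤ C * (Real.exp x + Real.exp (-x)) := by
  obtain ⟨n, hn⟩ := exists_nat_ge r
  have hf : (1 : ℝ) ≤ (n.factorial : ℝ) := by exact_mod_cast n.factorial_pos
  refine ⟨n.factorial, by linarith, fun x => ?_⟩
  have h1 : Real.exp |x| ≤ Real.exp x + Real.exp (-x) := by
    rcases abs_cases x with ⟨h, _⟩ | ⟨h, _⟩ <;> rw [h] <;>
      linarith [Real.exp_pos x, Real.exp_pos (-x)]
  have h2 : |x| ^ r ≤ n.factorial * Real.exp |x| := by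
    rcases le_total 1 |x| with h | h
    · have h3 := Real.pow_div_factorial_le_exp |x| (abs_nonneg x) n
      rw [div_le_iff₀ (by linarith), mul_comm] at h3
      refine le_trans ?_ h3
      rw [← Real.rpow_natCast]
      exact Real.rpow_le_rpow_of_exponent_le h hn
    · exact (Real.rpow_le_one (abs_nonneg x) h hr).trans
        (one_le_mul_of_one_le_of_one_le hf (Real.one_le_exp (abs_nonneg x)))
  exact h2.trans (mul_le_mul_of_nonneg_left h1 (by linarith))

/-- Khinchin's inequality (upper bound) for real coefficients. -/
theorem IsBernoulliSigns.exists_eLpNorm_le_real (hε : IsBernoulliSigns P ε) {r : ℝ≥0∞}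
    (hr₀ : r ≠ 0) (hr : r ≠ ∞) :
    ∃ C : ℝ, 0 < C ∧ ∀ (F : Finset ι) (x : ι → ℝ),
      eLpNorm (fun ω => ∑ i ∈ F, ε i ω * x i) r P ≤
        ENNReal.ofReal (C * √(∑ i ∈ F, x i ^ 2)) := by
  have hr' : 0 < r.toReal := ENNReal.toReal_pos hr₀ hr
  obtain ⟨C, hC, hexp⟩ := exists_rpow_le_exp hr'.le
  set K : ℝ := C * (Real.exp (1 / 2) + Real.exp (1 / 2)) with hK
  have hK0 : 0 < K := by positivity
  refine ⟨K ^ r.toReal⁻¹, by positivity, fun F x => ?_⟩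
  -- By homogeneity it is enough to treat unit coefficient vectors, for which the exponential
  -- moments of the sum and of its negative are at most `e^{1/2}`.
  have hunit : ∀ y : ι → ℝ, ∑ i ∈ F, y i ^ 2 = 1 →
      eLpNorm (fun ω => ∑ i ∈ F, ε i ω * y i) r P ≤ ENNReal.ofReal (K ^ r.toReal⁻¹) := by
    intro y hy
    obtain ⟨i1, b1⟩ := hε.integral_exp_sum_le F y
    obtain ⟨i2, b2⟩ := hε.integral_exp_sum_le F (fun i => -y i)
    simp only [mul_neg, Finset.sum_neg_distrib, neg_sq] at i2 b2
    rw [hy] at b1 b2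
    rw [eLpNorm_eq_lintegral_rpow_enorm_toReal hr₀ hr, one_div,
      ← ENNReal.ofReal_rpow_of_pos hK0]
    refine ENNReal.rpow_le_rpow ?_ (inv_pos.2 hr').le
    calc ∫⁻ ω, ‖∑ i ∈ F, ε i ω * y i‖ₑ ^ r.toReal ∂P
        ≤ ∫⁻ ω, ENNReal.ofReal (C * (Real.exp (∑ i ∈ F, ε i ω * y i) +
            Real.exp (-∑ i ∈ F, ε i ω * y i))) ∂P := by
          refine lintegral_mono fun ω => ?_
          rw [← ofReal_norm, Real.norm_eq_abs,
            ENNReal.ofReal_rpow_of_nonneg (abs_nonneg _) hr'.le]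
          exact ENNReal.ofReal_le_ofReal (hexp _)
      _ = ENNReal.ofReal (∫ ω, C * (Real.exp (∑ i ∈ F, ε i ω * y i) +
            Real.exp (-∑ i ∈ F, ε i ω * y i)) ∂P) :=
          (ofReal_integral_eq_lintegral_ofReal ((i1.add i2).const_mul C)
            (ae_of_all _ fun ω => mul_nonneg hC.le
            (add_nonneg (Real.exp_pos _).le (Real.exp_pos _).le))).symm
      _ ≤ ENNReal.ofReal K := by
          refine ENNReal.ofReal_le_ofReal ?_
          rw [integral_const_mul, integral_add i1 i2]
          exact mul_le_mul_of_nonneg_left (add_le_add b1 b2) hC.le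
  rcases (Finset.sum_nonneg fun i (_ : i ∈ F) => sq_nonneg (x i)).eq_or_lt with h0 | h0
  · have hx : ∀ i ∈ F, x i = 0 := fun i hi =>
      pow_eq_zero_iff two_ne_zero |>.1
        ((Finset.sum_eq_zero_iff_of_nonneg fun i _ => sq_nonneg (x i)).1 h0.symm i hi)
    have : (fun ω => ∑ i ∈ F, ε i ω * x i) = 0 := by
      ext ω
      exact Finset.sum_eq_zero fun i hi => by rw [hx i hi, mul_zero]
    rw [this, eLpNorm_zero]
    exact zero_le
  · set N := √(∑ i ∈ F, x i ^ 2) with hN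
    have hN0 : 0 < N := Real.sqrt_pos.2 h0
    have h1 := hunit (fun i => x i / N) (by
      simp only [div_pow]
      rw [← Finset.sum_div, hN, Real.sq_sqrt h0.le, div_self h0.ne'])
    have h2 : (fun ω => ∑ i ∈ F, ε i ω * x i) = N • fun ω => ∑ i ∈ F, ε i ω * (x i / N) := by
      ext ω
      rw [Pi.smul_apply, smul_eq_mul, Finset.mul_sum]
      exact Finset.sum_congr rfl fun i _ => by field_simp
    rw [h2, eLpNorm_const_smul, mul_comm, ENNReal.ofReal_mul (by positivity),
      ← ofReal_norm, Real.norm_of_nonneg hN0.le]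
    gcongr

/-- Khinchin's inequality (upper bound) for complex coefficients. -/
theorem IsBernoulliSigns.exists_eLpNorm_le (hε : IsBernoulliSigns P ε) {r : ℝ≥0∞}
    (hr₁ : 1 ≤ r) (hr : r ≠ ∞) :
    ∃ C : ℝ, 0 < C ∧ ∀ (F : Finset ι) (z : ι → ℂ),
      eLpNorm (fun ω => ∑ i ∈ F, (ε i ω : ℂ) * z i) r P ≤
        ENNReal.ofReal (C * √(∑ i ∈ F, ‖z i‖ ^ 2)) := by
  obtain ⟨C, hC, h⟩ := hε.exists_eLpNorm_le_real (one_pos.trans_le hr₁).ne' hr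
  refine ⟨C + C, by positivity, fun F z => ?_⟩
  have hmeas : ∀ x : ι → ℝ, Measurable fun ω => ∑ i ∈ F, ε i ω * x i := fun x =>
    Finset.measurable_fun_sum F fun i _ => (hε.measurable i).mul_const _
  have hN : ∀ x : ι → ℝ, (∀ i, |x i| ≤ ‖z i‖) →
      eLpNorm (fun ω => ∑ i ∈ F, ε i ω * x i) r P ≤
        ENNReal.ofReal (C * √(∑ i ∈ F, ‖z i‖ ^ 2)) := fun x hx =>
    (h F x).trans (by
      refine ENNReal.ofReal_le_ofReal (mul_le_mul_of_nonneg_left (Real.sqrt_le_sqrt ?_) hC.le)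
      refine Finset.sum_le_sum fun i _ => ?_
      rw [← sq_abs]
      exact pow_le_pow_left₀ (abs_nonneg _) (hx i) 2)
  -- Real and imaginary parts are estimated separately, which accounts for the constant `C + C`.
  have heq : (fun ω => ∑ i ∈ F, (ε i ω : ℂ) * z i) =
      (fun ω => ((∑ i ∈ F, ε i ω * (z i).re : ℝ) : ℂ)) +
        Complex.I • fun ω => ((∑ i ∈ F, ε i ω * (z i).im : ℝ) : ℂ) := by
    ext ω
    simp only [Pi.add_apply, Pi.smul_apply, smul_eq_mul]
    push_cast
    rw [Finset.mul_sum, ← Finset.sum_add_distrib]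
    refine Finset.sum_congr rfl fun i _ => ?_
    conv_lhs => rw [← Complex.re_add_im (z i)]
    ring
  have hcoe : ∀ f : Ω → ℝ, eLpNorm (fun ω => (f ω : ℂ)) r P = eLpNorm f r P := fun f =>
    eLpNorm_congr_norm_ae (ae_of_all _ fun ω => by simp)
  rw [heq, add_mul, ENNReal.ofReal_add (by positivity) (by positivity)]
  refine (eLpNorm_add_le ?_ ?_ hr₁).trans (add_le_add ?_ ?_)
  · exact (Complex.measurable_ofReal.comp (hmeas _)).aestronglyMeasurable
  · exact ((Complex.measurable_ofReal.comp (hmeas _)).aestronglyMeasurable).const_smul _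
  · rw [hcoe]
    exact hN _ fun i => Complex.abs_re_le_norm _
  · rw [eLpNorm_const_smul, enorm_eq_nnnorm, Complex.nnnorm_I, ENNReal.coe_one, one_mul, hcoe]
    exact hN _ fun i => Complex.abs_im_le_norm _

end Signs


/-! ### Randomised factorisation -/

section Exponents

variable {p s q : ℝ≥0∞}

theorem one_lt_exponent (hs : 1 ≤ s) (hp : p ≠ ∞) (hq : 1 / s = 1 / p + 1 / q) : 1 < q := by
  have h1 : 1 / q < 1 := by
    have h2 : 1 / p ≠ 0 := by simpa using hp
    have h3 : 1 / q ≠ ∞ := by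
      intro h
      rw [h, add_top, one_div, ENNReal.inv_eq_top] at hq
      simp [hq] at hs
    have h4 : 1 / s ≤ 1 := by
      rw [one_div]; exact ENNReal.inv_le_one.2 hs
    refine lt_of_lt_of_le ?_ (hq ▸ h4)
    rw [add_comm]
    exact ENNReal.lt_add_right h3 h2
  rwa [one_div, ENNReal.inv_lt_one] at h1

theorem exponent_ne_top (hsp : s < p) (hq : 1 / s = 1 / p + 1 / q) : q ≠ ∞ := by
  rintro rfl
  simp only [one_div, ENNReal.inv_top, add_zero, inv_inj] at hq
  exact hsp.ne hq

theorem inv_toReal_add_inv_toReal {u v w : ℝ≥0∞} (hu : u ≠ 0) (hv : v ≠ 0)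
    (h : 1 / w = 1 / u + 1 / v) : w.toReal⁻¹ = u.toReal⁻¹ + v.toReal⁻¹ := by
  have h1 := congrArg ENNReal.toReal h
  rw [one_div, one_div, one_div, ENNReal.toReal_add (ENNReal.inv_ne_top.2 hu)
    (ENNReal.inv_ne_top.2 hv)] at h1
  simpa only [ENNReal.toReal_inv] using h1

end Exponents

section Random

theorem IsBernoulliSigns.measurable_sum_mul {ι Ω α : Type*} [MeasurableSpace Ω]
    [MeasurableSpace α] {P : Measure Ω} {m : Measure α} {ε : ι → Ω → ℝ}
    (hε : IsBernoulliSigns P ε) {p : ℝ≥0∞} {r : ℝ} (F : Finset ι) (l : ι → ℂ)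
    (y : ι → Lp ℂ p m) :
    Measurable fun x : α × Ω => ‖∑ a ∈ F, (ε a x.2 : ℂ) * (l a * y a x.1)‖ₑ ^ r := by
  refine (Measurable.enorm ?_).pow_const _
  refine Finset.measurable_fun_sum F fun a _ => ?_
  exact (Complex.measurable_ofReal.comp ((hε.measurable a).comp measurable_snd)).mul
    (measurable_const.mul ((Lp.stronglyMeasurable (y a)).measurable.comp measurable_fst))

variable {ι Ω : Type*} [MeasurableSpace Ω] {P : Measure Ω} [IsProbabilityMeasure P]
  {ε : ι → Ω → ℝ}

theorem IsBernoulliSigns.memLp_sum (hε : IsBernoulliSigns P ε) (r : ℝ≥0∞) (F : Finset ι)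
    {X : Type*} [NormedAddCommGroup X] [NormedSpace ℂ X] (y : ι → X) :
    MemLp (fun ω => ∑ a ∈ F, (ε a ω : ℂ) • y a) r P := by
  refine memLp_finsetSum F fun a _ => MemLp.of_bound (C := ‖y a‖) ?_ ?_
  · exact ((Complex.measurable_ofReal.comp (hε.measurable a)).stronglyMeasurable.smul_const
      (y a)).aestronglyMeasurable
  · filter_upwards [hε.ae_abs_le a] with ω h
    rw [norm_smul, Complex.norm_real, Real.norm_eq_abs]
    exact mul_le_of_le_one_left (norm_nonneg _) h

/-- The signs are orthonormal, so only diagonal terms survive. The identity is bilinear, without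
conjugates, as products of analytic functions require. -/
theorem IsBernoulliSigns.integral_sum_mul_sum (hε : IsBernoulliSigns P ε) (F : Finset ι)
    (z w : ι → ℂ) :
    ∫ ω, (∑ a ∈ F, (ε a ω : ℂ) * z a) * ∑ b ∈ F, (ε b ω : ℂ) * w b ∂P =
      ∑ a ∈ F, z a * w a := by
  classical
  have h1 : ∀ ω, (∑ a ∈ F, (ε a ω : ℂ) * z a) * ∑ b ∈ F, (ε b ω : ℂ) * w b =
      ∑ a ∈ F, ∑ b ∈ F, ((ε a ω * ε b ω : ℝ) : ℂ) * (z a * w b) := fun ω => by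
    rw [Finset.sum_mul_sum]
    refine Finset.sum_congr rfl fun a _ => Finset.sum_congr rfl fun b _ => ?_
    push_cast
    ring
  have hi : ∀ a b, Integrable (fun ω => ((ε a ω * ε b ω : ℝ) : ℂ) * (z a * w b)) P :=
    fun a b => (hε.integrable_mul a b).ofReal.mul_const _
  simp_rw [h1]
  rw [integral_finsetSum _ fun a _ => integrable_finsetSum _ fun b _ => hi a b]
  refine Finset.sum_congr rfl fun a ha => ?_
  rw [integral_finsetSum _ fun b _ => hi a b]
  simp_rw [integral_mul_const, integral_complex_ofReal, hε.integral_mul]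
  rw [Finset.sum_eq_single a]
  · simp
  · intro b _ hb
    simp [hb.symm]
  · exact fun h => (h ha).elim

/-- A sum of products is the average of a product of two random sums, and Hölder over the signs
separates the factors. -/
theorem IsBernoulliSigns.enorm_sum_mul_le (hε : IsBernoulliSigns P ε) {p p' : ℝ≥0∞}
    (h : 1 / p + 1 / p' = 1) (F : Finset ι) (z w : ι → ℂ) :
    ‖∑ a ∈ F, z a * w a‖ₑ ≤ eLpNorm (fun ω => ∑ a ∈ F, (ε a ω : ℂ) * z a) p P *
      eLpNorm (fun ω => ∑ a ∈ F, (ε a ω : ℂ) * w a) p' P := by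
  have : ENNReal.HolderTriple p p' 1 := ⟨by simpa only [one_div, inv_one] using h⟩
  rw [← hε.integral_sum_mul_sum F z w]
  refine (enorm_integral_le_lintegral_enorm _).trans ?_
  rw [← eLpNorm_one_eq_lintegral_enorm]
  have h1 := eLpNorm_le_eLpNorm_mul_eLpNorm_of_nnnorm (p := p) (q := p') (r := 1)
    (hε.memLp_sum p F z).1 (hε.memLp_sum p' F w).1 (fun x y => x * y) 1
    (ae_of_all _ fun ω => by rw [nnnorm_mul, one_mul])
  simpa only [smul_eq_mul, ENNReal.coe_one, one_mul] using h1

/-- The bound is applied to the truncation of `l` to `F`, so `l` itself need not lie in `ℓ^p`. -/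
theorem RandomSignBound.exists_lintegral_le (hε : IsBernoulliSigns P ε) {p : ℝ≥0∞}
    [Fact (1 ≤ p)] (hp : p ≠ ∞)
    {X : Type*} [NormedAddCommGroup X] [NormedSpace ℂ X] {y : ι → X}
    (h : RandomSignBound P ε p y) :
    ∃ C : ℝ, 0 < C ∧ ∀ (F : Finset ι) (l : ι → ℂ),
      ∫⁻ ω, ‖∑ a ∈ F, (ε a ω : ℂ) • l a • y a‖ₑ ^ p.toReal ∂P ≤
        ENNReal.ofReal (C * ∑ a ∈ F, ‖l a‖ ^ p.toReal) := by
  classical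
  obtain ⟨C, hC, h⟩ := h
  have hp₀ : p ≠ 0 := (one_pos.trans_le Fact.out).ne'
  have hp' : 0 < p.toReal := ENNReal.toReal_pos hp₀ hp
  refine ⟨C, hC, fun F l => ?_⟩
  have h1 := h (∑ a ∈ F, lp.single p a (l a)) F
  rw [lp.norm_sum_single hp'] at h1
  have h2 : ∀ a ∈ F, (∑ b ∈ F, lp.single p b (l b) : lp (fun _ : ι => ℂ) p) a = l a := by
    intro a ha
    rw [lp.coeFn_sum, Finset.sum_apply, Finset.sum_eq_single a]
    · simp
    · intro b _ hb
      simp [lp.single_apply, hb.symm]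
    · exact fun h => (h ha).elim
  have h3 : ∀ ω, ∑ a ∈ F, ((∑ b ∈ F, lp.single p b (l b) : lp (fun _ : ι => ℂ) p) a *
      (ε a ω : ℂ)) • y a = ∑ a ∈ F, (ε a ω : ℂ) • l a • y a := fun ω =>
    Finset.sum_congr rfl fun a ha => by rw [h2 a ha, smul_smul, mul_comm]
  simp_rw [h3] at h1
  refine le_trans (le_of_eq ?_) (ENNReal.ofReal_le_ofReal h1)
  rw [ofReal_integral_eq_lintegral_ofReal
    ((hε.memLp_sum p F fun a => l a • y a).integrable_norm_rpow hp₀ hp)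
    (ae_of_all _ fun ω => Real.rpow_nonneg (norm_nonneg _) _)]
  refine lintegral_congr fun ω => ?_
  rw [← ENNReal.ofReal_rpow_of_nonneg (norm_nonneg _) hp'.le, ofReal_norm]

variable {α : Type*} [MeasurableSpace α] {m : Measure α} [SFinite m]

/-- Tonelli exchanges expectation and space, so that the bound concerns the pointwise `p`-th moments
of the random sum. -/
theorem RandomSignBound.exists_lintegral_lintegral_le (hε : IsBernoulliSigns P ε) {p : ℝ≥0∞}
    [Fact (1 ≤ p)] (hp : p ≠ ∞) {y : ι → Lp ℂ p m} (h : RandomSignBound P ε p y) :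
    ∃ C : ℝ, 0 < C ∧ ∀ (F : Finset ι) (l : ι → ℂ),
      ∫⁻ t, ∫⁻ ω, ‖∑ a ∈ F, (ε a ω : ℂ) * (l a * y a t)‖ₑ ^ p.toReal ∂P ∂m ≤
        ENNReal.ofReal (C * ∑ a ∈ F, ‖l a‖ ^ p.toReal) := by
  obtain ⟨C, hC, h⟩ := h.exists_lintegral_le hε hp
  have hp₀ : p ≠ 0 := (one_pos.trans_le Fact.out).ne'
  have hp' : 0 < p.toReal := ENNReal.toReal_pos hp₀ hp
  refine ⟨C, hC, fun F l => ?_⟩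
  rw [lintegral_lintegral_swap]
  · refine le_trans (lintegral_mono fun ω => le_of_eq ?_) (h F l)
    have h1 : ∀ᵐ t ∂m, (∑ a ∈ F, (ε a ω : ℂ) • l a • y a : Lp ℂ p m) t =
        ∑ a ∈ F, (ε a ω : ℂ) * (l a * y a t) := by
      have h2 : ∀ᵐ t ∂m, ∀ a ∈ F, ((ε a ω : ℂ) • l a • y a : Lp ℂ p m) t =
          (ε a ω : ℂ) * (l a * y a t) := by
        refine (Filter.eventually_all_finset F).2 fun a _ => ?_
        filter_upwards [Lp.coeFn_smul (ε a ω : ℂ) (l a • y a), Lp.coeFn_smul (l a) (y a)]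
          with t h3 h4
        rw [h3, Pi.smul_apply, h4, Pi.smul_apply, smul_eq_mul, smul_eq_mul]
      filter_upwards [Lp.coeFn_finsetSum F fun a => ((ε a ω : ℂ) • l a • y a : Lp ℂ p m), h2]
        with t h3 h4
      rw [h3, Finset.sum_apply]
      exact Finset.sum_congr rfl h4
    rw [Lp.enorm_def, eLpNorm_congr_ae h1, eLpNorm_eq_lintegral_rpow_enorm_toReal hp₀ hp,
      ← ENNReal.rpow_mul, one_div, inv_mul_cancel₀ hp'.ne', ENNReal.rpow_one]
  · exact (hε.measurable_sum_mul F l y).aemeasurable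

/-- Averaging over signs a factorisation `ν = λ μ` with `|λ|^p = |μ|^q = |ν|^s` bounds
`∑ ν_a y_a k_a` in `L^s` by the random sign bound for `y` in `L^p` and the square function of
`k` in `L^q`. -/
theorem RandomSignBound.exists_eLpNorm_sum_mul_le (hε : IsBernoulliSigns P ε)
    {p s q p' : ℝ≥0∞} [Fact (1 ≤ p)] (hs : 1 ≤ s) (hsp : s < p) (hp : p ≠ ∞)
    (hq : 1 / s = 1 / p + 1 / q) (hp' : 1 / p + 1 / p' = 1)
    {y : ι → Lp ℂ p m} (h : RandomSignBound P ε p y) {k : ι → α → ℂ}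
    (hkm : ∀ a, AEStronglyMeasurable (k a) m)
    (hk : ∃ D : ℝ, 0 < D ∧ ∀ (F : Finset ι) (u : ι → ℂ),
      eLpNorm (fun t => √(∑ a ∈ F, ‖u a * k a t‖ ^ 2)) q m ≤
        ENNReal.ofReal (D * (∑ a ∈ F, ‖u a‖ ^ q.toReal) ^ q.toReal⁻¹)) :
    ∃ C : ℝ, 0 < C ∧ ∀ (F : Finset ι) (v : ι → ℂ),
      eLpNorm (fun t => ∑ a ∈ F, v a * (y a t * k a t)) s m ≤
        ENNReal.ofReal (C * (∑ a ∈ F, ‖v a‖ ^ s.toReal) ^ s.toReal⁻¹) := by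
  have hp₀ : p ≠ 0 := (one_pos.trans_le Fact.out).ne'
  have hs₀ : s ≠ 0 := (one_pos.trans_le hs).ne'
  have hst : s ≠ ∞ := hsp.ne_top
  have hq1 := one_lt_exponent hs hp hq
  have hq₀ : q ≠ 0 := (one_pos.trans hq1).ne'
  have hqt := exponent_ne_top hsp hq
  have hp'1 : 1 ≤ p' := by
    have h1 : 1 / p' ≤ 1 := calc
      1 / p' ≤ 1 / p + 1 / p' := le_add_self
      _ = 1 := hp'
    rwa [one_div, ENNReal.inv_le_one] at h1
  have hp't : p' ≠ ∞ := exponent_ne_top (hs.trans_lt hsp) (by rw [hp', one_div_one])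
  have hsr : 0 < s.toReal := ENNReal.toReal_pos hs₀ hst
  have hpr : 0 < p.toReal := ENNReal.toReal_pos hp₀ hp
  have hqr : 0 < q.toReal := ENNReal.toReal_pos hq₀ hqt
  have hinv := inv_toReal_add_inv_toReal hp₀ hq₀ hq
  have hspr : s.toReal < p.toReal := (ENNReal.toReal_lt_toReal hst hp).2 hsp
  obtain ⟨C, hC, hA⟩ := h.exists_lintegral_lintegral_le hε hp
  obtain ⟨D, hD, hG⟩ := hk
  obtain ⟨K, hK, hkh⟩ := hε.exists_eLpNorm_le hp'1 hp't
  refine ⟨C ^ p.toReal⁻¹ * (K * D), by positivity, fun F v => ?_⟩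
  set μ : ι → ℂ := fun a => ((‖v a‖ ^ (s.toReal / q.toReal) : ℝ) : ℂ) with hμ
  -- Where `v a = 0` this is `0 / 0 = 0`, so `l μ = v` holds there as well.
  set l : ι → ℂ := fun a => v a / μ a with hl
  have hlμ : ∀ a, l a * μ a = v a := fun a => by
    by_cases h0 : v a = 0
    · simp [hl, h0]
    · refine div_mul_cancel₀ _ ?_
      rw [hμ, Complex.ofReal_ne_zero]
      exact (Real.rpow_pos_of_pos (norm_pos_iff.2 h0) _).ne'
  have hnμ : ∀ a, ‖μ a‖ = ‖v a‖ ^ (s.toReal / q.toReal) := fun a => by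
    rw [hμ, Complex.norm_real, Real.norm_of_nonneg (by positivity)]
  have hμq : ∀ a, ‖μ a‖ ^ q.toReal = ‖v a‖ ^ s.toReal := fun a => by
    rw [hnμ, ← Real.rpow_mul (norm_nonneg _), div_mul_cancel₀ _ hqr.ne']
  have hlp : ∀ a, ‖l a‖ ^ p.toReal = ‖v a‖ ^ s.toReal := fun a => by
    by_cases h0 : v a = 0
    · simp [hl, h0, Real.zero_rpow hsr.ne', Real.zero_rpow hpr.ne']
    · have hv := norm_pos_iff.2 h0
      have h1 : 1 - s.toReal / q.toReal = s.toReal * p.toReal⁻¹ := by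
        have h2 : s.toReal * p.toReal⁻¹ + s.toReal * q.toReal⁻¹ = 1 := by
          rw [← mul_add, ← hinv, mul_inv_cancel₀ hsr.ne']
        rw [div_eq_mul_inv]
        linarith
      have h3 : ‖l a‖ = ‖v a‖ ^ (1 - s.toReal / q.toReal) := by
        rw [hl, norm_div, hnμ, Real.rpow_sub hv, Real.rpow_one]
      rw [h3, ← Real.rpow_mul hv.le, h1, mul_assoc, inv_mul_cancel₀ hpr.ne', mul_one]
  set A : α → ℝ≥0∞ := fun t =>
    (∫⁻ ω, ‖∑ a ∈ F, (ε a ω : ℂ) * (l a * y a t)‖ₑ ^ p.toReal ∂P) ^ (1 / p.toReal) with hAdef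
  set G : α → ℝ := fun t => K * √(∑ a ∈ F, ‖μ a * k a t‖ ^ 2) with hGdef
  -- Randomised factorisation at a fixed point `t`: the first factor is the `p`-th moment kept for
  -- the hypothesis on `y`, the second is replaced by the square function through Khinchin in
  -- `L^{p'}`. Hölder on `α` follows below.
  have hpt : ∀ t, ‖∑ a ∈ F, v a * (y a t * k a t)‖ₑ ≤ A t * ‖G t‖ₑ := fun t => by
    have h1 : ∑ a ∈ F, v a * (y a t * k a t) = ∑ a ∈ F, (l a * y a t) * (μ a * k a t) :=
      Finset.sum_congr rfl fun a _ => by rw [← hlμ a]; ring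
    rw [h1]
    refine (hε.enorm_sum_mul_le hp' F _ _).trans (mul_le_mul' (le_of_eq ?_) ?_)
    · rw [eLpNorm_eq_lintegral_rpow_enorm_toReal hp₀ hp]
    · refine (hkh F _).trans (le_of_eq ?_)
      rw [← ofReal_norm, Real.norm_of_nonneg (by positivity)]
  have hAm : AEMeasurable A m :=
    ((hε.measurable_sum_mul F l y).lintegral_prod_right'.pow_const _).aemeasurable
  have hGm : AEStronglyMeasurable G m := by
    refine (continuous_const.mul Real.continuous_sqrt).comp_aestronglyMeasurable
      (Finset.aestronglyMeasurable_fun_sum F fun a _ => ?_)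
    exact ((hkm a).const_mul (μ a)).norm.pow 2
  calc eLpNorm (fun t => ∑ a ∈ F, v a * (y a t * k a t)) s m
      = (∫⁻ t, ‖∑ a ∈ F, v a * (y a t * k a t)‖ₑ ^ s.toReal ∂m) ^ (1 / s.toReal) :=
        eLpNorm_eq_lintegral_rpow_enorm_toReal hs₀ hst
    _ ≤ (∫⁻ t, (A * fun t => ‖G t‖ₑ) t ^ s.toReal ∂m) ^ (1 / s.toReal) := by
        refine ENNReal.rpow_le_rpow (lintegral_mono fun t => ?_) (by positivity)
        exact ENNReal.rpow_le_rpow (hpt t) hsr.le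
    _ ≤ (∫⁻ t, A t ^ p.toReal ∂m) ^ (1 / p.toReal) *
          (∫⁻ t, ‖G t‖ₑ ^ q.toReal ∂m) ^ (1 / q.toReal) :=
        ENNReal.lintegral_Lp_mul_le_Lq_mul_Lr hsr hspr
          (by simpa only [one_div] using hinv) m hAm hGm.enorm
    _ ≤ ENNReal.ofReal ((C * ∑ a ∈ F, ‖v a‖ ^ s.toReal) ^ (1 / p.toReal)) *
          ENNReal.ofReal (K * (D * (∑ a ∈ F, ‖v a‖ ^ s.toReal) ^ q.toReal⁻¹)) := by
        refine mul_le_mul' ?_ ?_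
        · rw [← ENNReal.ofReal_rpow_of_nonneg (by positivity) (by positivity)]
          refine ENNReal.rpow_le_rpow ?_ (by positivity)
          have h1 := hA F l
          simp_rw [hlp] at h1
          refine le_trans (lintegral_mono fun t => le_of_eq ?_) h1
          rw [hAdef, ← ENNReal.rpow_mul, one_div, inv_mul_cancel₀ hpr.ne', ENNReal.rpow_one]
        · rw [← eLpNorm_eq_lintegral_rpow_enorm_toReal hq₀ hqt]
          have h1 := hG F μ
          simp_rw [hμq] at h1
          have h2 : G = K • fun t => √(∑ a ∈ F, ‖μ a * k a t‖ ^ 2) := rfl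
          rw [h2, eLpNorm_const_smul, ENNReal.ofReal_mul hK.le, ← ofReal_norm,
            Real.norm_of_nonneg hK.le]
          gcongr
    _ = _ := by
        have hS : 0 ≤ ∑ a ∈ F, ‖v a‖ ^ s.toReal := by positivity
        rw [← ENNReal.ofReal_mul (by positivity), one_div, Real.mul_rpow hC.le hS, hinv,
          Real.rpow_add_of_nonneg hS (by positivity) (by positivity)]
        congr 1
        ring

end Random


/-! ### Square functions -/

theorem enorm_sqrt_sum {ι : Type*} (F : Finset ι) (z : ι → ℂ) :
    ‖√(∑ a ∈ F, ‖z a‖ ^ 2)‖ₑ ^ 2 = ∑ a ∈ F, ‖z a‖ₑ ^ 2 := by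
  have h : 0 ≤ ∑ a ∈ F, ‖z a‖ ^ 2 := by positivity
  rw [← ofReal_norm, Real.norm_of_nonneg (Real.sqrt_nonneg _), ← ENNReal.ofReal_pow
    (Real.sqrt_nonneg _), Real.sq_sqrt h, ENNReal.ofReal_sum_of_nonneg fun a _ => by positivity]
  exact Finset.sum_congr rfl fun a _ => by rw [ENNReal.ofReal_pow (norm_nonneg _), ofReal_norm]

/-- This is `ℓ^r ⊂ ℓ²`: raising to the power `r/2 ≤ 1` is subadditive. -/
theorem enorm_sqrt_sum_rpow_le {ι : Type*} (F : Finset ι) (z : ι → ℂ) {r : ℝ} (hr₀ : 0 < r)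
    (hr : r ≤ 2) : ‖√(∑ a ∈ F, ‖z a‖ ^ 2)‖ₑ ^ r ≤ ∑ a ∈ F, ‖z a‖ₑ ^ r := by
  have h : ∀ u : ℝ≥0∞, u ^ r = (u ^ 2) ^ (r / 2) := fun u => by
    rw [← ENNReal.rpow_natCast, ← ENNReal.rpow_mul]
    congr 1
    push_cast
    ring
  rw [h, enorm_sqrt_sum]
  simp_rw [h]
  refine Finset.le_sum_of_subadditive (fun u : ℝ≥0∞ => u ^ (r / 2)) ?_ (fun x y => ?_) F _
  · simp [ENNReal.zero_rpow_of_pos (half_pos hr₀)]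
  · exact ENNReal.rpow_add_le_add_rpow x y (by linarith) (by linarith)

/-- For exponents at most two, the square function of a bounded family satisfies an upper
estimate without further assumptions. -/
theorem eLpNorm_sqrt_sum_le {ι α : Type*} [MeasurableSpace α] {m : Measure α} {q : ℝ≥0∞}
    (hq₀ : q ≠ 0) (hq : q ≤ 2) {k : ι → α → ℂ} (hkm : ∀ a, AEStronglyMeasurable (k a) m) {B : ℝ}
    (hB : 0 ≤ B) (hk : ∀ a, eLpNorm (k a) q m ≤ ENNReal.ofReal B) (F : Finset ι) (u : ι → ℂ) :
    eLpNorm (fun t => √(∑ a ∈ F, ‖u a * k a t‖ ^ 2)) q m ≤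
      ENNReal.ofReal (B * (∑ a ∈ F, ‖u a‖ ^ q.toReal) ^ q.toReal⁻¹) := by
  have hqt : q ≠ ∞ := (hq.trans_lt ENNReal.ofNat_lt_top).ne
  have hqr : 0 < q.toReal := ENNReal.toReal_pos hq₀ hqt
  have hq2 : q.toReal ≤ 2 := by simpa using ENNReal.toReal_mono ENNReal.ofNat_ne_top hq
  have hterm : ∀ a, ∫⁻ t, ‖u a * k a t‖ₑ ^ q.toReal ∂m ≤
      ENNReal.ofReal (B ^ q.toReal * ‖u a‖ ^ q.toReal) := fun a => by
    have h1 := ENNReal.rpow_le_rpow (eLpNorm_const_smul (u a) (k a) q m).le hqr.le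
    rw [eLpNorm_eq_lintegral_rpow_enorm_toReal hq₀ hqt, ← ENNReal.rpow_mul, one_div,
      inv_mul_cancel₀ hqr.ne', ENNReal.rpow_one] at h1
    refine h1.trans ?_
    rw [ENNReal.mul_rpow_of_nonneg _ _ hqr.le, mul_comm, ENNReal.ofReal_mul (by positivity),
      ← ENNReal.ofReal_rpow_of_nonneg hB hqr.le,
      ← ENNReal.ofReal_rpow_of_nonneg (norm_nonneg _) hqr.le, ofReal_norm]
    gcongr
    exact hk a
  have hS : 0 ≤ ∑ a ∈ F, ‖u a‖ ^ q.toReal := by positivity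
  have h2 : ENNReal.ofReal (B * (∑ a ∈ F, ‖u a‖ ^ q.toReal) ^ q.toReal⁻¹) =
      (∑ a ∈ F, ENNReal.ofReal (B ^ q.toReal * ‖u a‖ ^ q.toReal)) ^ (1 / q.toReal) := by
    rw [← ENNReal.ofReal_sum_of_nonneg fun a _ => by positivity, ← Finset.mul_sum,
      ENNReal.ofReal_rpow_of_nonneg (by positivity) (by positivity), one_div,
      Real.mul_rpow (by positivity) hS, Real.rpow_rpow_inv hB hqr.ne']
  rw [h2, eLpNorm_eq_lintegral_rpow_enorm_toReal hq₀ hqt]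
  refine ENNReal.rpow_le_rpow ?_ (by positivity)
  calc ∫⁻ t, ‖√(∑ a ∈ F, ‖u a * k a t‖ ^ 2)‖ₑ ^ q.toReal ∂m
      ≤ ∫⁻ t, ∑ a ∈ F, ‖u a * k a t‖ₑ ^ q.toReal ∂m :=
        lintegral_mono fun t => enorm_sqrt_sum_rpow_le F _ hqr hq2
    _ = ∑ a ∈ F, ∫⁻ t, ‖u a * k a t‖ₑ ^ q.toReal ∂m :=
        lintegral_finsetSum' _ fun a _ => (((hkm a).const_mul (u a)).enorm.pow_const _)
    _ ≤ _ := Finset.sum_le_sum fun a _ => hterm a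

/-- The hypothesis on `c` dominates `c_a k_a` by `B` times the normalised kernel. The Carleson
condition is tested on truncated sequences, and the `L^{q/2}` norm of a square is the square of the
`L^q` norm. -/
theorem WeaklyCarleson.exists_eLpNorm_sqrt_sum_le {q : ℝ≥0∞} (hq : 1 < q) (hqt : q ≠ ∞)
    {E : ℂ → ℂ} {S : Set Complex.UnitDisc} (h : WeaklyCarleson q E S) {c : S → ℝ} {B : ℝ}
    (hB : 0 < B) (hpos : ∀ a : S, 0 < kernelNorm E q a)
    (hc : ∀ a : S, |c a| * kernelNorm E q a ≤ B) :
    ∃ D : ℝ, 0 < D ∧ ∀ (F : Finset S) (u : S → ℂ),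
      eLpNorm (fun t => √(∑ a ∈ F, ‖u a * ((c a : ℂ) * kernel E a t)‖ ^ 2)) q σ ≤
        ENNReal.ofReal (D * (∑ a ∈ F, ‖u a‖ ^ q.toReal) ^ q.toReal⁻¹) := by
  classical
  have : Fact (1 ≤ q) := ⟨hq.le⟩
  have hqr : 0 < q.toReal := ENNReal.toReal_pos (one_pos.trans hq).ne' hqt
  obtain ⟨D, hD, h⟩ := h
  refine ⟨B * √D, by positivity, fun F u => ?_⟩
  set l : lp (fun _ : S => ℂ) q := ∑ a ∈ F, lp.single q a (u a) with hl
  have hla : ∀ a ∈ F, l a = u a := by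
    intro a ha
    rw [hl, lp.coeFn_sum, Finset.sum_apply, Finset.sum_eq_single a]
    · simp
    · intro b _ hb
      simp [lp.single_apply, hb.symm]
    · exact fun h => (h ha).elim
  have hln : ‖l‖ = (∑ a ∈ F, ‖u a‖ ^ q.toReal) ^ q.toReal⁻¹ := by
    rw [← lp.norm_sum_single hqr, Real.rpow_rpow_inv (norm_nonneg _) hqr.ne']
  set g : UnitAddCircle → ℝ := fun t => √(∑ a ∈ F, ‖u a * ((c a : ℂ) * kernel E a t)‖ ^ 2)
    with hg
  have hpt : ∀ t, ‖‖g t‖ₑ ^ (2 : ℝ)‖ₑ ≤ ((Real.toNNReal (B ^ 2) : ℝ≥0) : ℝ≥0∞) *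
      ‖∑' a : S, ‖l a‖ₑ ^ 2 * ‖normalizedKernel E q a t‖ₑ ^ 2‖ₑ := fun t => by
    rw [enorm_eq_self, enorm_eq_self, ENNReal.rpow_ofNat, hg, enorm_sqrt_sum]
    refine le_trans ?_ (mul_le_mul_right (ENNReal.sum_le_tsum F) _)
    rw [Finset.mul_sum]
    refine Finset.sum_le_sum fun a ha => ?_
    have h1 : |c a| ≤ B / kernelNorm E q a := (le_div_iff₀ (hpos a)).2 (hc a)
    have h2 : ‖u a * ((c a : ℂ) * kernel E a t)‖ ≤ B * (‖u a‖ * ‖normalizedKernel E q a t‖) := by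
      rw [norm_mul, norm_mul, Complex.norm_real, Real.norm_eq_abs, normalizedKernel, norm_div,
        Complex.norm_real, Real.norm_of_nonneg (hpos a).le]
      calc ‖u a‖ * (|c a| * ‖kernel E a t‖)
          ≤ ‖u a‖ * (B / kernelNorm E q a * ‖kernel E a t‖) := by gcongr
        _ = _ := by ring
    have h3 := ENNReal.ofReal_le_ofReal (pow_le_pow_left₀ (norm_nonneg _) h2 2)
    rw [ENNReal.ofReal_pow (norm_nonneg _), ofReal_norm, mul_pow, mul_pow,
      ENNReal.ofReal_mul (by positivity), ENNReal.ofReal_mul (by positivity),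
      ENNReal.ofReal_pow (norm_nonneg _), ENNReal.ofReal_pow (norm_nonneg _), ofReal_norm,
      ofReal_norm] at h3
    rw [hla a ha]
    exact h3
  have h4 := eLpNorm_le_nnreal_smul_eLpNorm_of_ae_le_mul' (ae_of_all σ hpt) (q / 2)
  rw [eLpNorm_enorm_rpow _ two_pos, ENNReal.ofReal_ofNat,
    ENNReal.div_mul_cancel two_ne_zero ENNReal.ofNat_ne_top, ENNReal.rpow_ofNat] at h4
  have h5 : eLpNorm g q σ ^ 2 ≤ ENNReal.ofReal (B * √D * ‖l‖) ^ 2 := by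
    refine (h4.trans (mul_le_mul_right (h l) _)).trans (le_of_eq ?_)
    change ENNReal.ofReal (B ^ 2) * _ = _
    rw [← ENNReal.ofReal_mul (by positivity), ← ENNReal.ofReal_pow (by positivity), mul_pow,
      mul_pow, Real.sq_sqrt hD.le, mul_assoc]
  rw [← hln]
  exact (ENNReal.pow_le_pow_left_iff two_ne_zero).1 h5

/-! ### Synthesis operators -/

/-- The estimate applied to tails of the convergent sum `∑ |ν_a|^s` is the Cauchy criterion for
unconditional convergence. Giving `T` as a `HasSum` allows evaluations to be taken termwise. -/
theorem exists_continuousLinearMap_of_norm_sum_le {ι X : Type*} [NormedAddCommGroup X]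
    [NormedSpace ℂ X] [CompleteSpace X] {s : ℝ≥0∞} [Fact (1 ≤ s)] (hst : s ≠ ∞) {x : ι → X}
    {C : ℝ} (hC : 0 < C)
    (h : ∀ (F : Finset ι) (v : ι → ℂ),
      ‖∑ a ∈ F, v a • x a‖ ≤ C * (∑ a ∈ F, ‖v a‖ ^ s.toReal) ^ s.toReal⁻¹) :
    ∃ T : lp (fun _ : ι => ℂ) s →L[ℂ] X, ∀ ν, HasSum (fun a => ν a • x a) (T ν) := by
  have hsr : 0 < s.toReal := ENNReal.toReal_pos (one_pos.trans_le Fact.out).ne' hst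
  have hsum : ∀ ν : lp (fun _ : ι => ℂ) s, Summable fun a => ν a • x a := fun ν => by
    rw [summable_iff_vanishing_norm]
    intro η hη
    obtain ⟨F, hF⟩ := (summable_iff_vanishing_norm.1 (lp.hasSum_norm hsr ν).summable)
      ((η / C) ^ s.toReal) (by positivity)
    refine ⟨F, fun t ht => (h t ν).trans_lt ?_⟩
    have h1 := hF t ht
    have h0 : 0 ≤ ∑ a ∈ t, ‖ν a‖ ^ s.toReal := by positivity
    rw [Real.norm_of_nonneg h0] at h1
    have h2 := Real.rpow_lt_rpow h0 h1 (inv_pos.2 hsr)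
    rw [Real.rpow_rpow_inv (by positivity) hsr.ne', lt_div_iff₀ hC, mul_comm] at h2
    exact h2
  refine ⟨LinearMap.mkContinuous
    { toFun := fun ν => ∑' a, ν a • x a
      map_add' := fun ν μ => by
        rw [← (hsum ν).tsum_add (hsum μ)]
        exact tsum_congr fun a => by rw [lp.coeFn_add, Pi.add_apply, add_smul]
      map_smul' := fun c ν => by
        rw [RingHom.id_apply, ← tsum_const_smul'']
        exact tsum_congr fun a => by rw [lp.coeFn_smul, Pi.smul_apply, smul_assoc] } C
    fun ν => ?_, fun ν => (hsum ν).hasSum⟩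
  refine le_of_tendsto (hsum ν).hasSum.norm (Eventually.of_forall fun F => (h F ν).trans ?_)
  have h1 : ∑ a ∈ F, ‖ν a‖ ^ s.toReal ≤ ‖ν‖ ^ s.toReal :=
    sum_le_hasSum F (fun a _ => by positivity) (lp.hasSum_norm hsr ν)
  have h2 := Real.rpow_le_rpow (by positivity) h1 (inv_pos.2 hsr).le
  rw [Real.rpow_rpow_inv (norm_nonneg _) hsr.ne'] at h2
  gcongr


/-! ### Interpolation -/

theorem IsInner.kernelNorm_pos {E : ℂ → ℂ} (hE : IsInner E) {p p' : ℝ≥0∞}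
    (h : 1 / p + 1 / p' = 1) {a : Complex.UnitDisc} (ha : 0 < kernelDiag E a) :
    0 < kernelNorm E p' a :=
  (kernelNorm_nonneg E p' a).lt_of_ne' fun h0 => by
    have h1 := hE.kernelDiag_le_mul h a
    rw [h0, mul_zero] at h1
    linarith

/-- The functions `c_a ρ_a k_a^E` interpolate the normalised data at the points of `S`. -/
theorem exists_interpolating_family {I E : ℂ → ℂ} (hI : IsInner I) (hE : IsInner E)
    {S : Set Complex.UnitDisc} {p s p' s' : ℝ≥0∞} [Fact (1 ≤ p)] [Fact (1 ≤ s)] (hsp : s ≤ p)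
    {ρ : S → K p I} (hρ : IsDualSequence p p' I S ρ)
    (hpos : ∀ a : S, 0 < kernelNorm I p' a) (hdiag : ∀ a : S, 0 < kernelDiag E a) :
    ∃ x : S → K s (I * E),
      (∀ a : S, (x a : Lp ℂ s σ) =ᵐ[σ] fun t => (ρ a : Lp ℂ p σ) t *
        (((kernelNorm (I * E) s' a / (kernelNorm I p' a * kernelDiag E a) : ℝ) : ℂ) *
          kernel E a t)) ∧
      (∀ a : S, eval s (I * E) a (x a) = (kernelNorm (I * E) s' a : ℂ)) ∧
      ∀ a b : S, a ≠ b → eval s (I * E) b (x a) = 0 := by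
  choose f hf hfe using fun a : S => exists_mul_kernel_mem hI hE hsp (ρ a) a
  refine ⟨fun a => ((kernelNorm (I * E) s' a / (kernelNorm I p' a * kernelDiag E a) : ℝ) : ℂ) •
    f a, fun a => ?_, fun a => ?_, fun a b hab => ?_⟩
  · filter_upwards [hf a, Lp.coeFn_smul
      ((kernelNorm (I * E) s' a / (kernelNorm I p' a * kernelDiag E a) : ℝ) : ℂ)
      (f a : Lp ℂ s σ)] with t h1 h2
    rw [Submodule.coe_smul, h2, Pi.smul_apply, smul_eq_mul, h1]
    ring
  -- The value of `ρ_a k_a^E` at `a` is `‖k_a^I‖_{p'} k_a^E(a)`, the denominator of the coefficient.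
  · rw [map_smul, hfe, hρ.eval_self, kernelFun_self, smul_eq_mul]
    change _ * (_ * ((kernelDiag E a : ℝ) : ℂ)) = _
    rw [← Complex.ofReal_mul, ← Complex.ofReal_mul,
      div_mul_cancel₀ _ (mul_pos (hpos a) (hdiag a)).ne']
  · rw [map_smul, hfe, hρ.eval_of_ne a b hab, zero_mul, smul_zero]

/-- The random sign bound for the dual sequence and the Carleson condition on the kernels of `E`
give the upper `ℓ^s` estimate for the interpolating family. -/
theorem exists_norm_sum_smul_le {I E : ℂ → ℂ} (hE : IsInner E) (hE₁ : IsOneComponent E)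
    {S : Set Complex.UnitDisc} {p s q p' s' : ℝ≥0∞} [Fact (1 ≤ p)] [Fact (1 ≤ s)]
    (hsp : s < p) (hp : p ≠ ∞) (hq : 1 / s = 1 / p + 1 / q)
    (hp' : 1 / p + 1 / p' = 1) (hs' : 1 / s + 1 / s' = 1)
    (ρ : S → K p I) {Ω : Type*} [MeasurableSpace Ω] {P : Measure Ω} [IsProbabilityMeasure P]
    {ε : S → Ω → ℝ} (hε : IsBernoulliSigns P ε)
    (h₁ : Comparable (fun a : S => kernelNorm (I * E) s' a)
      (fun a : S => kernelNorm E s' a * kernelNorm I p' a / kernelNorm E p' a))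
    (h₂ : RandomSignBound P ε p ρ) (h₃ : 2 < q → WeaklyCarleson q E S)
    (hpos : ∀ a : S, 0 < kernelNorm I p' a)
    (x : S → K s (I * E)) (hx : ∀ a : S, (x a : Lp ℂ s σ) =ᵐ[σ] fun t => (ρ a : Lp ℂ p σ) t *
        (((kernelNorm (I * E) s' a / (kernelNorm I p' a * kernelDiag E a) : ℝ) : ℂ) *
          kernel E a t)) :
    ∃ C : ℝ, 0 < C ∧ ∀ (F : Finset S) (v : S → ℂ),
      ‖∑ a ∈ F, v a • x a‖ ≤ C * (∑ a ∈ F, ‖v a‖ ^ s.toReal) ^ s.toReal⁻¹ := by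
  have hs : 1 ≤ s := Fact.out
  have hp1 : 1 < p := hs.trans_lt hsp
  have hq1 := one_lt_exponent hs hp hq
  have hqt := exponent_ne_top hsp hq
  have hs'1 : 1 < s' := by
    have h0 : 1 / s ≠ 0 := by simpa using hsp.ne_top
    have h2 : 1 / s' ≠ ∞ := fun h => by
      rw [h, add_top] at hs'
      exact ENNReal.top_ne_one hs'
    have h1 : 1 / s' < 1 := calc
      1 / s' < 1 / s' + 1 / s := ENNReal.lt_add_right h2 h0
      _ = 1 := by rw [add_comm, hs']
    rwa [one_div, ENNReal.inv_lt_one] at h1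
  obtain ⟨⟨d, hd, hdiag⟩, -⟩ := exists_kernelNorm_le hE hE₁
  have hN : ∀ a : S, 0 < kernelDiag E a := fun a => hd.trans_le (hdiag a)
  have hqpos : ∀ a : S, 0 < kernelNorm E q a := fun a => by
    -- The exponent conjugate to `q`.
    refine hE.kernelNorm_pos (p := (1 - q⁻¹)⁻¹) ?_ (hN a)
    rw [one_div, one_div, inv_inv, tsub_add_cancel_of_le (ENNReal.inv_le_one.2 hq1.le)]
  obtain ⟨L, hL, hLe⟩ := exists_kernelNorm_mul_le hE hE₁ hp1 hq1 hs'1 hp' (by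
    have e1 := inv_toReal_add_inv_toReal (one_pos.trans hp1).ne' (one_pos.trans hq1).ne' hq
    have e2 := inv_toReal_add_inv_toReal (w := 1) (one_pos.trans_le hs).ne'
      (one_pos.trans hs'1).ne' (by rw [hs', one_div_one])
    rw [ENNReal.toReal_one, inv_one] at e2
    linarith)
  obtain ⟨_, M, -, hM, hcomp⟩ := h₁
  set c : S → ℝ := fun a => kernelNorm (I * E) s' a / (kernelNorm I p' a * kernelDiag E a)
    with hc
  -- The upper half of the comparison (i) cancels `‖k_a^I‖_{p'}`, leaving `‖k_a^E‖_{s'} ‖k_a^E‖_q /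
  -- (‖k_a^E‖_{p'} k_a^E(a))`, a quantity of `E` alone.
  have hcB : ∀ a : S, |c a| * kernelNorm E q a ≤ M * L := fun a => by
    have hkp := hE.kernelNorm_pos hp' (hN a)
    have hD : 0 < kernelNorm I p' a * kernelDiag E a := mul_pos (hpos a) (hN a)
    rw [hc, abs_of_nonneg (div_nonneg (kernelNorm_nonneg _ _ _) hD.le), div_mul_eq_mul_div,
      div_le_iff₀ hD]
    calc kernelNorm (I * E) s' a * kernelNorm E q a
        ≤ M * (kernelNorm E s' a * kernelNorm I p' a / kernelNorm E p' a) * kernelNorm E q a :=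
          mul_le_mul_of_nonneg_right (hcomp a).2 (hqpos a).le
      _ = M * kernelNorm I p' a / kernelNorm E p' a * (kernelNorm E s' a * kernelNorm E q a) := by
          ring
      _ ≤ M * kernelNorm I p' a / kernelNorm E p' a *
          (L * (kernelNorm E p' a * kernelDiag E a)) :=
          mul_le_mul_of_nonneg_left (hLe a) (div_nonneg (mul_nonneg hM.le (hpos a).le) hkp.le)
      _ = M * L * (kernelNorm I p' a * kernelDiag E a) := by field_simp
  have hkm : ∀ a : S, AEStronglyMeasurable (fun t => (c a : ℂ) * kernel E a t) σ := fun a =>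
    (hE.memLp_kernel a q).1.const_mul _
  have hsq : ∃ D : ℝ, 0 < D ∧ ∀ (F : Finset S) (u : S → ℂ),
      eLpNorm (fun t => √(∑ a ∈ F, ‖u a * ((c a : ℂ) * kernel E a t)‖ ^ 2)) q σ ≤
        ENNReal.ofReal (D * (∑ a ∈ F, ‖u a‖ ^ q.toReal) ^ q.toReal⁻¹) := by
    -- For `q ≤ 2` the uniform bound on `‖c_a k_a^E‖_q` is enough; the Carleson condition enters
    -- only beyond `2`.
    rcases le_or_gt q 2 with hq2 | hq2
    · refine ⟨M * L, by positivity, fun F u => eLpNorm_sqrt_sum_le (one_pos.trans hq1).ne' hq2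
        hkm (by positivity) (fun a => ?_) F u⟩
      refine (eLpNorm_const_smul (c a : ℂ) (kernel E a) q σ).le.trans ?_
      rw [← ENNReal.ofReal_toReal (hE.memLp_kernel a q).eLpNorm_ne_top, ← ofReal_norm,
        ← ENNReal.ofReal_mul (norm_nonneg _), Complex.norm_real, Real.norm_eq_abs]
      exact ENNReal.ofReal_le_ofReal (hcB a)
    · exact (h₃ hq2).exists_eLpNorm_sqrt_sum_le hq1 hqt (by positivity) hqpos hcB
  have h₂' : RandomSignBound P ε p fun a => (ρ a : Lp ℂ p σ) := by
    obtain ⟨C, hC, h⟩ := h₂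
    refine ⟨C, hC, fun l F => le_of_eq_of_le (integral_congr_ae (ae_of_all _ fun ω => ?_)) (h l F)⟩
    change _ = ‖((∑ a ∈ F, (l a * (ε a ω : ℂ)) • ρ a : K p I) : Lp ℂ p σ)‖ ^ p.toReal
    rw [Submodule.coe_sum]
    rfl
  obtain ⟨C, hC, hfin⟩ := h₂'.exists_eLpNorm_sum_mul_le hε hs hsp hp hq hp' hkm hsq
  refine ⟨C, hC, fun F v => ?_⟩
  have hae : ((∑ a ∈ F, v a • x a : K s (I * E)) : Lp ℂ s σ) =ᵐ[σ]
      fun t => ∑ a ∈ F, v a * ((ρ a : Lp ℂ p σ) t * ((c a : ℂ) * kernel E a t)) := by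
    have h2 : ∀ᵐ t ∂σ, ∀ a ∈ F, (v a • (x a : Lp ℂ s σ) : Lp ℂ s σ) t =
        v a * ((ρ a : Lp ℂ p σ) t * ((c a : ℂ) * kernel E a t)) := by
      refine (Filter.eventually_all_finset F).2 fun a _ => ?_
      filter_upwards [Lp.coeFn_smul (v a) (x a : Lp ℂ s σ), hx a] with t h3 h4
      rw [h3, Pi.smul_apply, h4, smul_eq_mul]
    rw [Submodule.coe_sum]
    filter_upwards [Lp.coeFn_finsetSum F fun a => (v a • (x a : Lp ℂ s σ) : Lp ℂ s σ), h2]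
      with t h3 h4
    simp only [Submodule.coe_smul]
    rw [h3, Finset.sum_apply]
    exact Finset.sum_congr rfl h4
  rw [Submodule.coe_norm, Lp.norm_def, eLpNorm_congr_ae hae]
  exact ENNReal.toReal_le_of_le_ofReal (by positivity) (hfin F v)

end ModelSpace

end

/-! ### The interpolation theorem -/

theorem mainTheorem3
    (I E : ℂ → ℂ)
    (hI : ModelSpace.IsInner I) (hI₁ : ModelSpace.IsOneComponent I)
    (hE : ModelSpace.IsInner E) (hE₁ : ModelSpace.IsOneComponent E)
    (S : Set Complex.UnitDisc) (hS : S.Countable)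
    (p s q p' s' : ℝ≥0∞) [Fact (1 ≤ p)] [Fact (1 ≤ s)]
    (hsp : s < p) (hp : p ≠ ∞) (hq : 1 / s = 1 / p + 1 / q)
    (hp' : 1 / p + 1 / p' = 1) (hs' : 1 / s + 1 / s' = 1)
    (hdual : ModelSpace.DualBounded p I S)
    (ρ : S → ModelSpace.K p I) (hρ : ModelSpace.IsDualSequence p p' I S ρ)
    {Ω : Type*} [MeasurableSpace Ω] (P : Measure Ω) [IsProbabilityMeasure P]
    (ε : S → Ω → ℝ) (hε : ModelSpace.IsBernoulliSigns P ε)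
    (h₁ : ModelSpace.Comparable
      (fun a : S => ModelSpace.kernelNorm (I * E) s' a)
      (fun a : S => ModelSpace.kernelNorm E s' a * ModelSpace.kernelNorm I p' a /
        ModelSpace.kernelNorm E p' a))
    (h₂ : ModelSpace.RandomSignBound P ε p ρ)
    (h₃ : 2 < q → ModelSpace.WeaklyCarleson q E S) :
    ModelSpace.IsInterpolating s (I * E) S ∧
    ∃ T : lp (fun _ : S => ℂ) s →L[ℂ] ModelSpace.K s (I * E),
      ∀ (ν : lp (fun _ : S => ℂ) s) (a : S),
        ModelSpace.eval s (I * E) a (T ν) =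
          ν a * (ModelSpace.kernelNorm (I * E) s' a : ℂ) := by
  have hst : s ≠ ∞ := hsp.ne_top
  obtain ⟨⟨d, hd, hdI⟩, -⟩ := ModelSpace.exists_kernelNorm_le hI hI₁
  obtain ⟨⟨e, he, hdE⟩, -⟩ := ModelSpace.exists_kernelNorm_le hE hE₁
  have hpos : ∀ a : S, 0 < ModelSpace.kernelNorm I p' a := fun a =>
    hI.kernelNorm_pos hp' (hd.trans_le (hdI a))
  have hdiag : ∀ a : S, 0 < ModelSpace.kernelDiag E a := fun a => he.trans_le (hdE a)
  have hJ := hI.mul hE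
  have hJpos : ∀ a : S, 0 < ModelSpace.kernelNorm (I * E) s' a := fun a => by
    obtain ⟨c, _, hc, -, h⟩ := h₁
    refine lt_of_lt_of_le ?_ (h a).1
    have h1 := hE.kernelNorm_pos hp' (hdiag a)
    have h2 := hE.kernelNorm_pos hs' (hdiag a)
    have h3 := hpos a
    positivity
  obtain ⟨x, hx, hxs, hxn⟩ := ModelSpace.exists_interpolating_family (s' := s') hI hE hsp.le hρ
    hpos hdiag
  obtain ⟨C, hC, hbd⟩ := ModelSpace.exists_norm_sum_smul_le hE hE₁ hsp hp hq hp' hs' ρ hε h₁ h₂ h₃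
    hpos x hx
  have : CompleteSpace (ModelSpace.K s (I * E)) :=
    (ModelSpace.isClosed_K hJ).completeSpace_coe
  obtain ⟨T, hT⟩ := ModelSpace.exists_continuousLinearMap_of_norm_sum_le hst hC hbd
  have hTe : ∀ (ν : lp (fun _ : S => ℂ) s) (a : S), ModelSpace.eval s (I * E) a (T ν) =
      ν a * (ModelSpace.kernelNorm (I * E) s' a : ℂ) := fun ν a => by
    -- Evaluation at `a` is continuous, so it acts on the series termwise, and only the term of
    -- index `a` survives.
    refine (((hT ν).mapL (ModelSpace.eval s (I * E) a)).unique
      (hasSum_single a fun b hb => ?_)).trans ?_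
    · rw [map_smul, hxn b a hb, smul_zero]
    · rw [map_smul, hxs, smul_eq_mul]
  refine ⟨fun v hv => ?_, T, hTe⟩
  have hle : ∀ a : S, ‖v a / (ModelSpace.kernelNorm (I * E) s' a : ℂ)‖ ≤
      ‖v a / (‖ModelSpace.eval s (I * E) a‖ : ℂ)‖ := fun a => by
    -- `x_a` does not vanish at `a`. Were `‖E_a‖` zero, the quotient `v_a / ‖E_a‖` would be `0` by
    -- convention and carry no information on `v_a`.
    have h1 : 0 < ‖ModelSpace.eval s (I * E) a‖ := by
      have h2 := (ModelSpace.eval s (I * E) a).le_opNorm (x a)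
      rw [hxs, Complex.norm_real, Real.norm_of_nonneg (hJpos a).le] at h2
      exact pos_of_mul_pos_left ((hJpos a).trans_le h2) (norm_nonneg _)
    rw [norm_div, norm_div, Complex.norm_real, Complex.norm_real,
      Real.norm_of_nonneg (hJpos a).le, Real.norm_of_nonneg h1.le]
    exact div_le_div_of_nonneg_left (norm_nonneg _) h1 (ModelSpace.norm_eval_le hJ hs' a)
  refine ⟨T ⟨_, hv.mono' hle⟩, fun a => ?_⟩
  rw [hTe]
  exact div_mul_cancel₀ _ (Complex.ofReal_ne_zero.2 (hJpos a).ne')
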